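/- All groupoids are small. A \emph{polynomial in groupoids} $P : I \rightsquigarrow J$ is a diagram of groupoids and functors $$I \xleftarrow{\ s\ } \mathrm{Pm}(P) \xrightarrow{\ p\ } \mathrm{Op}(P) \xrightarrow{\ t\ } J .$$ The objects $c$ of $\mathrm{Op}(P)$ are its \emph{operations}, and the homotopy fibre of $p$ at $c$ is the \emph{total space of parameters} of $c$. The polynomial $P$ is \emph{finitary} if, for each operation $c$, the total space of parameters of $c$ is equivalent to a finite set (viewed as a discrete groupoid). The identity polynomial on $I$ is $I = I = I = I$. For $P : I \rightsquigarrow J$ and $Q : J \rightsquigarrow K$, the composite $P \otimes Q : I \rightsquigarrow K$ has as operations the pairs of an operation $c$ of $Q$ and a functor $\phi$ from the total space of parameters of $c$ to $\mathrm{Op}(P)$, together with a natural isomorphism $t\phi(x) \cong s(x)$; its parameters are the pairs of a parameter $x$ of $c$ and a parameter of $\phi(x)$. An \emph{equivalence} $P \to P'$ of polynomials consists of equivalences of groupoids $\mathrm{Op}(P) \to \mathrm{Op}(P')$ and $\mathrm{Pm}(P) \to \mathrm{Pm}(P')$ together with natural isomorphisms filling the squares formed with $s$, $p$, $t$ (the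 components on $I$ and $J$ being identities). An isomorphism between two equivalences is a pair of natural isomorphisms compatible with these fillers; equivalences and isomorphisms form a groupoid $\mathrm{Eqv}(P,P')$. A \emph{2-cell} is an isomorphism class of equivalences. A 1-cell $P : I \to J$ of a bicategory is an \emph{internal equivalence} if there are $Q, Q' : J \to I$ such that $P \otimes Q \cong \mathrm{id}_I$ and $Q' \otimes P \cong \mathrm{id}_J$. \textbf{Theorem.} (1) With suitable associators and unitors, groupoids, polynomials in groupoids and 2-cells form, with the identities, the composition and the induced whiskerings above, a bicategory with invertible 2-cells, such that: (a) it is cartesian: the empty groupoid is terminal (every category of 1-cells $I \to \emptyset$ is equivalent to the one-point category), and the disjoint union $J \sqcup K$ is a product, in the sense that post-composition with the projections $$J \sqcup K \xleftarrow{\ \mathrm{inl}\ } J = J = J, \qquad J \sqcup K \xleftarrow{\ \mathrm{inr}\ } K = K = K$$ is an equivalence of categories $\mathrm{Hom}(I, J \sqcup K) \simeq \mathrm{Hom}(I,J) \times \mathrm{Hom}(I,K)$, for all $I$, $J$, $K$; the pairing of $P : I \rightsquigarrow J$ and $Q : I \rightsquigarrow K$ is $I \leftarrow \mathrm{Pm}(P)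 \sqcup \mathrm{Pm}(Q) \to \mathrm{Op}(P) \sqcup \mathrm{Op}(Q) \to J \sqcup K$, whose composites with the projections are isomorphic to $P$ and $Q$; (b) for all $I$, $J$, the functor that sends an equivalence of groupoids $f : I \simeq J$ to the polynomial $I = I = I \xrightarrow{f} J$ and a natural isomorphism to the corresponding 2-cell is fully faithful, and its essential image consists exactly of the internal equivalences $I \to J$. (2) Finitary polynomials include the identities, the two projections and the polynomials of equivalences of groupoids in (b), and they are closed under composition and pairing. Consequently the bicategory of (1) restricts to a bicategory with all groupoids as objects, the finitary polynomials as 1-cells and all 2-cells between these, with the same composition, associators and unitors; it has invertible 2-cells, it is cartesian with the same terminal object, products, projections and pairing as in (a), and (b) holds in it. (3) The statements also hold before isomorphic equivalences are identified: for $P, P' : I \rightsquigarrow \emptyset$ the groupoid $\mathrm{Eqv}(P,P')$ is equivalent to a point; for $P, P' : I \rightsquigarrow J \sqcup K$, whiskering with the two projections $\pi_1$, $\pi_2$ is an equivalence of groupoids $\mathrm{Eqv}(P,P') \simeq \mathrm{Eqv}(P \otimes \pi_1, P' \otimes \pi_1) \times \mathrm{Eqv}(P \otimes \pi_2, P' \otimes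 \pi_2)$; and for equivalences $f, g : I \simeq J$ of groupoids, the groupoid of equivalences between their polynomials is equivalent to the discrete groupoid of natural isomorphisms $f \Rightarrow g$. -/

import Mathlib

open CategoryTheory

universe u

/-- The homotopy fibre of a functor `p : E ⥤ B` of groupoids at `b`: objects `pt` of `E` together
with a morphism `path` from `p pt` to `b`. -/
structure HFib {E B : Type u} [Groupoid.{u} E] [Groupoid.{u} B] (p : E ⥤ B) (b : B) : Type u where
  pt : E
  path : p.obj pt ⟶ b

namespace HFib

variable {E B : Type u} [Groupoid.{u} E] [Groupoid.{u} B] {p : E ⥤ B} {b c d : B}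

/-- Morphisms of the homotopy fibre. -/
@[ext]
structure Hom (x y : HFib p b) : Type u where
  pt : x.pt ⟶ y.pt
  path : p.map pt ≫ y.path = x.path

noncomputable instance : Groupoid.{u} (HFib p b) where
  Hom := Hom
  id x := ⟨𝟙 x.pt, by simp⟩
  comp f g := ⟨f.pt ≫ g.pt, by simp [f.path, g.path]⟩
  id_comp f := Hom.ext (Category.id_comp _)
  comp_id f := Hom.ext (Category.comp_id _)
  assoc f g h := Hom.ext (Category.assoc _ _ _)
  inv {x y} f := ⟨inv f.pt, by simp [← f.path]⟩
  inv_comp f := Hom.ext (IsIso.inv_hom_id _)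
  comp_inv f := Hom.ext (IsIso.hom_inv_id _)

@[ext] theorem hom_ext {x y : HFib p b} {f g : x ⟶ y} (h : f.pt = g.pt) : f = g := Hom.ext h
@[simp] theorem id_pt (x : HFib p b) : Hom.pt (𝟙 x) = 𝟙 x.pt := rfl
@[simp] theorem comp_pt {x y z : HFib p b} (f : x ⟶ y) (g : y ⟶ z) :
    (f ≫ g).pt = f.pt ≫ g.pt := rfl
@[simp] theorem inv_pt {x y : HFib p b} (f : x ⟶ y) : (inv f).pt = inv f.pt := by
  rw [← Groupoid.inv_eq_inv f]; rfl
@[simp] theorem hom_path {x y : HFib p b} (f : x ⟶ y) :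
    p.map f.pt ≫ y.path = x.path := f.path
@[simp] theorem hom_path_assoc {x y : HFib p b} (f : x ⟶ y) {e : B} (h : b ⟶ e) :
    p.map f.pt ≫ y.path ≫ h = x.path ≫ h := by
  simpa only [Category.assoc] using congrArg (fun t => t ≫ h) f.path

/-- Morphisms in `E` from a point of the fibre at `b` to a point of the fibre at `c`, lying over
`γ : b ⟶ c`. -/
@[ext]
structure Over (γ : b ⟶ c) (x : HFib p b) (y : HFib p c) : Type u where
  pt : x.pt ⟶ y.pt
  path : p.map pt ≫ y.path = x.path ≫ γ

namespace Over

attribute [simp] Over.path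

@[simp] theorem path_assoc {γ : b ⟶ c} {x : HFib p b} {y : HFib p c} (f : Over γ x y) {e : B}
    (h : c ⟶ e) : p.map f.pt ≫ y.path ≫ h = x.path ≫ γ ≫ h := by
  simpa only [Category.assoc] using congrArg (fun t => t ≫ h) f.path

@[simps] def pre {γ : b ⟶ c} {x' x : HFib p b} {y : HFib p c} (g : x' ⟶ x) (f : Over γ x y) :
    Over γ x' y := ⟨g.pt ≫ f.pt, by simp⟩

@[simps] def post {γ : b ⟶ c} {x : HFib p b} {y y' : HFib p c} (f : Over γ x y) (g : y ⟶ y') :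
    Over γ x y' := ⟨f.pt ≫ g.pt, by simp⟩

@[simps] def comp {γ : b ⟶ c} {δ : c ⟶ d} {x : HFib p b} {y : HFib p c} {z : HFib p d}
    (f : Over γ x y) (g : Over δ y z) : Over (γ ≫ δ) x z := ⟨f.pt ≫ g.pt, by simp⟩

@[simps] noncomputable def symm {γ : b ⟶ c} {x : HFib p b} {y : HFib p c}
    (f : Over (inv γ) y x) : Over γ x y :=
  ⟨inv f.pt, by
    rw [Functor.map_inv, IsIso.inv_comp_eq, f.path_assoc, IsIso.inv_hom_id, Category.comp_id]⟩

@[simps] def cast {γ δ : b ⟶ c} (e : γ = δ) {x : HFib p b} {y : HFib p c} (f : Over γ x y) :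
    Over δ x y := ⟨f.pt, e ▸ f.path⟩

@[simps] def toHom {x y : HFib p b} (f : Over (𝟙 b) x y) : x ⟶ y := ⟨f.pt, by simp⟩

end Over

/-- Transport of points of homotopy fibres along `γ`. -/
abbrev push (γ : b ⟶ c) (x : HFib p b) : HFib p c := ⟨x.pt, x.path ≫ γ⟩

@[simps] def toPush (γ : b ⟶ c) (x : HFib p b) : Over γ x (x.push γ) := ⟨𝟙 x.pt, by simp⟩

@[simps] def Over.fromPush {γ : b ⟶ c} {δ : c ⟶ d} {x : HFib p b} {y : HFib p d}
    (f : Over (γ ≫ δ) x y) : Over δ (x.push γ) y := ⟨f.pt, by simp⟩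

@[simps] def Over.pushHom {γ : b ⟶ c} {x : HFib p b} {y : HFib p c}
    (f : Over γ x y) : x.push γ ⟶ y := ⟨f.pt, by simp⟩

@[simps] def forget (p : E ⥤ B) (b : B) : HFib p b ⥤ E where
  obj x := x.pt
  map f := f.pt

end HFib

/-- A polynomial in groupoids `I ↝ J`, as a diagram of groupoids and functors
`I ←src– Pm –proj→ Op –tgt→ J`. Here `Op` is the total groupoid of operations and `Pm` the total
groupoid of parameters: the operations of type `j` form the homotopy fibre of `tgt` at `j`, and the
parameters of type `i` of an operation `c` form the homotopy fibre of `(src, proj)` at `(i, c)`. -/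
structure GPoly (I J : Type u) [Groupoid.{u} I] [Groupoid.{u} J] : Type (u + 1) where
  Op : Type u
  Pm : Type u
  [opGroupoid : Groupoid.{u} Op]
  [pmGroupoid : Groupoid.{u} Pm]
  src : Pm ⥤ I
  proj : Pm ⥤ Op
  tgt : Op ⥤ J

namespace GPoly

attribute [instance] opGroupoid pmGroupoid

section
variable {I J : Type u} [Groupoid.{u} I] [Groupoid.{u} J]

/-- The total groupoid of all parameters (of whatever type) of the operation `c`. -/
abbrev Params (P : GPoly I J) (c : P.Op) : Type u := HFib P.proj c

/-- A polynomial is finitary when the total groupoid of parameters of each of its operations is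
equivalent to a finite set. -/
def IsFinitary (P : GPoly I J) : Prop :=
  ∀ c : P.Op, ∃ n : ℕ, Nonempty (P.Params c ≌ Discrete (Fin n))

/-- The identity polynomial: one operation of each type, with one parameter of the same type. -/
protected def id (I : Type u) [Groupoid.{u} I] : GPoly I I where
  Op := I
  Pm := I
  src := 𝟭 I
  proj := 𝟭 I
  tgt := 𝟭 I
end

variable {I J K : Type u} [Groupoid.{u} I] [Groupoid.{u} J] [Groupoid.{u} K]

/-- The operations of the composite of `P : I ↝ J` and `Q : J ↝ K`: an operation `oper` of `Q` and a
family of operations of `P` indexed by its parameters, the type of each of them being identified,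
by `typ`, with the type of the parameter. -/
structure CompOp (P : GPoly I J) (Q : GPoly J K) : Type u where
  oper : Q.Op
  fam : Q.Params oper ⥤ P.Op
  typ (x : Q.Params oper) : P.tgt.obj (fam.obj x) ⟶ Q.src.obj x.pt
  typ_naturality {x y : Q.Params oper} (f : x ⟶ y) :
    P.tgt.map (fam.map f) ≫ typ y = typ x ≫ Q.src.map f.pt

namespace CompOp

variable {P : GPoly I J} {Q : GPoly J K}

/-- Morphisms of such pairs: a morphism of operations of `Q`, and a morphism between the families
lying over it, compatible with `typ`. The latter is given by its components at all morphisms of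
parameters over `oper`. -/
structure Hom (o o' : CompOp P Q) : Type u where
  oper : o.oper ⟶ o'.oper
  app {x : Q.Params o.oper} {y : Q.Params o'.oper} (f : HFib.Over oper x y) :
    o.fam.obj x ⟶ o'.fam.obj y
  naturality {x' x : Q.Params o.oper} {y y' : Q.Params o'.oper} (g : x' ⟶ x)
    (f : HFib.Over oper x y) (h : y ⟶ y') :
    o.fam.map g ≫ app f ≫ o'.fam.map h = app ((f.pre g).post h)
  typ {x : Q.Params o.oper} {y : Q.Params o'.oper} (f : HFib.Over oper x y) :
    P.tgt.map (app f) ≫ o'.typ y = o.typ x ≫ Q.src.map f.pt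

theorem typ_naturality_assoc (o : CompOp P Q) {x y : Q.Params o.oper} (f : x ⟶ y) {e : J}
    (h : Q.src.obj y.pt ⟶ e) :
    P.tgt.map (o.fam.map f) ≫ o.typ y ≫ h = o.typ x ≫ Q.src.map f.pt ≫ h := by
  simpa only [Category.assoc] using congrArg (fun t => t ≫ h) (o.typ_naturality f)

namespace Hom

variable {o o' o'' : CompOp P Q}

theorem typ_assoc (k : Hom o o') {x : Q.Params o.oper} {y : Q.Params o'.oper}
    (f : HFib.Over k.oper x y) {e : J} (h : Q.src.obj y.pt ⟶ e) :
    P.tgt.map (k.app f) ≫ o'.typ y ≫ h = o.typ x ≫ Q.src.map f.pt ≫ h := by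
  simpa only [Category.assoc] using congrArg (fun t => t ≫ h) (k.typ f)

theorem map_app (h : Hom o o') {x' x : Q.Params o.oper} {y : Q.Params o'.oper}
    (g : x' ⟶ x) (f : HFib.Over h.oper x y) : o.fam.map g ≫ h.app f = h.app (f.pre g) := by
  have := h.naturality g f (𝟙 y)
  rw [o'.fam.map_id, Category.comp_id] at this
  rw [this]
  congr 1
  ext
  simp

theorem app_map (h : Hom o o') {x : Q.Params o.oper} {y y' : Q.Params o'.oper}
    (f : HFib.Over h.oper x y) (g : y ⟶ y') : h.app f ≫ o'.fam.map g = h.app (f.post g) := by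
  have := h.naturality (𝟙 x) f g
  rw [o.fam.map_id, Category.id_comp] at this
  rw [this]
  congr 1
  ext
  simp

theorem ext' {g h : Hom o o'} (e : g.oper = h.oper)
    (e' : ∀ {x : Q.Params o.oper} {y : Q.Params o'.oper} (f : HFib.Over g.oper x y),
      g.app f = h.app (f.cast e)) : g = h := by
  obtain ⟨a, b, c⟩ := g
  obtain ⟨a', b', c'⟩ := h
  obtain rfl : a = a' := e
  congr 1
  funext x y f
  exact e' f

protected def id (o : CompOp P Q) : Hom o o where
  oper := 𝟙 o.oper
  app f := o.fam.map f.toHom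
  naturality g f h := by
    rw [← o.fam.map_comp, ← o.fam.map_comp]
    congr 1
    ext
    simp
  typ f := o.typ_naturality _

protected def comp (g : Hom o o') (h : Hom o' o'') : Hom o o'' where
  oper := g.oper ≫ h.oper
  app {x y} f := g.app (x.toPush g.oper) ≫ h.app f.fromPush
  naturality {x' x y y'} k f l := by
    have e : o.fam.map k ≫ g.app (x.toPush g.oper) = g.app (x'.toPush g.oper) ≫
          o'.fam.map ((x.toPush g.oper).pre k).pushHom := by
      rw [g.map_app, g.app_map]
      congr 1
      ext
      simp
    rw [Category.assoc, h.app_map, reassoc_of% e, h.map_app]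
    congr 2
    ext
    simp
  typ {x y} f := by
    rw [P.tgt.map_comp, Category.assoc, h.typ, g.typ_assoc, ← Q.src.map_comp]
    simp

theorem app_comp_app (g : Hom o o') (h : Hom o' o'') {x : Q.Params o.oper}
    {y : Q.Params o'.oper} {z : Q.Params o''.oper} (f : HFib.Over g.oper x y)
    (k : HFib.Over h.oper y z) : g.app f ≫ h.app k = (g.comp h).app (f.comp k) := by
  have e : g.app f = g.app (x.toPush g.oper) ≫ o'.fam.map f.pushHom := by
    rw [g.app_map]
    congr 1
    ext
    simp
  rw [e, Category.assoc, h.map_app]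
  rfl

noncomputable def symm (h : Hom o o') : Hom o' o where
  oper := inv h.oper
  app {x y} f := inv (h.app f.symm)
  naturality {x' x y y'} g f k := by
    rw [← IsIso.inv_eq_inv]
    simp only [IsIso.inv_comp, IsIso.inv_inv, ← Functor.map_inv, Category.assoc]
    rw [h.naturality]
    congr 1
    ext
    simp
  typ {x y} f := by
    rw [Functor.map_inv, IsIso.inv_comp_eq, h.typ_assoc, ← Q.src.map_comp]
    simp

end Hom

noncomputable instance : Groupoid.{u} (CompOp P Q) where
  Hom := Hom
  id := Hom.id
  comp := Hom.comp
  id_comp {o o'} h := Hom.ext' (Category.id_comp _) fun f => by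
    refine (h.map_app _ _).trans ?_
    congr 1
    ext
    exact Category.id_comp _
  comp_id {o o'} h := Hom.ext' (Category.comp_id _) fun {x y} f => by
    refine (h.app_map _ _).trans ?_
    congr 1
    ext
    exact Category.id_comp _
  assoc {o₁ o₂ o₃ o₄} f g h := Hom.ext' (Category.assoc _ _ _) fun {x y} k => by
    change (f.app _ ≫ g.app _) ≫ h.app _ = f.app _ ≫ g.app _ ≫ h.app _
    rw [Category.assoc]
    congr 1
    rw [g.app_comp_app, g.app_comp_app]
    congr 1
  inv := Hom.symm
  inv_comp {o o'} h := Hom.ext' (IsIso.inv_hom_id _) fun {x y} f => by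
    change inv (h.app _) ≫ h.app _ = o'.fam.map _
    rw [IsIso.inv_comp_eq, h.app_map]
    congr 1
    ext
    change f.pt = inv (𝟙 x.pt) ≫ f.pt
    simp
  comp_inv {o o'} h := Hom.ext' (IsIso.hom_inv_id _) fun {x y} f => by
    change h.app _ ≫ inv (h.app _) = o.fam.map _
    rw [IsIso.comp_inv_eq, h.map_app]
    congr 1
    ext
    change 𝟙 x.pt = f.pt ≫ inv f.pt
    simp

@[simp] theorem id_oper (o : CompOp P Q) : Hom.oper (𝟙 o) = 𝟙 o.oper := rfl

@[simp] theorem comp_oper {o₁ o₂ o₃ : CompOp P Q} (f : o₁ ⟶ o₂) (g : o₂ ⟶ o₃) :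
    (f ≫ g).oper = f.oper ≫ g.oper := rfl

theorem id_app (o : CompOp P Q) {x y : Q.Params o.oper} (f : HFib.Over (𝟙 o.oper) x y) :
    Hom.app (𝟙 o) f = o.fam.map f.toHom := rfl

theorem app_comp_app {o o' o'' : CompOp P Q} (g : o ⟶ o') (h : o' ⟶ o'') {x : Q.Params o.oper}
    {y : Q.Params o'.oper} {z : Q.Params o''.oper} (f : HFib.Over g.oper x y)
    (k : HFib.Over h.oper y z) : g.app f ≫ h.app k = (g ≫ h).app (f.comp k) :=
  Hom.app_comp_app g h f k

theorem comp_app {o o' o'' : CompOp P Q} (g : o ⟶ o') (h : o' ⟶ o'') {x : Q.Params o.oper}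
    {y : Q.Params o''.oper} (f : HFib.Over (g ≫ h).oper x y) :
    (g ≫ h).app f = g.app (x.toPush g.oper) ≫ h.app (HFib.Over.fromPush f) := rfl

theorem hom_ext {o o' : CompOp P Q} {g h : o ⟶ o'} (e : g.oper = h.oper)
    (e' : ∀ {x : Q.Params o.oper} {y : Q.Params o'.oper} (f : HFib.Over g.oper x y),
      g.app f = h.app (f.cast e)) : g = h :=
  Hom.ext' e e'

theorem app_congr {o o' : CompOp P Q} {g h : o ⟶ o'} (e : g = h) {x : Q.Params o.oper}
    {y : Q.Params o'.oper} (f : HFib.Over g.oper x y) :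
    g.app f = h.app (f.cast (congrArg Hom.oper e)) := by
  subst e; rfl

end CompOp

/-- The parameters of the composite: a parameter `arg` of the operation of `Q`, and a parameter `par` of
the operation of `P` placed there. -/
structure CompPm (P : GPoly I J) (Q : GPoly J K) : Type u where
  oper : CompOp P Q
  arg : Q.Params oper.oper
  par : P.Params (oper.fam.obj arg)

namespace CompPm

variable {P : GPoly I J} {Q : GPoly J K}

/-- Morphisms of parameters of the composite. -/
structure Hom (x y : CompPm P Q) : Type u where
  oper : x.oper ⟶ y.oper
  arg : HFib.Over oper.oper x.arg y.arg
  par : HFib.Over (oper.app arg) x.par y.par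

theorem Hom.ext' {x y : CompPm P Q} {f g : Hom x y} (h₁ : f.oper = g.oper)
    (h₂ : f.arg.pt = g.arg.pt) (h₃ : f.par.pt = g.par.pt) : f = g := by
  obtain ⟨a, ⟨b, hb⟩, ⟨c, hc⟩⟩ := f
  obtain ⟨a', ⟨b', hb'⟩, ⟨c', hc'⟩⟩ := g
  obtain rfl : a = a' := h₁
  obtain rfl : b = b' := h₂
  obtain rfl : c = c' := h₃
  rfl

noncomputable instance : Groupoid.{u} (CompPm P Q) where
  Hom := Hom
  id x :=
    { oper := 𝟙 x.oper
      arg := ⟨𝟙 x.arg.pt, by simp⟩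
      par := ⟨𝟙 x.par.pt, by
        change _ = _ ≫ x.oper.fam.map (𝟙 x.arg)
        simp⟩ }
  comp f g :=
    { oper := f.oper ≫ g.oper
      arg := f.arg.comp g.arg
      par := (f.par.comp g.par).cast (CompOp.app_comp_app _ _ _ _) }
  id_comp f := Hom.ext' (Category.id_comp _) (Category.id_comp _) (Category.id_comp _)
  comp_id f := Hom.ext' (Category.comp_id _) (Category.comp_id _) (Category.comp_id _)
  assoc f g h := Hom.ext' (Category.assoc _ _ _) (Category.assoc _ _ _) (Category.assoc _ _ _)
  inv {x y} f :=
    { oper := Groupoid.inv f.oper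
      arg := HFib.Over.symm (γ := inv f.oper.oper) (x := y.arg) (y := x.arg)
        (f.arg.cast (IsIso.inv_inv).symm)
      par := ⟨inv f.par.pt, by
        change _ = _ ≫ inv (f.oper.app _)
        rw [IsIso.eq_comp_inv, Functor.map_inv, Category.assoc, IsIso.inv_comp_eq, f.par.path]
        congr 2
        ext
        simp⟩ }
  inv_comp f := Hom.ext' (Groupoid.inv_comp f.oper) (IsIso.inv_hom_id _) (IsIso.inv_hom_id _)
  comp_inv f := Hom.ext' (Groupoid.comp_inv f.oper) (IsIso.hom_inv_id _) (IsIso.hom_inv_id _)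

theorem hom_ext {x y : CompPm P Q} {f g : x ⟶ y} (h₁ : f.oper = g.oper)
    (h₂ : f.arg.pt = g.arg.pt) (h₃ : f.par.pt = g.par.pt) : f = g := Hom.ext' h₁ h₂ h₃

@[simp] theorem id_oper (x : CompPm P Q) : Hom.oper (𝟙 x) = 𝟙 x.oper := rfl
@[simp] theorem id_arg (x : CompPm P Q) : (Hom.arg (𝟙 x)).pt = 𝟙 x.arg.pt := rfl
@[simp] theorem id_par (x : CompPm P Q) : (Hom.par (𝟙 x)).pt = 𝟙 x.par.pt := rfl

variable {x y z : CompPm P Q} (f : x ⟶ y) (g : y ⟶ z)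

@[simp] theorem comp_oper : (f ≫ g).oper = f.oper ≫ g.oper := rfl
@[simp] theorem comp_arg : (f ≫ g).arg.pt = f.arg.pt ≫ g.arg.pt := rfl
@[simp] theorem comp_par : (f ≫ g).par.pt = f.par.pt ≫ g.par.pt := rfl

end CompPm

/-- The composite `I ↝ K` of polynomials `P : I ↝ J` and `Q : J ↝ K`. -/
protected noncomputable abbrev comp (P : GPoly I J) (Q : GPoly J K) : GPoly I K where
  Op := CompOp P Q
  Pm := CompPm P Q
  src :=
    { obj := fun x => P.src.obj x.par.pt
      map := fun f => P.src.map f.par.pt }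
  proj :=
    { obj := fun x => x.oper
      map := fun f => f.oper }
  tgt :=
    { obj := fun o => Q.tgt.obj o.oper
      map := fun f => Q.tgt.map f.oper }

/-- An equivalence of polynomials: equivalences on operations and on parameters, compatible with the
structure functors up to given natural isomorphisms. -/
structure Eqv (P P' : GPoly I J) : Type u where
  oper : P.Op ⥤ P'.Op
  pm : P.Pm ⥤ P'.Pm
  [oper_isEquivalence : oper.IsEquivalence]
  [pm_isEquivalence : pm.IsEquivalence]
  src : pm ⋙ P'.src ≅ P.src
  proj : pm ⋙ P'.proj ≅ P.proj ⋙ oper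
  tgt : oper ⋙ P'.tgt ≅ P.tgt

namespace Eqv

attribute [instance] oper_isEquivalence pm_isEquivalence

variable {P P' P'' P''' : GPoly I J}

section
variable (φ : Eqv P P')

theorem src_naturality {x y : P.Pm} (f : x ⟶ y) :
    P'.src.map (φ.pm.map f) ≫ φ.src.hom.app y = φ.src.hom.app x ≫ P.src.map f :=
  φ.src.hom.naturality f

theorem src_naturality_assoc {x y : P.Pm} (f : x ⟶ y) {e : I} (h : P.src.obj y ⟶ e) :
    P'.src.map (φ.pm.map f) ≫ φ.src.hom.app y ≫ h = φ.src.hom.app x ≫ P.src.map f ≫ h := by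
  simpa only [Category.assoc] using congrArg (fun t => t ≫ h) (φ.src_naturality f)

theorem proj_naturality {x y : P.Pm} (f : x ⟶ y) :
    P'.proj.map (φ.pm.map f) ≫ φ.proj.hom.app y
      = φ.proj.hom.app x ≫ φ.oper.map (P.proj.map f) :=
  φ.proj.hom.naturality f

theorem proj_naturality_assoc {x y : P.Pm} (f : x ⟶ y) {e : P'.Op}
    (h : φ.oper.obj (P.proj.obj y) ⟶ e) :
    P'.proj.map (φ.pm.map f) ≫ φ.proj.hom.app y ≫ h
      = φ.proj.hom.app x ≫ φ.oper.map (P.proj.map f) ≫ h := by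
  simpa only [Category.assoc] using congrArg (fun t => t ≫ h) (φ.proj_naturality f)

theorem tgt_naturality {x y : P.Op} (f : x ⟶ y) :
    P'.tgt.map (φ.oper.map f) ≫ φ.tgt.hom.app y = φ.tgt.hom.app x ≫ P.tgt.map f :=
  φ.tgt.hom.naturality f

theorem tgt_naturality_assoc {x y : P.Op} (f : x ⟶ y) {e : J} (h : P.tgt.obj y ⟶ e) :
    P'.tgt.map (φ.oper.map f) ≫ φ.tgt.hom.app y ≫ h = φ.tgt.hom.app x ≫ P.tgt.map f ≫ h := by
  simpa only [Category.assoc] using congrArg (fun t => t ≫ h) (φ.tgt_naturality f)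

end

/-- Isomorphisms between two equivalences of polynomials, that is, identifications of the two. -/
@[ext]
structure Hom (φ ψ : Eqv P P') : Type u where
  oper : φ.oper ⟶ ψ.oper
  pm : φ.pm ⟶ ψ.pm
  src (e : P.Pm) : P'.src.map (pm.app e) ≫ ψ.src.hom.app e = φ.src.hom.app e
  proj (e : P.Pm) : P'.proj.map (pm.app e) ≫ ψ.proj.hom.app e
    = φ.proj.hom.app e ≫ oper.app (P.proj.obj e)
  tgt (b : P.Op) : P'.tgt.map (oper.app b) ≫ ψ.tgt.hom.app b = φ.tgt.hom.app b

theorem Hom.src_assoc {φ ψ : Eqv P P'} (m : Hom φ ψ) (x : P.Pm) {e : I}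
    (h : P.src.obj x ⟶ e) :
    P'.src.map (m.pm.app x) ≫ ψ.src.hom.app x ≫ h = φ.src.hom.app x ≫ h := by
  simpa only [Category.assoc] using congrArg (fun t => t ≫ h) (m.src x)

theorem Hom.proj_assoc {φ ψ : Eqv P P'} (m : Hom φ ψ) (x : P.Pm) {e : P'.Op}
    (h : ψ.oper.obj (P.proj.obj x) ⟶ e) :
    P'.proj.map (m.pm.app x) ≫ ψ.proj.hom.app x ≫ h
      = φ.proj.hom.app x ≫ m.oper.app (P.proj.obj x) ≫ h := by
  simpa only [Category.assoc] using congrArg (fun t => t ≫ h) (m.proj x)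

theorem Hom.tgt_assoc {φ ψ : Eqv P P'} (m : Hom φ ψ) (b : P.Op) {e : J}
    (h : P.tgt.obj b ⟶ e) :
    P'.tgt.map (m.oper.app b) ≫ ψ.tgt.hom.app b ≫ h = φ.tgt.hom.app b ≫ h := by
  simpa only [Category.assoc] using congrArg (fun t => t ≫ h) (m.tgt b)

noncomputable instance : Groupoid.{u} (Eqv P P') where
  Hom := Hom
  id φ := ⟨𝟙 φ.oper, 𝟙 φ.pm, fun _ => by simp, fun _ => by simp, fun _ => by simp⟩
  comp {φ ψ χ} m n := ⟨m.oper ≫ n.oper, m.pm ≫ n.pm,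
    fun e => by simp [n.src, m.src],
    fun e => by simp [n.proj, m.proj_assoc],
    fun b => by simp [n.tgt, m.tgt]⟩
  id_comp m := Hom.ext (Category.id_comp _) (Category.id_comp _)
  comp_id m := Hom.ext (Category.comp_id _) (Category.comp_id _)
  assoc m n k := Hom.ext (Category.assoc _ _ _) (Category.assoc _ _ _)
  inv {φ ψ} m :=
    { oper := { app := fun b => inv (m.oper.app b) }
      pm := { app := fun b => inv (m.pm.app b) }
      src := fun e => by simp [← m.src e]
      proj := fun e => by
        dsimp only
        rw [Functor.map_inv, IsIso.inv_comp_eq, m.proj_assoc]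
        simp
      tgt := fun b => by simp [← m.tgt b] }
  inv_comp m := by
    apply Hom.ext
    · ext b; exact IsIso.inv_hom_id _
    · ext b; exact IsIso.inv_hom_id _
  comp_inv m := by
    apply Hom.ext
    · ext b; exact IsIso.hom_inv_id _
    · ext b; exact IsIso.hom_inv_id _

@[ext] theorem hom_ext {φ ψ : Eqv P P'} {m n : φ ⟶ ψ} (h : Hom.oper m = Hom.oper n)
    (h' : Hom.pm m = Hom.pm n) : m = n := Hom.ext h h'

@[simp] theorem id_oper (φ : Eqv P P') : Hom.oper (𝟙 φ) = 𝟙 φ.oper := rfl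
@[simp] theorem id_pm (φ : Eqv P P') : Hom.pm (𝟙 φ) = 𝟙 φ.pm := rfl
@[simp] theorem comp_oper {φ ψ χ : Eqv P P'} (m : φ ⟶ ψ) (n : ψ ⟶ χ) :
    Hom.oper (m ≫ n) = Hom.oper m ≫ Hom.oper n := rfl
@[simp] theorem comp_pm {φ ψ χ : Eqv P P'} (m : φ ⟶ ψ) (n : ψ ⟶ χ) :
    Hom.pm (m ≫ n) = Hom.pm m ≫ Hom.pm n := rfl

/-- The identity equivalence. -/
protected abbrev refl (P : GPoly I J) : Eqv P P where
  oper := 𝟭 _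
  pm := 𝟭 _
  src := Iso.refl _
  proj := Iso.refl _
  tgt := Iso.refl _

/-- The composite of two equivalences. -/
protected abbrev trans (φ : Eqv P P') (ψ : Eqv P' P'') : Eqv P P'' where
  oper := φ.oper ⋙ ψ.oper
  pm := φ.pm ⋙ ψ.pm
  src := NatIso.ofComponents (fun e => ψ.src.app (φ.pm.obj e) ≪≫ φ.src.app e)
    (fun f => by simp [ψ.src_naturality_assoc, φ.src_naturality])
  proj := NatIso.ofComponents (fun e => ψ.proj.app (φ.pm.obj e) ≪≫ ψ.oper.mapIso (φ.proj.app e))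
    (fun f => by
      dsimp
      rw [ψ.proj_naturality_assoc, Category.assoc, ← ψ.oper.map_comp, ← ψ.oper.map_comp,
        φ.proj_naturality])
  tgt := NatIso.ofComponents (fun e => ψ.tgt.app (φ.oper.obj e) ≪≫ φ.tgt.app e)
    (fun f => by simp [ψ.tgt_naturality_assoc, φ.tgt_naturality])

/-- The horizontal composite of isomorphisms of equivalences. -/
def transHom {φ φ' : Eqv P P'} {ψ ψ' : Eqv P' P''} (m : φ ⟶ φ') (n : ψ ⟶ ψ') :
    φ.trans ψ ⟶ φ'.trans ψ' where
  oper := NatTrans.hcomp m.oper n.oper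
  pm := NatTrans.hcomp m.pm n.pm
  src e := by
    dsimp
    rw [NatTrans.hcomp_app, P''.src.map_comp, Category.assoc, ψ'.src_naturality_assoc, n.src_assoc, m.src]
  proj e := by
    dsimp
    rw [NatTrans.hcomp_app, NatTrans.hcomp_app, P''.proj.map_comp, Category.assoc, ψ'.proj_naturality_assoc, ← ψ'.oper.map_comp, m.proj,
      ψ'.oper.map_comp, n.proj_assoc, Category.assoc, n.oper.naturality_assoc]
  tgt e := by
    dsimp
    rw [NatTrans.hcomp_app, P''.tgt.map_comp, Category.assoc, ψ'.tgt_naturality_assoc, n.tgt_assoc, m.tgt]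

end Eqv

namespace Eqv

variable {P P' P'' : GPoly I J} {Q Q' Q'' : GPoly J K}

section WhiskerRight

variable (η : Eqv P P') (Q)

/-- The counit of a chosen quasi-inverse. -/
noncomputable abbrev counit {C D : Type u} [Groupoid.{u} C] [Groupoid.{u} D] (F : C ⥤ D) [F.IsEquivalence] :
    F.inv ⋙ F ≅ 𝟭 D := F.asEquivalence.counitIso

/-- Right whiskering, on operations. -/
noncomputable abbrev operRight : CompOp P Q ⥤ CompOp P' Q where
  obj o :=
    { oper := o.oper
      fam := o.fam ⋙ η.oper
      typ := fun x => η.tgt.hom.app (o.fam.obj x) ≫ o.typ x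
      typ_naturality := fun f => by
        rw [Functor.comp_map, η.tgt_naturality_assoc, o.typ_naturality, Category.assoc] }
  map h :=
    { oper := h.oper
      app := fun f => η.oper.map (h.app f)
      naturality := fun g f k => by
        rw [Functor.comp_map, Functor.comp_map, ← η.oper.map_comp, ← η.oper.map_comp, h.naturality]
      typ := fun f => by rw [η.tgt_naturality_assoc, h.typ, Category.assoc] }
  map_id o := CompOp.hom_ext rfl fun _ => rfl
  map_comp g h := CompOp.hom_ext rfl fun _ => η.oper.map_comp _ _

instance : (η.operRight Q).Faithful where
  map_injective h :=
    CompOp.hom_ext (congrArg CompOp.Hom.oper h :) fun k =>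
      η.oper.map_injective (CompOp.app_congr h k)

instance : (η.operRight Q).Full where
  map_surjective {o o'} f := ⟨
    { oper := f.oper
      app := fun k => η.oper.preimage (f.app k)
      naturality := fun g k h => η.oper.map_injective (by
        rw [η.oper.map_comp, η.oper.map_comp, η.oper.map_preimage, η.oper.map_preimage]
        exact f.naturality g k h)
      typ := fun {x y} k => by
        have := f.typ k
        rw [← η.oper.map_preimage (f.app k)] at this
        dsimp only [operRight] at this
        rw [η.tgt_naturality_assoc, Category.assoc, cancel_epi] at this
        exact this }, CompOp.hom_ext rfl fun k => η.oper.map_preimage (f.app k)⟩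

noncomputable abbrev operRightLift (o : CompOp P' Q) : CompOp P Q where
  oper := o.oper
  fam := o.fam ⋙ η.oper.inv
  typ x := η.tgt.inv.app _ ≫ P'.tgt.map ((counit η.oper).hom.app (o.fam.obj x)) ≫ o.typ x
  typ_naturality {x y} f := by
    have h₁ := η.tgt.inv.naturality (η.oper.inv.map (o.fam.map f))
    have h₂ := (counit η.oper).hom.naturality (o.fam.map f)
    dsimp only [Functor.comp_map, Functor.comp_obj, Functor.id_map] at h₁ h₂ ⊢
    rw [reassoc_of% h₁, ← P'.tgt.map_comp_assoc, h₂, P'.tgt.map_comp_assoc, o.typ_naturality]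
    simp only [Category.assoc]

noncomputable abbrev operRightLiftHom (o : CompOp P' Q) :
    (η.operRight Q).obj (η.operRightLift Q o) ⟶ o where
  oper := 𝟙 o.oper
  app {x y} f := (counit η.oper).hom.app (o.fam.obj x) ≫ o.fam.map f.toHom
  naturality {x' x y y'} g f h := by
    have h₂ := (counit η.oper).hom.naturality (o.fam.map g)
    dsimp only [operRight, operRightLift, Functor.comp_map, Functor.id_map] at h₂ ⊢
    rw [Category.assoc, reassoc_of% h₂, ← o.fam.map_comp, ← o.fam.map_comp]
    congr 2
    ext
    simp
  typ {x y} f := by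
    dsimp only [operRight, operRightLift]
    rw [P'.tgt.map_comp, Category.assoc, o.typ_naturality, Iso.hom_inv_id_app_assoc,
      Category.assoc]
    rfl

instance : (η.operRight Q).EssSurj where
  mem_essImage o := ⟨η.operRightLift Q o, ⟨asIso (η.operRightLiftHom Q o)⟩⟩

instance : (η.operRight Q).IsEquivalence where

/-- Right whiskering, on parameters. -/
noncomputable abbrev pmRight : CompPm P Q ⥤ CompPm P' Q where
  obj x :=
    { oper := (η.operRight Q).obj x.oper
      arg := x.arg
      par := ⟨η.pm.obj x.par.pt, η.proj.hom.app x.par.pt ≫ η.oper.map x.par.path⟩ }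
  map {x y} h :=
    { oper := (η.operRight Q).map h.oper
      arg := h.arg
      par := ⟨η.pm.map h.par.pt, by
        rw [η.proj_naturality_assoc, ← η.oper.map_comp, h.par.path, η.oper.map_comp,
          Category.assoc]⟩ }
  map_id x := CompPm.hom_ext ((η.operRight Q).map_id _) rfl (η.pm.map_id _)
  map_comp x y := CompPm.hom_ext ((η.operRight Q).map_comp _ _) rfl (η.pm.map_comp _ _)

instance : (η.pmRight Q).Faithful where
  map_injective {_ _} _ _ h := CompPm.hom_ext
    ((η.operRight Q).map_injective (congrArg CompPm.Hom.oper h :))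
    (congrArg (fun k => k.arg.pt) h :) (η.pm.map_injective (congrArg (fun k => k.par.pt) h :))

instance : (η.pmRight Q).Full where
  map_surjective {x y} f := by
    obtain ⟨k, hk⟩ := (η.operRight Q).map_surjective f.oper
    refine ⟨
      { oper := k
        arg := f.arg.cast (congrArg CompOp.Hom.oper hk.symm)
        par := ⟨η.pm.preimage f.par.pt, ?_⟩ }, CompPm.hom_ext hk rfl (η.pm.map_preimage _)⟩
    apply η.oper.map_injective
    have h := f.par.path
    rw [← η.pm.map_preimage f.par.pt] at h
    dsimp only [pmRight] at h
    rw [η.proj_naturality_assoc, Category.assoc, cancel_epi] at h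
    rw [η.oper.map_comp, h, η.oper.map_comp]
    congr 1
    exact CompOp.app_congr hk.symm _

instance : (η.pmRight Q).EssSurj where
  mem_essImage x := by
    obtain ⟨o, ⟨i⟩⟩ := Functor.EssSurj.mem_essImage (F := η.operRight Q) x.oper
    let y : CompPm P Q :=
      { oper := o
        arg := x.arg.push i.inv.oper
        par := ⟨η.pm.inv.obj x.par.pt, η.oper.preimage (η.proj.inv.app _ ≫
          P'.proj.map ((counit η.pm).hom.app x.par.pt) ≫ x.par.path ≫
            i.inv.app (x.arg.toPush i.inv.oper))⟩ }
    let f : x ⟶ (η.pmRight Q).obj y :=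
      { oper := i.inv
        arg := x.arg.toPush i.inv.oper
        par := ⟨(counit η.pm).inv.app x.par.pt, ?_⟩ }
    · exact ⟨y, ⟨(asIso f).symm⟩⟩
    dsimp only [pmRight, y]
    rw [η.oper.map_preimage, Iso.hom_inv_id_app_assoc, ← P'.proj.map_comp_assoc,
      Iso.inv_hom_id_app]
    simp

instance : (η.pmRight Q).IsEquivalence where

/-- The equivalence `P.comp Q → P'.comp Q` induced by `η : P → P'`. -/
noncomputable abbrev whiskerRight : Eqv (P.comp Q) (P'.comp Q) where
  oper := η.operRight Q
  pm := η.pmRight Q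
  src := NatIso.ofComponents (fun x => η.src.app x.par.pt) fun _ => η.src_naturality _
  proj := Iso.refl _
  tgt := Iso.refl _

end WhiskerRight

noncomputable abbrev operRightHom {η η' : Eqv P P'} (m : η ⟶ η') (Q : GPoly J K) (o : CompOp P Q) :
    (η.operRight Q).obj o ⟶ (η'.operRight Q).obj o where
  oper := 𝟙 o.oper
  app {x y} f := m.oper.app (o.fam.obj x) ≫ η'.oper.map (o.fam.map f.toHom)
  naturality {x' x y y'} g f h := by
    dsimp only [operRight, Functor.comp_map]
    rw [Category.assoc, m.oper.naturality_assoc, ← η'.oper.map_comp, ← η'.oper.map_comp,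
      ← o.fam.map_comp, ← o.fam.map_comp]
    congr 3
    ext
    simp
  typ {x y} f := by
    dsimp only [operRight]
    rw [P'.tgt.map_comp, Category.assoc, η'.tgt_naturality_assoc, o.typ_naturality,
      m.tgt_assoc, Category.assoc]
    rfl

theorem operRightHom_naturality {η η' : Eqv P P'} (m : η ⟶ η') (Q : GPoly J K)
    {o o' : CompOp P Q} (h : o ⟶ o') : (η.operRight Q).map h ≫ operRightHom m Q o'
      = operRightHom m Q o ≫ (η'.operRight Q).map h := by
  refine CompOp.hom_ext ((Category.comp_id _).trans (Category.id_comp _).symm) fun {x y} f => ?_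
  rw [CompOp.comp_app, CompOp.comp_app]
  dsimp only
  rw [m.oper.naturality_assoc, ← η'.oper.map_comp, Category.assoc, ← η'.oper.map_comp,
    h.app_map, h.map_app]
  congr 3

/-- Right whiskering of an isomorphism of equivalences. -/
noncomputable abbrev whiskerRightHom {η η' : Eqv P P'} (m : η ⟶ η') (Q : GPoly J K) :
    η.whiskerRight Q ⟶ η'.whiskerRight Q where
  oper :=
    { app := operRightHom m Q
      naturality := fun _ _ h => operRightHom_naturality m Q h }
  pm :=
    { app := fun x =>
        { oper := operRightHom m Q x.oper
          arg := ⟨𝟙 x.arg.pt, by simp⟩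
          par := ⟨m.pm.app x.par.pt, by
            have e : x.oper.fam.map (HFib.Over.toHom ⟨𝟙 x.arg.pt, by simp⟩) = 𝟙 _ :=
              x.oper.fam.map_id x.arg
            dsimp only
            rw [m.proj_assoc, ← m.oper.naturality, Category.assoc, e, η'.oper.map_id,
              Category.comp_id]⟩ }
      naturality := fun x y f => CompPm.hom_ext (operRightHom_naturality m Q f.oper)
        ((Category.comp_id _).trans (Category.id_comp _).symm) (m.pm.naturality _) }
  src := fun x => m.src x.par.pt
  proj := fun _ => (Category.comp_id _).trans (Category.id_comp _).symm
  tgt := fun o => (Category.comp_id _).trans (Q.tgt.map_id o.oper)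

variable (P P') in
/-- Right whiskering with `Q`, as a functor between the groupoids of equivalences. -/
noncomputable def whiskerRightFunctor (Q : GPoly J K) :
    Eqv P P' ⥤ Eqv (P.comp Q) (P'.comp Q) where
  obj η := η.whiskerRight Q
  map m := whiskerRightHom m Q
  map_id η := by
    have h (o : CompOp P Q) : operRightHom (𝟙 η) Q o = 𝟙 ((η.operRight Q).obj o) :=
      CompOp.hom_ext rfl fun _ => Category.id_comp _
    apply Eqv.hom_ext
    · ext o
      exact h o
    · ext x
      exact CompPm.hom_ext (h x.oper) rfl rfl
  map_comp {η η' η''} m n := by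
    have h (o : CompOp P Q) :
        operRightHom (m ≫ n) Q o = operRightHom m Q o ≫ operRightHom n Q o := by
      refine CompOp.hom_ext (Category.comp_id _).symm fun {x y} f => ?_
      rw [CompOp.comp_app]
      have e : o.fam.map (HFib.Over.toHom (x.toPush (𝟙 o.oper))) ≫
          o.fam.map (HFib.Over.toHom (HFib.Over.fromPush (f.cast (Category.comp_id _).symm)))
            = o.fam.map f.toHom := by
        rw [← o.fam.map_comp]
        congr 1
        ext
        simp
      change (m.oper.app _ ≫ n.oper.app _) ≫ η''.oper.map _
        = (m.oper.app _ ≫ η'.oper.map _) ≫ n.oper.app _ ≫ η''.oper.map _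
      rw [← e, Category.assoc, Category.assoc, n.oper.naturality_assoc, η''.oper.map_comp]
      rfl
    apply Eqv.hom_ext
    · ext o
      exact h o
    · ext x
      exact CompPm.hom_ext (h x.oper) (Category.comp_id _).symm rfl

end Eqv

namespace Eqv

section Fibre

variable {P P' : GPoly I J} (η : Eqv P P') {c d : P.Op}

/-- The action of an equivalence of polynomials on the parameters of an operation. -/
abbrev fib (x : P.Params c) : P'.Params (η.oper.obj c) :=
  ⟨η.pm.obj x.pt, η.proj.hom.app x.pt ≫ η.oper.map x.path⟩

/-- The action on morphisms of parameters over a morphism of operations. -/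
@[simps] def fibOver {γ : c ⟶ d} {x : P.Params c} {y : P.Params d} (f : HFib.Over γ x y) :
    HFib.Over (η.oper.map γ) (η.fib x) (η.fib y) :=
  ⟨η.pm.map f.pt, by
    rw [η.proj_naturality_assoc, ← η.oper.map_comp, f.path, η.oper.map_comp, Category.assoc]⟩

noncomputable def unfibOver {γ : c ⟶ d} {x : P.Params c} {y : P.Params d}
    (f : HFib.Over (η.oper.map γ) (η.fib x) (η.fib y)) : HFib.Over γ x y :=
  ⟨η.pm.preimage f.pt, η.oper.map_injective (by
    have h := f.path
    rw [← η.pm.map_preimage f.pt, η.proj_naturality_assoc, Category.assoc, cancel_epi] at h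
    rw [η.oper.map_comp, h, η.oper.map_comp])⟩

@[simp] theorem map_unfibOver {γ : c ⟶ d} {x : P.Params c} {y : P.Params d}
    (f : HFib.Over (η.oper.map γ) (η.fib x) (η.fib y)) : η.pm.map (η.unfibOver f).pt = f.pt :=
  η.pm.map_preimage _

variable (c) in
abbrev fibFunctor : P.Params c ⥤ P'.Params (η.oper.obj c) where
  obj x := η.fib x
  map f := ⟨η.pm.map f.pt, by
    rw [η.proj_naturality_assoc, ← η.oper.map_comp, f.path]⟩

instance : (η.fibFunctor c).Faithful where
  map_injective h := HFib.hom_ext (η.pm.map_injective (congrArg HFib.Hom.pt h :))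

instance : (η.fibFunctor c).Full where
  map_surjective {x y} f := ⟨⟨η.pm.preimage f.pt, η.oper.map_injective (by
    have h := f.path
    rw [← η.pm.map_preimage f.pt, η.proj_naturality_assoc, cancel_epi] at h
    rw [η.oper.map_comp, h])⟩, HFib.hom_ext (η.pm.map_preimage _)⟩

instance : (η.fibFunctor c).EssSurj where
  mem_essImage x := by
    let y : P.Params c := ⟨η.pm.inv.obj x.pt, η.oper.preimage (η.proj.inv.app _ ≫
      P'.proj.map ((counit η.pm).hom.app x.pt) ≫ x.path)⟩
    let f : (η.fibFunctor c).obj y ⟶ x := ⟨(counit η.pm).hom.app x.pt, ?_⟩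
    · exact ⟨y, ⟨asIso f⟩⟩
    dsimp only [y]
    rw [η.oper.map_preimage, Iso.hom_inv_id_app_assoc]

instance : (η.fibFunctor c).IsEquivalence where

variable (c) in
/-- A quasi-inverse of the action on the parameters of `c`. -/
noncomputable def unfib : P'.Params (η.oper.obj c) ⥤ P.Params c := (η.fibFunctor c).inv

/-- The counit of the quasi-inverse. -/
noncomputable def cu (x : P'.Params (η.oper.obj c)) : η.fib ((η.unfib c).obj x) ⟶ x :=
  (counit (η.fibFunctor c)).hom.app x

theorem cu_naturality {x y : P'.Params (η.oper.obj c)} (f : x ⟶ y) :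
    η.pm.map ((η.unfib c).map f).pt ≫ (η.cu y).pt = (η.cu x).pt ≫ f.pt :=
  congrArg HFib.Hom.pt ((counit (η.fibFunctor c)).hom.naturality f)

theorem cu_naturality_assoc {x y : P'.Params (η.oper.obj c)} (f : x ⟶ y) {e : P'.Pm}
    (h : y.pt ⟶ e) :
    η.pm.map ((η.unfib c).map f).pt ≫ (η.cu y).pt ≫ h = (η.cu x).pt ≫ f.pt ≫ h := by
  simpa only [Category.assoc] using congrArg (fun t => t ≫ h) (η.cu_naturality f)

/-- The unit of the quasi-inverse. -/
noncomputable def un (x : P.Params c) : x ⟶ (η.unfib c).obj (η.fib x) :=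
  (η.fibFunctor c).preimage (inv (η.cu (η.fib x)))

@[simp] theorem map_un (x : P.Params c) : η.pm.map (η.un x).pt = inv (η.cu (η.fib x)).pt := by
  have h := congrArg HFib.Hom.pt ((η.fibFunctor c).map_preimage (inv (η.cu (η.fib x))))
  rw [HFib.inv_pt] at h
  exact h

theorem map_cu_inv (x : P'.Params (η.oper.obj c)) :
    (η.unfib c).map (inv (η.cu x)) = η.un ((η.unfib c).obj x) := by
  apply HFib.hom_ext
  apply η.pm.map_injective
  rw [map_un]
  apply IsIso.eq_inv_of_inv_hom_id
  rw [η.cu_naturality, HFib.inv_pt, IsIso.hom_inv_id]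

/-- The quasi-inverse on morphisms of parameters over a morphism of operations. -/
noncomputable def lower {γ : c ⟶ d} {x : P'.Params (η.oper.obj c)} {y : P'.Params (η.oper.obj d)}
    (f : HFib.Over (η.oper.map γ) x y) :
    HFib.Over γ ((η.unfib c).obj x) ((η.unfib d).obj y) :=
  η.unfibOver ((f.pre (η.cu x)).post (inv (η.cu y)))

@[simp] theorem map_lower {γ : c ⟶ d} {x : P'.Params (η.oper.obj c)}
    {y : P'.Params (η.oper.obj d)} (f : HFib.Over (η.oper.map γ) x y) :
    η.pm.map (η.lower f).pt = (η.cu x).pt ≫ f.pt ≫ inv (η.cu y).pt := by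
  rw [lower, map_unfibOver]
  simp

theorem over_ext {c d : P.Op} {γ : c ⟶ d} {x : P.Params c} {y : P.Params d}
    {f g : HFib.Over γ x y} (h : η.pm.map f.pt = η.pm.map g.pt) : f = g :=
  HFib.Over.ext (η.pm.map_injective h)

theorem lower_pre_post {γ : c ⟶ d} {x x' : P'.Params (η.oper.obj c)}
    {y y' : P'.Params (η.oper.obj d)} (g : x' ⟶ x) (f : HFib.Over (η.oper.map γ) x y)
    (k : y ⟶ y') : ((η.lower f).pre ((η.unfib c).map g)).post ((η.unfib d).map k)
      = η.lower ((f.pre g).post k) := by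
  apply η.over_ext
  rw [map_lower, HFib.Over.post_pt, HFib.Over.pre_pt, η.pm.map_comp, η.pm.map_comp, map_lower,
    ← cancel_mono (η.cu y').pt, Category.assoc, Category.assoc, η.cu_naturality]
  simp [η.cu_naturality_assoc]

theorem lower_comp {e : P.Op} {γ : c ⟶ d} {δ : d ⟶ e} {x : P'.Params (η.oper.obj c)}
    {y : P'.Params (η.oper.obj d)} {z : P'.Params (η.oper.obj e)}
    (f : HFib.Over (η.oper.map γ) x y) (g : HFib.Over (η.oper.map δ) y z) :
    (η.lower f).comp (η.lower g) = η.lower ((f.comp g).cast (η.oper.map_comp _ _).symm) := by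
  apply η.over_ext
  rw [map_lower, HFib.Over.comp_pt, η.pm.map_comp, map_lower, map_lower]
  simp

theorem un_comp_lower {γ : c ⟶ d} {x : P.Params c} {y : P.Params d} (f : HFib.Over γ x y) :
    (η.lower (η.fibOver f)).pre (η.un x) = f.post (η.un y) := by
  apply η.over_ext
  rw [HFib.Over.pre_pt, HFib.Over.post_pt, η.pm.map_comp, η.pm.map_comp, map_lower, map_un,
    map_un]
  simp

end Fibre

section WhiskerLeft

variable (P : GPoly I J) {Q Q' : GPoly J K} (η : Eqv Q Q') {c : Q.Op}

noncomputable abbrev operLeftObj (o : CompOp P Q) : CompOp P Q' where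
  oper := η.oper.obj o.oper
  fam := η.unfib o.oper ⋙ o.fam
  typ x := o.typ ((η.unfib o.oper).obj x) ≫ η.src.inv.app _ ≫ Q'.src.map (η.cu x).pt
  typ_naturality {x y} f := by
    have h := η.src.inv.naturality ((η.unfib o.oper).map f).pt
    dsimp only [Functor.comp_map, Functor.comp_obj] at h ⊢
    rw [o.typ_naturality_assoc, reassoc_of% h, ← Q'.src.map_comp, η.cu_naturality,
      Q'.src.map_comp, Category.assoc, Category.assoc]

noncomputable abbrev operLeftMap {o o' : CompOp P Q} (h : o ⟶ o') :
    η.operLeftObj P o ⟶ η.operLeftObj P o' where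
  oper := η.oper.map h.oper
  app f := h.app (η.lower f)
  naturality g f k := by
    dsimp only [Functor.comp_map]
    rw [h.naturality, lower_pre_post]
  typ {x y} f := by
    have e := η.src.inv.naturality (η.lower f).pt
    dsimp only [Functor.comp_map, Functor.comp_obj] at e ⊢
    rw [h.typ_assoc, reassoc_of% e, ← Q'.src.map_comp, map_lower]
    simp only [Category.assoc, IsIso.inv_hom_id, Category.comp_id, Q'.src.map_comp]

theorem lower_toHom {x y : Q'.Params (η.oper.obj c)} (f : HFib.Over (η.oper.map (𝟙 c)) x y) :
    (η.lower f).toHom = (η.unfib c).map (f.cast (η.oper.map_id c)).toHom := by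
  apply HFib.hom_ext
  apply η.pm.map_injective
  rw [HFib.Over.toHom_pt, map_lower, ← cancel_mono (η.cu _).pt, η.cu_naturality]
  simp

/-- Left whiskering, on operations: parameters are transported back along `η`. -/
noncomputable abbrev operLeft : CompOp P Q ⥤ CompOp P Q' where
  obj := η.operLeftObj P
  map := η.operLeftMap P
  map_id o := CompOp.hom_ext (η.oper.map_id _) fun f =>
    congrArg o.fam.map (η.lower_toHom f)
  map_comp {o₁ o₂ o₃} g h := CompOp.hom_ext (η.oper.map_comp _ _) fun {x y} f => by
    refine Eq.trans ?_ (CompOp.app_comp_app g h _ _).symm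
    rw [lower_comp]
    change (g ≫ h).app _ = _
    congr 2
    ext
    simp
    rfl

theorem app_eq {o o' : CompOp P Q} (h : o ⟶ o') {x : Q.Params o.oper} {y : Q.Params o'.oper}
    (f : HFib.Over h.oper x y) :
    h.app f = o.fam.map (η.un x) ≫ h.app (η.lower (η.fibOver f)) ≫ o'.fam.map (inv (η.un y)) := by
  rw [h.app_map, h.map_app]
  congr 1
  apply η.over_ext
  simp

instance : (η.operLeft P).Faithful where
  map_injective {o o'} f g h := CompOp.hom_ext
    (η.oper.map_injective (congrArg CompOp.Hom.oper h :)) fun {x y} k => by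
      rw [η.app_eq P f, η.app_eq P g]
      congr 2
      exact CompOp.app_congr h (η.fibOver k)

theorem un_naturality {x y : Q.Params c} (f : x ⟶ y) :
    f ≫ η.un y = η.un x ≫ (η.unfib c).map ((η.fibFunctor c).map f) := by
  apply HFib.hom_ext
  apply η.pm.map_injective
  rw [HFib.comp_pt, HFib.comp_pt, η.pm.map_comp, η.pm.map_comp, map_un, map_un,
    ← cancel_mono (η.cu _).pt, Category.assoc, Category.assoc, η.cu_naturality]
  simp

theorem un_typ (o : CompOp P Q) (x : Q.Params o.oper) :
    P.tgt.map (o.fam.map (η.un x)) ≫ (η.operLeftObj P o).typ (η.fib x)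
      = o.typ x ≫ η.src.inv.app x.pt := by
  have e := η.src.inv.naturality (η.un x).pt
  dsimp only [Functor.comp_map, Functor.comp_obj] at e ⊢
  rw [o.typ_naturality_assoc, reassoc_of% e, ← Q'.src.map_comp, map_un, IsIso.inv_hom_id,
    Q'.src.map_id]
  exact congrArg _ (Category.comp_id _)

theorem un_fam (o : CompOp P Q) {x' x : Q.Params o.oper} (g : x' ⟶ x) :
    o.fam.map g ≫ o.fam.map (η.un x)
      = o.fam.map (η.un x') ≫ (η.operLeftObj P o).fam.map ((η.fibFunctor _).map g) := by
  rw [← o.fam.map_comp, un_naturality, o.fam.map_comp]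
  rfl

theorem un_fam_inv (o : CompOp P Q) {x' x : Q.Params o.oper} (g : x' ⟶ x) :
    o.fam.map (inv (η.un x')) ≫ o.fam.map g
      = (η.operLeftObj P o).fam.map ((η.fibFunctor _).map g) ≫ o.fam.map (inv (η.un x)) := by
  rw [Functor.map_inv, Functor.map_inv, IsIso.inv_comp_eq, ← Category.assoc, IsIso.eq_comp_inv,
    un_fam]

noncomputable abbrev operLeftPreimage {o o' : CompOp P Q}
    (F : η.operLeftObj P o ⟶ η.operLeftObj P o') : o ⟶ o' where
  oper := η.oper.preimage F.oper
  app {x y} k := o.fam.map (η.un x) ≫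
    F.app ((η.fibOver k).cast (η.oper.map_preimage _)) ≫ o'.fam.map (inv (η.un y))
  naturality {x' x y y'} g k h := by
    have e := congrArg (fun z => o.fam.map (η.un x') ≫ z ≫ o'.fam.map (inv (η.un y')))
      (F.naturality ((η.fibFunctor o.oper).map g)
        ((η.fibOver k).cast (η.oper.map_preimage _)) ((η.fibFunctor o'.oper).map h))
    simp only [Category.assoc] at e ⊢
    rw [η.un_fam_inv P o' h, ← Category.assoc (o.fam.map g), η.un_fam P o g, Category.assoc]
    refine e.trans ?_
    congr 3
    ext
    simp
  typ {x y} k := by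
    rw [← cancel_mono (η.src.inv.app y.pt), Category.assoc, ← un_typ, P.tgt.map_comp,
      P.tgt.map_comp, Category.assoc, Category.assoc, ← P.tgt.map_comp_assoc (o'.fam.map _),
      ← o'.fam.map_comp, IsIso.inv_hom_id, o'.fam.map_id, P.tgt.map_id, Category.id_comp]
    have e := η.src.inv.naturality k.pt
    dsimp only [Functor.comp_map, Functor.comp_obj] at e
    refine (congrArg (fun z => _ ≫ z) (F.typ _)).trans ?_
    rw [← Category.assoc, un_typ, Category.assoc, Category.assoc, e]
    rfl

instance : (η.operLeft P).Full where
  map_surjective {o o'} F := ⟨η.operLeftPreimage P F,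
    CompOp.hom_ext (η.oper.map_preimage _) fun {x y} f => by
      change o.fam.map (η.un _) ≫ F.app _ ≫ o'.fam.map (inv (η.un _)) = _
      simp only [← η.map_cu_inv, ← Functor.map_inv, IsIso.inv_inv]
      refine (F.naturality (inv (η.cu x)) _ (η.cu y)).trans ?_
      congr 1
      ext
      simp⟩

/-- Transport of parameters. -/
abbrev fibPush {d : Q'.Op} (i : η.oper.obj c ⟶ d) : Q.Params c ⥤ Q'.Params d where
  obj x := (η.fib x).push i
  map {x y} f := ⟨η.pm.map f.pt, by
    have h := ((η.fibFunctor c).map f).path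
    dsimp only at h ⊢
    rw [← Category.assoc, h]⟩

noncomputable abbrev operLeftLift (o : CompOp P Q') (c : Q.Op) (i : η.oper.obj c ⟶ o.oper) :
    CompOp P Q where
  oper := c
  fam := η.fibPush i ⋙ o.fam
  typ x := o.typ ((η.fib x).push i) ≫ η.src.hom.app x.pt
  typ_naturality {x y} f := by
    dsimp only [Functor.comp_map, Functor.comp_obj]
    rw [o.typ_naturality_assoc, Category.assoc]
    dsimp only
    rw [η.src_naturality]

noncomputable abbrev cuOver {d : Q'.Op} (i : η.oper.obj c ⟶ d) {x : Q'.Params (η.oper.obj c)}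
    {y : Q'.Params d} (f : HFib.Over i x y) : (η.fib ((η.unfib c).obj x)).push i ⟶ y :=
  ⟨(η.cu x).pt ≫ f.pt, by
    have h := (η.cu x).path
    dsimp only at h ⊢
    rw [Q'.proj.map_comp, Category.assoc, f.path, ← Category.assoc, h]⟩

noncomputable abbrev operLeftLiftHom (o : CompOp P Q') (c : Q.Op) (i : η.oper.obj c ⟶ o.oper) :
    η.operLeftObj P (η.operLeftLift P o c i) ⟶ o where
  oper := i
  app {x y} f := o.fam.map (η.cuOver i f)
  naturality {x' x y y'} g f h := by
    dsimp only [Functor.comp_map]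
    rw [← o.fam.map_comp, ← o.fam.map_comp]
    congr 1
    ext
    simp [η.cu_naturality_assoc]
  typ {x y} f := by
    dsimp only [Functor.comp_obj]
    rw [o.typ_naturality, Q'.src.map_comp]
    simp

instance : (η.operLeft P).EssSurj where
  mem_essImage o := ⟨η.operLeftLift P o _ (η.oper.objObjPreimageIso o.oper).hom,
    ⟨asIso (η.operLeftLiftHom P o _ _)⟩⟩

instance : (η.operLeft P).IsEquivalence where

theorem un_fam_app {o o' : CompOp P Q} (h : o ⟶ o') {x : Q.Params o.oper} {y : Q.Params o'.oper}
    (f : HFib.Over h.oper x y) : h.app f ≫ o'.fam.map (η.un y)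
      = o.fam.map (η.un x) ≫ h.app (η.lower (η.fibOver f)) := by
  rw [h.map_app, h.app_map, un_comp_lower]

noncomputable abbrev pmLeftObj (x : CompPm P Q) : CompPm P Q' where
  oper := η.operLeftObj P x.oper
  arg := η.fib x.arg
  par := x.par.push (x.oper.fam.map (η.un x.arg))

noncomputable abbrev pmLeftMap {x y : CompPm P Q} (h : x ⟶ y) :
    η.pmLeftObj P x ⟶ η.pmLeftObj P y where
  oper := η.operLeftMap P h.oper
  arg := η.fibOver h.arg
  par := ⟨h.par.pt, by
    dsimp only
    rw [h.par.path_assoc, Category.assoc, un_fam_app]⟩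

/-- Left whiskering, on parameters. -/
noncomputable abbrev pmLeft : CompPm P Q ⥤ CompPm P Q' where
  obj := η.pmLeftObj P
  map := η.pmLeftMap P
  map_id _ := CompPm.hom_ext ((η.operLeft P).map_id _) (η.pm.map_id _) rfl
  map_comp _ _ := CompPm.hom_ext ((η.operLeft P).map_comp _ _) (η.pm.map_comp _ _) rfl

instance : (η.pmLeft P).Faithful where
  map_injective {_ _} _ _ h := CompPm.hom_ext
    ((η.operLeft P).map_injective (congrArg CompPm.Hom.oper h :))
    (η.pm.map_injective (congrArg (fun k => k.arg.pt) h :)) (congrArg (fun k => k.par.pt) h :)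

instance : (η.pmLeft P).Full where
  map_surjective {x y} f := by
    obtain ⟨k, hk⟩ := (η.operLeft P).map_surjective f.oper
    have e : f.oper.oper = η.oper.map k.oper := congrArg CompOp.Hom.oper hk.symm
    refine ⟨
      { oper := k
        arg := η.unfibOver (f.arg.cast e)
        par := ⟨f.par.pt, ?_⟩ }, CompPm.hom_ext hk (η.map_unfibOver _) rfl⟩
    have h := f.par.path
    dsimp only at h
    rw [← cancel_mono (y.oper.fam.map (η.un y.arg)), Category.assoc, h, Category.assoc,
      Category.assoc, un_fam_app, CompOp.app_congr hk.symm f.arg]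
    congr 2
    change k.app _ = k.app _
    congr 1
    apply η.over_ext
    rw [map_lower, map_lower, fibOver_pt, map_unfibOver]

instance : (η.pmLeft P).EssSurj where
  mem_essImage x := by
    obtain ⟨o, ⟨i⟩⟩ := Functor.EssSurj.mem_essImage (F := η.operLeft P) x.oper
    let a : Q'.Params (η.oper.obj o.oper) := x.arg.push i.inv.oper
    let y : CompPm P Q :=
      { oper := o
        arg := (η.unfib _).obj a
        par := x.par.push (i.inv.app (x.arg.toPush i.inv.oper)) }
    let f : x ⟶ (η.pmLeft P).obj y :=
      { oper := i.inv
        arg := (x.arg.toPush i.inv.oper).post (inv (η.cu a))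
        par := ⟨𝟙 x.par.pt, ?_⟩ }
    · exact ⟨y, ⟨(asIso f).symm⟩⟩
    dsimp only [pmLeft, pmLeftObj, y]
    rw [P.proj.map_id, Category.id_comp, ← i.inv.app_map, ← map_cu_inv, Category.assoc]
    rfl

instance : (η.pmLeft P).IsEquivalence where

/-- The equivalence `P.comp Q → P.comp Q'` induced by `η : Q → Q'`. -/
noncomputable abbrev whiskerLeft : Eqv (P.comp Q) (P.comp Q') where
  oper := η.operLeft P
  pm := η.pmLeft P
  src := Iso.refl _
  proj := Iso.refl _
  tgt := NatIso.ofComponents (fun o => η.tgt.app o.oper) fun _ => η.tgt_naturality _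

end WhiskerLeft

section WhiskerLeftHom

variable (P : GPoly I J) {Q Q' : GPoly J K} {η η' : Eqv Q Q'} (m : η ⟶ η') {c : Q.Op}

abbrev shift (x : Q.Params c) : HFib.Over (m.oper.app c) (η.fib x) (η'.fib x) :=
  ⟨m.pm.app x.pt, by
    rw [m.proj_assoc, ← m.oper.naturality, Category.assoc]⟩

noncomputable def mlower {x : Q'.Params (η.oper.obj c)} {y : Q'.Params (η'.oper.obj c)}
    (f : HFib.Over (m.oper.app c) x y) : (η.unfib c).obj x ⟶ (η'.unfib c).obj y :=
  (η'.fibFunctor c).preimage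
    ⟨inv (m.pm.app _) ≫ (η.cu x).pt ≫ f.pt ≫ inv (η'.cu y).pt, by
      have h₁ := (η.cu x).path
      have h₂ := (inv (η'.cu y)).path
      have h₃ := (shift m ((η.unfib c).obj x)).path
      rw [HFib.inv_pt] at h₂
      dsimp only at h₁ h₂ h₃ ⊢
      rw [Q'.proj.map_comp, Q'.proj.map_comp, Q'.proj.map_comp, Functor.map_inv, Category.assoc,
        Category.assoc, Category.assoc, h₂, f.path, ← Category.assoc (Q'.proj.map (η.cu x).pt),
        h₁, ← h₃, IsIso.inv_hom_id_assoc]⟩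

@[simp] theorem map_mlower {x : Q'.Params (η.oper.obj c)} {y : Q'.Params (η'.oper.obj c)}
    (f : HFib.Over (m.oper.app c) x y) : η'.pm.map (mlower m f).pt
      = inv (m.pm.app _) ≫ (η.cu x).pt ≫ f.pt ≫ inv (η'.cu y).pt :=
  congrArg HFib.Hom.pt ((η'.fibFunctor c).map_preimage _)

theorem hom_ext_fib {x y : Q.Params c} {f g : x ⟶ y} (h : η.pm.map f.pt = η.pm.map g.pt) : f = g :=
  HFib.hom_ext (η.pm.map_injective h)

theorem un_mlower (x : Q.Params c) : η.un x ≫ mlower m (shift m x) = η'.un x := by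
  apply hom_ext_fib (η := η')
  have h := m.pm.naturality (η.un x).pt
  rw [map_un] at h
  rw [HFib.comp_pt, η'.pm.map_comp, map_mlower, map_un, ← cancel_epi (m.pm.app _), ← Category.assoc,
    ← h, Category.assoc, IsIso.hom_inv_id_assoc, IsIso.inv_hom_id_assoc]

noncomputable abbrev operLeftHom (o : CompOp P Q) :
    η.operLeftObj P o ⟶ η'.operLeftObj P o where
  oper := m.oper.app o.oper
  app {x y} f := o.fam.map (mlower m f)
  naturality {x' x y y'} g f h := by
    dsimp only [Functor.comp_map]
    rw [← o.fam.map_comp, ← o.fam.map_comp]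
    congr 1
    apply hom_ext_fib (η := η')
    have h₁ := m.pm.naturality ((η.unfib _).map g).pt
    rw [HFib.comp_pt, HFib.comp_pt, η'.pm.map_comp, η'.pm.map_comp, map_mlower, map_mlower,
      ← cancel_epi (m.pm.app _), ← cancel_mono (η'.cu _).pt, ← Category.assoc (m.pm.app _), ← h₁]
    simp only [Category.assoc, η'.cu_naturality, IsIso.hom_inv_id_assoc, IsIso.inv_hom_id_assoc,
      η.cu_naturality_assoc]
    simp
  typ {x y} f := by
    have e := η'.src.inv.naturality (mlower m f).pt
    have e' : η'.src.inv.app ((η.unfib _).obj x).pt ≫ Q'.src.map (inv (m.pm.app _))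
        = η.src.inv.app _ := by
      rw [← cancel_mono (η.src.hom.app _), ← m.src, Category.assoc, ← Q'.src.map_comp_assoc,
        IsIso.inv_hom_id, m.src]
      simp
    dsimp only [Functor.comp_map, Functor.comp_obj] at e ⊢
    rw [o.typ_naturality_assoc, reassoc_of% e, ← Q'.src.map_comp, map_mlower]
    simp only [Category.assoc, IsIso.inv_hom_id, Category.comp_id, Q'.src.map_comp]
    rw [reassoc_of% e']

theorem operLeftHom_naturality {o o' : CompOp P Q} (h : o ⟶ o') :
    η.operLeftMap P h ≫ operLeftHom P m o' = operLeftHom P m o ≫ η'.operLeftMap P h := by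
  refine CompOp.hom_ext (m.oper.naturality _) fun {x y} f => ?_
  rw [CompOp.comp_app, CompOp.comp_app]
  dsimp only
  rw [h.app_map, h.map_app]
  congr 1
  apply η'.over_ext
  rw [HFib.Over.post_pt, HFib.Over.pre_pt, η'.pm.map_comp, η'.pm.map_comp, map_mlower, map_mlower,
    map_lower, ← cancel_epi (m.pm.app _), ← Category.assoc, ← m.pm.naturality, map_lower]
  simp
  rfl

noncomputable abbrev pmLeftHom (x : CompPm P Q) :
    η.pmLeftObj P x ⟶ η'.pmLeftObj P x where
  oper := operLeftHom P m x.oper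
  arg := shift m x.arg
  par := ⟨𝟙 x.par.pt, by
    dsimp only
    rw [P.proj.map_id, Category.id_comp, Category.assoc, ← x.oper.fam.map_comp, un_mlower]⟩

/-- Left whiskering of an isomorphism of equivalences. -/
noncomputable abbrev whiskerLeftHom : η.whiskerLeft P ⟶ η'.whiskerLeft P where
  oper :=
    { app := operLeftHom P m
      naturality := fun _ _ h => operLeftHom_naturality P m h }
  pm :=
    { app := pmLeftHom P m
      naturality := fun _ _ f => CompPm.hom_ext (operLeftHom_naturality P m f.oper)
        (m.pm.naturality _) ((Category.comp_id _).trans (Category.id_comp _).symm) }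
  src x := (Category.comp_id _).trans (P.src.map_id x.par.pt)
  proj _ := (Category.comp_id _).trans (Category.id_comp _).symm
  tgt o := m.tgt o.oper

end WhiskerLeftHom

end Eqv

variable {P P' P'' P''' : GPoly I J}

namespace Eqv

noncomputable def transAssoc (φ : Eqv P P') (ψ : Eqv P' P'') (χ : Eqv P'' P''') :
    (φ.trans ψ).trans χ ⟶ φ.trans (ψ.trans χ) where
  oper := 𝟙 _
  pm := 𝟙 _
  src e := by simp
  proj e := by simp
  tgt b := by simp

noncomputable def reflTrans (φ : Eqv P P') : (Eqv.refl P).trans φ ⟶ φ where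
  oper := 𝟙 _
  pm := 𝟙 _
  src e := by simp
  proj e := by simp
  tgt b := by simp

noncomputable def transRefl (φ : Eqv P P') : φ.trans (Eqv.refl P') ⟶ φ where
  oper := 𝟙 _
  pm := 𝟙 _
  src e := by simp
  proj e := by simp
  tgt b := by simp

end Eqv

/-- The 2-cells between polynomials: equivalences of polynomials, two of them being the same 2-cell
when they are isomorphic. -/
noncomputable abbrev Cell (P P' : GPoly I J) : Type u := Quotient (isIsomorphicSetoid (Eqv P P'))

/-- The 2-cell of an equivalence. -/
noncomputable abbrev Eqv.cell (φ : Eqv P P') : Cell P P' := Quotient.mk _ φ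

theorem Eqv.cell_eq {φ ψ : Eqv P P'} (m : φ ⟶ ψ) : φ.cell = ψ.cell :=
  Quotient.sound ⟨asIso m⟩

/-- The category of polynomials from `I` to `J` and 2-cells. -/
noncomputable instance : Category.{u} (GPoly I J) where
  Hom := Cell
  id P := (Eqv.refl P).cell
  comp := Quotient.map₂ Eqv.trans fun _ _ ⟨m⟩ _ _ ⟨n⟩ => ⟨asIso (Eqv.transHom m.hom n.hom)⟩
  id_comp := by
    rintro P P' ⟨φ⟩
    exact Eqv.cell_eq φ.reflTrans
  comp_id := by
    rintro P P' ⟨φ⟩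
    exact Eqv.cell_eq φ.transRefl
  assoc := by
    rintro P P' P'' P''' ⟨φ⟩ ⟨ψ⟩ ⟨χ⟩
    exact Eqv.cell_eq (φ.transAssoc ψ χ)

/-- Left whiskering of 2-cells. -/
noncomputable def Cell.whiskerLeft (P : GPoly I J) {Q Q' : GPoly J K} :
    (Q ⟶ Q') → (P.comp Q ⟶ P.comp Q') :=
  Quotient.map (Eqv.whiskerLeft P) fun _ _ ⟨m⟩ => ⟨asIso (Eqv.whiskerLeftHom P m.hom)⟩

/-- Right whiskering of 2-cells. -/
noncomputable def Cell.whiskerRight {P P' : GPoly I J} (η : P ⟶ P') (Q : GPoly J K) :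
    P.comp Q ⟶ P'.comp Q :=
  Quotient.map (fun φ : Eqv P P' => φ.whiskerRight Q)
    (fun _ _ (h : IsIsomorphic _ _) => h.elim fun m => ⟨asIso (Eqv.whiskerRightHom m.hom Q)⟩) η

open Cell in
/-- The remaining structure that makes groupoids, polynomials and 2-cells, with the identities,
composites and whiskerings above, into a bicategory: associators and unitors, subject to the laws
of a bicategory. -/
structure Coherence where
  associator {I J K L : Type u} [Groupoid.{u} I] [Groupoid.{u} J] [Groupoid.{u} K]
    [Groupoid.{u} L] (P : GPoly I J) (Q : GPoly J K) (R : GPoly K L) :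
    (P.comp Q).comp R ≅ P.comp (Q.comp R)
  leftUnitor {I J : Type u} [Groupoid.{u} I] [Groupoid.{u} J] (P : GPoly I J) :
    (GPoly.id I).comp P ≅ P
  rightUnitor {I J : Type u} [Groupoid.{u} I] [Groupoid.{u} J] (P : GPoly I J) :
    P.comp (GPoly.id J) ≅ P
  whiskerLeft_id {I J K : Type u} [Groupoid.{u} I] [Groupoid.{u} J] [Groupoid.{u} K]
    (P : GPoly I J) (Q : GPoly J K) : whiskerLeft P (𝟙 Q) = 𝟙 (P.comp Q)
  whiskerLeft_comp {I J K : Type u} [Groupoid.{u} I] [Groupoid.{u} J] [Groupoid.{u} K]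
    (P : GPoly I J) {Q Q' Q'' : GPoly J K} (η : Q ⟶ Q') (θ : Q' ⟶ Q'') :
    whiskerLeft P (η ≫ θ) = whiskerLeft P η ≫ whiskerLeft P θ
  id_whiskerLeft {I J : Type u} [Groupoid.{u} I] [Groupoid.{u} J] {P P' : GPoly I J}
    (η : P ⟶ P') :
    whiskerLeft (GPoly.id I) η = (leftUnitor P).hom ≫ η ≫ (leftUnitor P').inv
  comp_whiskerLeft {I J K L : Type u} [Groupoid.{u} I] [Groupoid.{u} J] [Groupoid.{u} K]
    [Groupoid.{u} L] (P : GPoly I J) (Q : GPoly J K) {R R' : GPoly K L} (η : R ⟶ R') :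
    whiskerLeft (P.comp Q) η = (associator P Q R).hom ≫ whiskerLeft P (whiskerLeft Q η) ≫
      (associator P Q R').inv
  id_whiskerRight {I J K : Type u} [Groupoid.{u} I] [Groupoid.{u} J] [Groupoid.{u} K]
    (P : GPoly I J) (Q : GPoly J K) : whiskerRight (𝟙 P) Q = 𝟙 (P.comp Q)
  comp_whiskerRight {I J K : Type u} [Groupoid.{u} I] [Groupoid.{u} J] [Groupoid.{u} K]
    {P P' P'' : GPoly I J} (η : P ⟶ P') (θ : P' ⟶ P'') (Q : GPoly J K) :
    whiskerRight (η ≫ θ) Q = whiskerRight η Q ≫ whiskerRight θ Q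
  whiskerRight_id {I J : Type u} [Groupoid.{u} I] [Groupoid.{u} J] {P P' : GPoly I J}
    (η : P ⟶ P') :
    whiskerRight η (GPoly.id J) = (rightUnitor P).hom ≫ η ≫ (rightUnitor P').inv
  whiskerRight_comp {I J K L : Type u} [Groupoid.{u} I] [Groupoid.{u} J] [Groupoid.{u} K]
    [Groupoid.{u} L] {P P' : GPoly I J} (η : P ⟶ P') (Q : GPoly J K) (R : GPoly K L) :
    whiskerRight η (Q.comp R) = (associator P Q R).inv ≫ whiskerRight (whiskerRight η Q) R ≫
      (associator P' Q R).hom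
  whisker_assoc {I J K L : Type u} [Groupoid.{u} I] [Groupoid.{u} J] [Groupoid.{u} K]
    [Groupoid.{u} L] (P : GPoly I J) {Q Q' : GPoly J K} (η : Q ⟶ Q') (R : GPoly K L) :
    whiskerRight (whiskerLeft P η) R = (associator P Q R).hom ≫
      whiskerLeft P (whiskerRight η R) ≫ (associator P Q' R).inv
  whisker_exchange {I J K : Type u} [Groupoid.{u} I] [Groupoid.{u} J] [Groupoid.{u} K]
    {P P' : GPoly I J} {Q Q' : GPoly J K} (η : P ⟶ P') (θ : Q ⟶ Q') :
    whiskerLeft P θ ≫ whiskerRight η Q' = whiskerRight η Q ≫ whiskerLeft P' θ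
  pentagon {I J K L M : Type u} [Groupoid.{u} I] [Groupoid.{u} J] [Groupoid.{u} K]
    [Groupoid.{u} L] [Groupoid.{u} M] (P : GPoly I J) (Q : GPoly J K) (R : GPoly K L)
    (S : GPoly L M) :
    whiskerRight (associator P Q R).hom S ≫ (associator P (Q.comp R) S).hom ≫
        whiskerLeft P (associator Q R S).hom
      = (associator (P.comp Q) R S).hom ≫ (associator P Q (R.comp S)).hom
  triangle {I J K : Type u} [Groupoid.{u} I] [Groupoid.{u} J] [Groupoid.{u} K]
    (P : GPoly I J) (Q : GPoly J K) :
    (associator P (GPoly.id J) Q).hom ≫ whiskerLeft P (leftUnitor Q).hom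
      = whiskerRight (rightUnitor P).hom Q

/-- The objects of the bicategory: (small) groupoids. -/
structure Grpds (D : Coherence.{u}) : Type (u + 1) where
  carrier : Type u
  [groupoid : Groupoid.{u} carrier]

attribute [instance] Grpds.groupoid

/-- The bicategory of groupoids, polynomials in groupoids, and 2-cells. -/
noncomputable instance (D : Coherence.{u}) : Bicategory.{u, u + 1} (Grpds D) where
  Hom I J := GPoly I.carrier J.carrier
  id I := GPoly.id I.carrier
  comp P Q := P.comp Q
  homCategory I J := inferInstanceAs (Category (GPoly I.carrier J.carrier))
  whiskerLeft P _ _ η := Cell.whiskerLeft P η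
  whiskerRight η Q := Cell.whiskerRight η Q
  associator := D.associator
  leftUnitor := D.leftUnitor
  rightUnitor := D.rightUnitor
  whiskerLeft_id := D.whiskerLeft_id
  whiskerLeft_comp P _ _ _ η θ := D.whiskerLeft_comp P η θ
  id_whiskerLeft := D.id_whiskerLeft
  comp_whiskerLeft P Q _ _ η := D.comp_whiskerLeft P Q η
  id_whiskerRight := D.id_whiskerRight
  comp_whiskerRight η θ Q := D.comp_whiskerRight η θ Q
  whiskerRight_id := D.whiskerRight_id
  whiskerRight_comp := D.whiskerRight_comp
  whisker_assoc P _ _ η R := D.whisker_assoc P η R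
  whisker_exchange := D.whisker_exchange
  pentagon := D.pentagon
  triangle := D.triangle

end GPoly

section
variable {B : Type*} [Bicategory B]

/-- `P` is an internal equivalence: it has a right inverse and a left inverse up to 2-cells. -/
def IsInternalEquivalence {I J : B} (P : I ⟶ J) : Prop :=
  ∃ Q Q' : J ⟶ I, Nonempty (P ≫ Q ≅ 𝟙 I) ∧ Nonempty (Q' ≫ P ≅ 𝟙 J)

/-- The functor `F` into the category of 1-cells `I ⟶ J` is fully faithful and its essential image
consists exactly of the internal equivalences. -/
structure PresentsEquivalences {I J : B} {C : Type*} [Category C] (F : C ⥤ (I ⟶ J)) : Prop where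
  full : F.Full
  faithful : F.Faithful
  essImage (P : I ⟶ J) : F.essImage P ↔ IsInternalEquivalence P

variable (B) in
/-- Candidates for a terminal object, binary products, projections and pairing. -/
structure CartesianData where
  terminal : B
  prod : B → B → B
  projl (J K : B) : prod J K ⟶ J
  projr (J K : B) : prod J K ⟶ K
  pair {I J K : B} (P : I ⟶ J) (Q : I ⟶ K) : I ⟶ prod J K

/-- The data form a cartesian structure: the categories of 1-cells into `terminal` are trivial,
post-composition with the two projections is an equivalence
`Hom(I, prod J K) ≌ Hom(I, J) × Hom(I, K)`, and `pair` is its inverse on objects. -/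
structure CartesianData.IsCartesian (C : CartesianData B) : Prop where
  terminal (I : B) : Nonempty ((I ⟶ C.terminal) ≌ Discrete PUnit.{1})
  product (I J K : B) : ((Bicategory.postcomp I (C.projl J K)).prod'
    (Bicategory.postcomp I (C.projr J K))).IsEquivalence
  pair_projl {I J K : B} (P : I ⟶ J) (Q : I ⟶ K) : Nonempty (C.pair P Q ≫ C.projl J K ≅ P)
  pair_projr {I J K : B} (P : I ⟶ J) (Q : I ⟶ K) : Nonempty (C.pair P Q ≫ C.projr J K ≅ Q)

variable (B) in
/-- A class of 1-cells that contains the identities and is closed under composition. -/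
structure OneCells where
  mem {I J : B} : ObjectProperty (I ⟶ J)
  id_mem (I : B) : mem (𝟙 I)
  comp_mem {I J K : B} {P : I ⟶ J} {Q : J ⟶ K} : mem P → mem Q → mem (P ≫ Q)

namespace OneCells

/-- The objects of the sub-bicategory given by a class of 1-cells: all objects of `B`. -/
structure Sub (W : OneCells B) where
  obj : B

variable (W : OneCells B)

open Bicategory in
/-- The sub-bicategory on all objects, the 1-cells in `W`, and all 2-cells between these, with the
structure inherited from `B`. -/
instance : Bicategory W.Sub where
  Hom I J := (W.mem (I := I.obj) (J := J.obj)).FullSubcategory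
  id I := ⟨𝟙 I.obj, W.id_mem _⟩
  comp P Q := ⟨P.obj ≫ Q.obj, W.comp_mem P.property Q.property⟩
  homCategory I J := inferInstanceAs (Category (W.mem (I := I.obj) (J := J.obj)).FullSubcategory)
  whiskerLeft P _ _ η := ObjectProperty.homMk (P.obj ◁ η.hom)
  whiskerRight η Q := ObjectProperty.homMk (η.hom ▷ Q.obj)
  associator P Q R := ObjectProperty.isoMk _ (α_ P.obj Q.obj R.obj)
  leftUnitor P := ObjectProperty.isoMk _ (λ_ P.obj)
  rightUnitor P := ObjectProperty.isoMk _ (ρ_ P.obj)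
  whiskerLeft_id _ _ := ObjectProperty.hom_ext _ (Bicategory.whiskerLeft_id _ _)
  whiskerLeft_comp _ _ _ _ _ _ := ObjectProperty.hom_ext _ (Bicategory.whiskerLeft_comp _ _ _)
  id_whiskerLeft _ := ObjectProperty.hom_ext _ (Bicategory.id_whiskerLeft _)
  comp_whiskerLeft _ _ _ _ _ := ObjectProperty.hom_ext _ (Bicategory.comp_whiskerLeft _ _ _)
  id_whiskerRight _ _ := ObjectProperty.hom_ext _ (Bicategory.id_whiskerRight _ _)
  comp_whiskerRight _ _ _ := ObjectProperty.hom_ext _ (Bicategory.comp_whiskerRight _ _ _)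
  whiskerRight_id _ := ObjectProperty.hom_ext _ (Bicategory.whiskerRight_id _)
  whiskerRight_comp _ _ _ := ObjectProperty.hom_ext _ (Bicategory.whiskerRight_comp _ _ _)
  whisker_assoc _ _ _ _ _ := ObjectProperty.hom_ext _ (Bicategory.whisker_assoc _ _ _)
  whisker_exchange _ _ := ObjectProperty.hom_ext _ (Bicategory.whisker_exchange _ _)
  pentagon _ _ _ _ := ObjectProperty.hom_ext _ (Bicategory.pentagon _ _ _ _)
  triangle _ _ := ObjectProperty.hom_ext _ (Bicategory.triangle _ _)

/-- Restriction of cartesian data to a class of 1-cells that is closed under them. -/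
def restrictData (C : CartesianData B) (hl : ∀ J K : B, W.mem (C.projl J K))
    (hr : ∀ J K : B, W.mem (C.projr J K))
    (hp : ∀ {I J K : B} {P : I ⟶ J} {Q : I ⟶ K}, W.mem P → W.mem Q → W.mem (C.pair P Q)) :
    CartesianData W.Sub where
  terminal := ⟨C.terminal⟩
  prod J K := ⟨C.prod J.obj K.obj⟩
  projl J K := ⟨C.projl J.obj K.obj, hl _ _⟩
  projr J K := ⟨C.projr J.obj K.obj, hr _ _⟩
  pair P Q := ⟨C.pair P.obj Q.obj, hp P.property Q.property⟩

/-- Restriction of a functor with values in the 1-cells in `W`. -/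
def restrictFunctor {I J : W.Sub} {C : Type*} [Category C] (F : C ⥤ (I.obj ⟶ J.obj))
    (h : ∀ c, W.mem (F.obj c)) : C ⥤ (I ⟶ J) :=
  ObjectProperty.lift _ F h

end OneCells

end

/-- The disjoint union of two groupoids. -/
noncomputable instance {I J : Type u} [Groupoid.{u} I] [Groupoid.{u} J] : Groupoid.{u} (I ⊕ J) where
  inv {x y} f := match x, y, f with
    | .inl _, .inl _, f => ULift.up (Groupoid.inv f.down)
    | .inr _, .inr _, f => ULift.up (Groupoid.inv f.down)
  inv_comp {x y} f := match x, y, f with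
    | .inl _, .inl _, f => congrArg ULift.up (Groupoid.inv_comp f.down)
    | .inr _, .inr _, f => congrArg ULift.up (Groupoid.inv_comp f.down)
  comp_inv {x y} f := match x, y, f with
    | .inl _, .inl _, f => congrArg ULift.up (Groupoid.comp_inv f.down)
    | .inr _, .inr _, f => congrArg ULift.up (Groupoid.comp_inv f.down)

namespace GPoly

section
variable {I J K : Type u} [Groupoid.{u} I] [Groupoid.{u} J] [Groupoid.{u} K]

variable (I J) in
/-- The first projection `I ⊔ J ↝ I`: one operation of each type `i`, with one parameter, of type
`inl i`. -/
def projl : GPoly (I ⊕ J) I where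
  Op := I
  Pm := I
  src := Sum.inl_ I J
  proj := 𝟭 I
  tgt := 𝟭 I

variable (I J) in
/-- The second projection `I ⊔ J ↝ J`. -/
def projr : GPoly (I ⊕ J) J where
  Op := J
  Pm := J
  src := Sum.inr_ I J
  proj := 𝟭 J
  tgt := 𝟭 J

/-- The pairing `I ↝ J ⊔ K`: the operations, with their parameters, of `P` and of `Q`. -/
noncomputable def pair (P : GPoly I J) (Q : GPoly I K) : GPoly I (J ⊕ K) where
  Op := P.Op ⊕ Q.Op
  Pm := P.Pm ⊕ Q.Pm
  src := P.src.sum' Q.src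
  proj := P.proj.sum Q.proj
  tgt := P.tgt.sum Q.tgt

/-- The polynomial of an equivalence of groupoids: the identity polynomial, transported along `f`. -/
def graph (f : I ≌ J) : GPoly I J where
  Op := I
  Pm := I
  src := 𝟭 I
  proj := 𝟭 I
  tgt := f.functor

/-- The equivalence of polynomials of a natural isomorphism between equivalences of groupoids. -/
noncomputable abbrev graphEqv {f g : I ≌ J} (θ : f ⟶ g) : Eqv (graph f) (graph g) where
  oper := 𝟭 I
  pm := 𝟭 I
  oper_isEquivalence := inferInstanceAs (𝟭 I).IsEquivalence
  pm_isEquivalence := inferInstanceAs (𝟭 I).IsEquivalence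
  src := Iso.refl (𝟭 I)
  proj := Iso.refl (𝟭 I)
  tgt := NatIso.ofComponents (fun x => (asIso (NatTrans.app (F := f.functor) (G := g.functor) θ x)).symm)
    fun k => by
      have e := NatTrans.naturality (F := f.functor) (G := g.functor) θ k
      change g.functor.map k ≫ inv _ = inv _ ≫ f.functor.map k
      rw [IsIso.comp_inv_eq, Category.assoc, e, IsIso.inv_hom_id_assoc]

variable (I J) in
/-- The canonical functor from equivalences of groupoids to polynomials. -/
noncomputable def graphFunctor : (I ≌ J) ⥤ GPoly I J where
  obj f := graph f
  map θ := (graphEqv θ).cell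
  map_id f := Eqv.cell_eq (φ := graphEqv (𝟙 f)) (ψ := Eqv.refl (graph f))
    { oper := 𝟙 (𝟭 I)
      pm := 𝟙 (𝟭 I)
      src := fun x => Category.comp_id (𝟙 x)
      proj := fun _ => rfl
      tgt := fun x => by
        change f.functor.map (𝟙 x) ≫ 𝟙 (f.functor.obj x) = inv (𝟙 (f.functor.obj x))
        simp
        exact f.functor.map_id _ }
  map_comp {f g h} θ τ := Eqv.cell_eq (φ := graphEqv (θ ≫ τ)) (ψ := (graphEqv θ).trans (graphEqv τ))
    { oper := 𝟙 (𝟭 I)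
      pm := 𝟙 (𝟭 I)
      src := fun x => by
        change 𝟙 x ≫ 𝟙 x ≫ 𝟙 x = 𝟙 x
        simp
      proj := fun x => by
        change 𝟙 x ≫ 𝟙 x ≫ 𝟙 x = 𝟙 x ≫ 𝟙 x
        simp
      tgt := fun x => by
        let θ' : f.functor ⟶ g.functor := θ
        let τ' : g.functor ⟶ h.functor := τ
        change h.functor.map (𝟙 x) ≫ inv (τ'.app x) ≫ inv (θ'.app x) = inv (θ'.app x ≫ τ'.app x)
        simp
        exact h.functor.map_id _ }

end

/-- Finitary polynomials are closed under identities, composition, the projections and pairing, and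
contain the polynomials of equivalences of groupoids. -/
structure FinitaryStable : Prop where
  id (I : Type u) [Groupoid.{u} I] : (GPoly.id I).IsFinitary
  comp {I J K : Type u} [Groupoid.{u} I] [Groupoid.{u} J] [Groupoid.{u} K] {P : GPoly I J}
    {Q : GPoly J K} : P.IsFinitary → Q.IsFinitary → (P.comp Q).IsFinitary
  projl (I J : Type u) [Groupoid.{u} I] [Groupoid.{u} J] : (projl I J).IsFinitary
  projr (I J : Type u) [Groupoid.{u} I] [Groupoid.{u} J] : (projr I J).IsFinitary
  pair {I J K : Type u} [Groupoid.{u} I] [Groupoid.{u} J] [Groupoid.{u} K] {P : GPoly I J}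
    {Q : GPoly I K} : P.IsFinitary → Q.IsFinitary → (pair P Q).IsFinitary
  graph {I J : Type u} [Groupoid.{u} I] [Groupoid.{u} J] (f : I ≌ J) : (graph f).IsFinitary

/-- The universal properties hold for the groupoids of equivalences of polynomials themselves, before
isomorphic equivalences are identified. -/
structure UntruncatedUniversality : Prop where
  terminal {I : Type u} [Groupoid.{u} I] (P P' : GPoly I (Discrete PEmpty.{u + 1})) :
    Nonempty (Eqv P P' ≌ Discrete PUnit.{1})
  product {I J K : Type u} [Groupoid.{u} I] [Groupoid.{u} J] [Groupoid.{u} K]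
    (P P' : GPoly I (J ⊕ K)) :
    ((Eqv.whiskerRightFunctor P P' (GPoly.projl J K)).prod'
      (Eqv.whiskerRightFunctor P P' (GPoly.projr J K))).IsEquivalence
  graph {I J : Type u} [Groupoid.{u} I] [Groupoid.{u} J] (f g : I ≌ J) :
    (Discrete.functor fun θ : f ⟶ g => graphEqv θ).IsEquivalence

variable (D : Coherence.{u}) (h : FinitaryStable.{u})

/-- The empty groupoid, disjoint unions, and the projection and pairing polynomials. -/
noncomputable def cartesianData : CartesianData (Grpds D) where
  terminal := ⟨Discrete PEmpty⟩
  prod J K := ⟨J.carrier ⊕ K.carrier⟩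
  projl J K := projl J.carrier K.carrier
  projr J K := projr J.carrier K.carrier
  pair P Q := pair P Q

/-- The class of finitary polynomials. -/
noncomputable def finitary : OneCells (Grpds D) where
  mem P := GPoly.IsFinitary P
  id_mem I := h.id I.carrier
  comp_mem := h.comp

/-- The bicategory of groupoids, finitary polynomials, and 2-cells. -/
abbrev FinGrpds : Type (u + 1) := (finitary D h).Sub

/-- The same cartesian data in the bicategory of finitary polynomials. -/
noncomputable def finCartesianData : CartesianData (FinGrpds D h) :=
  (finitary D h).restrictData (cartesianData D) (fun _ _ => h.projl _ _) (fun _ _ => h.projr _ _)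
    h.pair

/-- The canonical functor from equivalences of groupoids to 1-cells. -/
noncomputable def graphs (I J : Grpds D) : (I.carrier ≌ J.carrier) ⥤ (I ⟶ J) :=
  graphFunctor I.carrier J.carrier

/-- The same functor, with values in finitary polynomials. -/
noncomputable def finGraphs (I J : FinGrpds D h) :
    (I.obj.carrier ≌ J.obj.carrier) ⥤ (I ⟶ J) :=
  (finitary D h).restrictFunctor (graphs D I.obj J.obj) h.graph

end GPoly

/-! A 2-cell is only an isomorphism class of equivalences, so each law of a bicategory asks for the
existence of one isomorphism between two composite equivalences; how these isomorphisms fit together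
does not matter. They can be found because data over homotopy fibres are rigid. A morphism lying
over a given morphism of operations is determined by its point, so a square of operations gives a
square of components as soon as the points commute (`CompOp.app_square`), and the operation part of
a morphism of parameters is forced by the projections. An isomorphism between equivalences into a
composite is therefore given by its action on operations and on two coordinates (`Eqv.compHom`).

The awkward ingredient is left whiskering, which reindexes a family along a chosen quasi-inverse of
the action on parameters. Maps out of the reindexed family are obtained, by transposition across
unit and counit, from maps lying over the equivalence itself (`Eqv.Het`). `Eqv.leftHom` packages
this and carries most of the laws in which a left whiskering occurs, arranged so that this
whiskering comes last.

The unitors are equivalences because the homotopy fibres of an identity functor are contractible.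
The associator is an equivalence because a parameter of a composite is, up to isomorphism, a pair of
coordinates, so a family indexed by pairs is a family of families. Quasi-inverses make all 2-cells
invertible.

For products, both projections have the form `restr i`, with `i` an inclusion of a summand, and
composing with `restr i` extracts the part of a polynomial whose operations have type in the image
of `i`. There are no morphisms between the two summands, so operations split into two parts, and
parameters follow their operations. A polynomial into a disjoint union is thus the pairing of its
two restrictions (`Embedding.glue`), equivalences can be glued from equivalences of the parts
(`exists_cell`), and so can isomorphisms, in a unique way (`Eqv.exists_whiskerRightHom_eq`,
`Eqv.whiskerRightHom_injective`). Gluing of isomorphisms gives the statement before identification,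
and it also shows that 2-cells with equal restrictions are equal. Over the empty groupoid everything
is empty.

For an equivalence between the polynomials of `f` and `g`, the source filler trivialises the action
on parameters, the projection filler then trivialises the action on operations, and the target
filler becomes a natural isomorphism from `f` to `g`; no automorphisms remain. Now let `P` and `Q`
be mutually inverse. The target of `P.comp Q` is an equivalence that factors through the operations
of `Q`; a section of the target of `P`, which `Q.comp P` supplies, gives a section of the first
factor, so the target of `Q` is an equivalence. The projection of `Q` is treated in the same way.
The source of `Q` then corresponds to the forgetful functor from parameters of `P.comp Q` to those
of `P`, which is faithful and afterwards full by comparison with the sources. A polynomial with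
three equivalences as legs comes from an equivalence of groupoids. Conversely, the polynomial of `f`
is inverted by restriction along `f`.

Finitary means that the groupoids of parameters are thin with finitely many isomorphism classes, a
condition that passes to pairs. The finitary part contains all 2-cells between its 1-cells, so the
same witnesses serve there. -/

namespace GPoly

variable {I J K L : Type u} [Groupoid.{u} I] [Groupoid.{u} J] [Groupoid.{u} K] [Groupoid.{u} L]

/-! ### Components of morphisms of composite operations; coordinates of parameters. -/

namespace CompOp

variable {P : GPoly I J} {Q : GPoly J K}

@[simp] theorem inv_oper {o o' : CompOp P Q} (f : o ⟶ o') : (inv f).oper = inv f.oper := by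
  rw [← Groupoid.inv_eq_inv f]; rfl

/-- A morphism over a fixed morphism of operations is determined by its point. Components of equal
morphisms are therefore compared by points alone, without transport along the equality. -/
theorem app_congr_pt {o o' : CompOp P Q} {g h : o ⟶ o'} (e : g = h) {x : Q.Params o.oper}
    {y : Q.Params o'.oper} (f : HFib.Over g.oper x y) (f' : HFib.Over h.oper x y)
    (e' : f.pt = f'.pt) : g.app f = h.app f' := by
  subst e
  congr 1
  exact HFib.Over.ext e'

/-- Commutative squares of morphisms of operations give commutative squares of components. -/
theorem app_square {o o₁ o₂ o' : CompOp P Q} {g : o ⟶ o₁} {h : o₁ ⟶ o'} {g' : o ⟶ o₂}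
    {h' : o₂ ⟶ o'} (e : g ≫ h = g' ≫ h') {x : Q.Params o.oper} {x₁ : Q.Params o₁.oper}
    {x₂ : Q.Params o₂.oper} {y : Q.Params o'.oper} (k : HFib.Over g.oper x x₁)
    (l : HFib.Over h.oper x₁ y) (k' : HFib.Over g'.oper x x₂) (l' : HFib.Over h'.oper x₂ y)
    (e' : k.pt ≫ l.pt = k'.pt ≫ l'.pt) : g.app k ≫ h.app l = g'.app k' ≫ h'.app l' := by
  rw [app_comp_app, app_comp_app]
  exact app_congr_pt e _ _ e'

end CompOp

namespace CompPm

variable {P : GPoly I J} {Q : GPoly J K}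

/-- A morphism of parameters of a composite, from a morphism between operations isomorphic to their
operations and its action on coordinates. -/
noncomputable def homMk {p p' : CompPm P Q} {o o' : CompOp P Q} (k : p.oper ⟶ o)
    (k' : p'.oper ⟶ o') (m : o ⟶ o')
    (arg : HFib.Over m.oper (p.arg.push k.oper) (p'.arg.push k'.oper))
    (par : HFib.Over (m.app arg) (p.par.push (k.app (p.arg.toPush k.oper)))
      (p'.par.push (k'.app (p'.arg.toPush k'.oper)))) : p ⟶ p' where
  oper := k ≫ m ≫ inv k'
  arg := ⟨arg.pt, by
    have h := arg.path
    rw [CompOp.comp_oper, CompOp.comp_oper, CompOp.inv_oper, ← Category.assoc,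
      ← Category.assoc, IsIso.eq_comp_inv]
    simpa using h⟩
  par := ⟨par.pt, by
    have h := par.path
    dsimp only at h
    rw [← cancel_mono (k'.app (p'.arg.toPush k'.oper)), Category.assoc, h, Category.assoc,
      Category.assoc, CompOp.app_comp_app, CompOp.app_comp_app]
    congr 1
    refine CompOp.app_congr_pt (by simp) _ _ ?_
    simp⟩

theorem homMk_naturality {p p' q q' : CompPm P Q} {o o' r r' : CompOp P Q} {k : p.oper ⟶ o}
    {k' : p'.oper ⟶ o'} {m : o ⟶ o'} {l : q.oper ⟶ r} {l' : q'.oper ⟶ r'} {n : r ⟶ r'}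
    {f : p.oper ⟶ q.oper} {f' : p'.oper ⟶ q'.oper} {g : o ⟶ r} {g' : o' ⟶ r'}
    (h₁ : f ≫ l = k ≫ g) (h₂ : f' ≫ l' = k' ≫ g') (h₃ : g ≫ n = m ≫ g') :
    f ≫ l ≫ n ≫ inv l' = (k ≫ m ≫ inv k') ≫ f' := by
  rw [← cancel_mono l']
  simp only [Category.assoc, IsIso.inv_hom_id, Category.comp_id]
  rw [h₂, IsIso.inv_hom_id_assoc, ← h₃, ← Category.assoc, h₁, Category.assoc]

end CompPm

/-! ### Quasi-inverses of equivalences and invertibility of 2-cells. -/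

namespace Eqv

section Symm

variable {P P' : GPoly I J}

/-- A quasi-inverse of an equivalence of polynomials. -/
noncomputable def symm (φ : Eqv P P') : Eqv P' P where
  oper := φ.oper.inv
  pm := φ.pm.inv
  src := NatIso.ofComponents
    (fun e => (φ.src.app (φ.pm.inv.obj e)).symm ≪≫ P'.src.mapIso ((counit φ.pm).app e))
    fun {x y} f => by
      have h₁ := φ.src.inv.naturality (φ.pm.inv.map f)
      have h₂ := (counit φ.pm).hom.naturality f
      dsimp at h₁ h₂ ⊢
      rw [reassoc_of% h₁, ← P'.src.map_comp, h₂, P'.src.map_comp, Category.assoc]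
  proj := NatIso.ofComponents
    (fun e => φ.oper.preimageIso ((φ.proj.app (φ.pm.inv.obj e)).symm ≪≫
      P'.proj.mapIso ((counit φ.pm).app e) ≪≫ ((counit φ.oper).app (P'.proj.obj e)).symm))
    fun {x y} f => by
      apply φ.oper.map_injective
      have h₁ := φ.proj.inv.naturality (φ.pm.inv.map f)
      have h₂ := (counit φ.pm).hom.naturality f
      have h₃ := (counit φ.oper).inv.naturality (P'.proj.map f)
      dsimp at h₁ h₂ h₃ ⊢
      simp only [Functor.map_comp, Functor.preimageIso_hom, Functor.map_preimage]
      dsimp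
      rw [reassoc_of% h₁, ← P'.proj.map_comp_assoc, h₂, P'.proj.map_comp_assoc, h₃]
      simp only [Category.assoc]
  tgt := NatIso.ofComponents
    (fun e => (φ.tgt.app (φ.oper.inv.obj e)).symm ≪≫ P'.tgt.mapIso ((counit φ.oper).app e))
    fun {x y} f => by
      have h₁ := φ.tgt.inv.naturality (φ.oper.inv.map f)
      have h₂ := (counit φ.oper).hom.naturality f
      dsimp at h₁ h₂ ⊢
      rw [reassoc_of% h₁, ← P'.tgt.map_comp, h₂, P'.tgt.map_comp, Category.assoc]

/-- The fillers of `symm` are built from the counits, so the counits are compatible with them by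
cancellation. The other composite is not needed: one-sided inverses of all 2-cells suffice. -/
noncomputable def symmTrans (φ : Eqv P P') : φ.symm.trans φ ⟶ Eqv.refl P' where
  oper := (counit φ.oper).hom
  pm := (counit φ.pm).hom
  src e := by simp [symm]
  proj e := by simp [symm]
  tgt b := by simp [symm]

end Symm

end Eqv

theorem exists_leftInverse {P P' : GPoly I J} (f : P ⟶ P') : ∃ g : P' ⟶ P, g ≫ f = 𝟙 P' := by
  obtain ⟨φ⟩ := f
  exact ⟨φ.symm.cell, Eqv.cell_eq φ.symmTrans⟩

/-- All 2-cells are invertible. -/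
instance isIso_cell {P P' : GPoly I J} (f : P ⟶ P') : IsIso f := by
  obtain ⟨g, hg⟩ := exists_leftInverse f
  obtain ⟨h, hh⟩ := exists_leftInverse g
  -- The left inverse `h` of the left inverse `g` of `f` is `f` itself, so `g` is inverse to `f` on
  -- both sides.
  have e : h = f := by rw [← Category.comp_id h, ← hg, reassoc_of% hh]
  subst e
  exact ⟨g, hh, hg⟩

/-! ### Isomorphisms between equivalences into a composite. -/

namespace Eqv

section CompHom

variable {X : GPoly I K} {P : GPoly I J} {Q : GPoly J K}

/-- The first coordinate of the image of a parameter. -/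
noncomputable abbrev argAt (φ : Eqv X (P.comp Q)) (e : X.Pm) :
    Q.Params (CompOp.oper (φ.oper.obj (X.proj.obj e))) :=
  (CompPm.arg (φ.pm.obj e)).push (CompOp.Hom.oper (φ.proj.hom.app e))

/-- The second coordinate of the image of a parameter. -/
noncomputable abbrev parAt (φ : Eqv X (P.comp Q)) (e : X.Pm) :
    P.Params ((CompOp.fam (φ.oper.obj (X.proj.obj e))).obj (φ.argAt e)) :=
  (CompPm.par (φ.pm.obj e)).push (CompOp.Hom.app (φ.proj.hom.app e) (HFib.toPush _ _))

/-- An isomorphism between two equivalences into a composite is determined by its action on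
operations and on the coordinates of parameters. -/
noncomputable def compHom {φ ψ : Eqv X (P.comp Q)} (m : φ.oper ⟶ ψ.oper)
    (arg : ∀ e, HFib.Over (CompOp.Hom.oper (m.app (X.proj.obj e))) (φ.argAt e) (ψ.argAt e))
    (par : ∀ e, HFib.Over (CompOp.Hom.app (m.app (X.proj.obj e)) (arg e)) (φ.parAt e) (ψ.parAt e))
    (arg_nat : ∀ {e e'} (f : e ⟶ e'), (CompPm.Hom.arg (φ.pm.map f)).pt ≫ (arg e').pt =
      (arg e).pt ≫ (CompPm.Hom.arg (ψ.pm.map f)).pt)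
    (par_nat : ∀ {e e'} (f : e ⟶ e'), (CompPm.Hom.par (φ.pm.map f)).pt ≫ (par e').pt =
      (par e).pt ≫ (CompPm.Hom.par (ψ.pm.map f)).pt)
    (src : ∀ e, P.src.map (par e).pt ≫ ψ.src.hom.app e = φ.src.hom.app e)
    (tgt : ∀ b, Q.tgt.map (CompOp.Hom.oper (m.app b)) ≫ ψ.tgt.hom.app b = φ.tgt.hom.app b) :
    φ ⟶ ψ where
  oper := m
  pm :=
    -- Compatibility with the projections forces the operation part of this component to be the
    -- conjugate of `m` by the two projection fillers; only the coordinates are free.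
    { app := fun e => CompPm.homMk (φ.proj.hom.app e) (ψ.proj.hom.app e) (m.app (X.proj.obj e))
        (arg e) (par e)
      naturality := fun e e' f => by
        refine CompPm.hom_ext ?_ (arg_nat f) (par_nat f)
        exact CompPm.homMk_naturality (φ.proj_naturality f) (ψ.proj_naturality f)
          (m.naturality (X.proj.map f)) }
  src := src
  proj e := by
    change (_ ≫ _ ≫ inv _) ≫ _ = _
    simp
  tgt := tgt

end CompHom

section Het

variable {P : GPoly I J} {Q Q' : GPoly J K} (η : Eqv Q Q')

/-- Morphisms from an operation of `P.comp Q` to an operation of `P.comp Q'` lying over `η`. -/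
structure Het (o : CompOp P Q) (o' : CompOp P Q') where
  oper : η.oper.obj o.oper ⟶ o'.oper
  app {x : Q.Params o.oper} {y : Q'.Params o'.oper} (f : HFib.Over oper (η.fib x) y) :
    o.fam.obj x ⟶ o'.fam.obj y
  naturality {x' x : Q.Params o.oper} {y y' : Q'.Params o'.oper} (g : x' ⟶ x)
    (f : HFib.Over oper (η.fib x) y) (h : y ⟶ y') :
    o.fam.map g ≫ app f ≫ o'.fam.map h = app ((f.pre ((η.fibFunctor _).map g)).post h)
  typ {x : Q.Params o.oper} {y : Q'.Params o'.oper} (f : HFib.Over oper (η.fib x) y) :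
    P.tgt.map (app f) ≫ o'.typ y = o.typ x ≫ η.src.inv.app x.pt ≫ Q'.src.map f.pt

namespace Het

variable {η} {o : CompOp P Q} {o' : CompOp P Q'}

theorem map_app (t : Het η o o') {x' x : Q.Params o.oper} {y : Q'.Params o'.oper} (g : x' ⟶ x)
    (f : HFib.Over t.oper (η.fib x) y) :
    o.fam.map g ≫ t.app f = t.app (f.pre ((η.fibFunctor _).map g)) := by
  have := t.naturality g f (𝟙 y)
  rw [o'.fam.map_id, Category.comp_id] at this
  rw [this]
  congr 1
  ext
  simp

/-- The value of the reindexed family at a parameter is the value of `o` at its preimage under the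
quasi-inverse; the counit maps the image of this preimage to the parameter, which brings it within
the scope of `t`. -/
noncomputable abbrev toHom (t : Het η o o') : η.operLeftObj P o ⟶ o' where
  oper := t.oper
  app f := t.app (f.pre (η.cu _))
  naturality g f h := by
    dsimp only [Functor.comp_map]
    rw [t.naturality]
    congr 1
    ext
    simp [η.cu_naturality_assoc]
  typ {x y} f := by
    rw [t.typ]
    simp

/-- Left whiskering moves the second coordinate of a parameter along the unit. The lowering in
`g.app l` and the counit in `l'` cancel that unit, so `t` may be evaluated on the original
parameter. In `leftHom` this yields the compatibility of second coordinates. -/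
theorem un_app {o₁ : CompOp P Q} (k : o₁ ⟶ o) (t : Het η o o') {x : Q.Params o₁.oper}
    {x' : Q'.Params (η.oper.obj o.oper)} {y : Q'.Params o'.oper}
    (f : HFib.Over t.oper (η.fib (x.push k.oper)) y)
    {g : η.operLeftObj P o₁ ⟶ η.operLeftObj P o} (hg : g = η.operLeftMap P k)
    (l : HFib.Over g.oper (η.fib x) x') (l' : HFib.Over t.oper (η.fib ((η.unfib _).obj x')) y)
    (n : x'.pt ⟶ y.pt) (h₁ : l'.pt = (η.cu x').pt ≫ n) (h₂ : l.pt ≫ n = f.pt) :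
    k.app (x.toPush k.oper) ≫ t.app f = o₁.fam.map (η.un x) ≫ g.app l ≫ t.app l' := by
  subst hg
  have e : k.app ((η.lower l).pre (η.un x)) = k.app (x.toPush k.oper) ≫
      o.fam.map (((η.lower l).pre (η.un x)).pushHom) := by
    rw [k.app_map]
    congr 1
    ext
    simp
  rw [← Category.assoc (o₁.fam.map _)]
  change _ = (o₁.fam.map _ ≫ k.app _) ≫ _
  rw [k.map_app, e, Category.assoc, t.map_app]
  congr 2
  ext
  simp [h₁, ← h₂]

end Het

variable {X : GPoly I K} {η}

/-- An isomorphism from an equivalence followed by a left whiskering, given by morphisms lying over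
the whiskered equivalence. -/
noncomputable def leftHom {A : Eqv X (P.comp Q)} {B : Eqv X (P.comp Q')}
    (t : ∀ a, Het η (A.oper.obj a) (B.oper.obj a))
    (oper_nat : ∀ {a a'} (h : a ⟶ a'), η.oper.map (CompOp.Hom.oper (A.oper.map h)) ≫ (t a').oper
      = (t a).oper ≫ CompOp.Hom.oper (B.oper.map h))
    (app_nat : ∀ {a a'} (h : a ⟶ a') {x x' y y'}
      (f : HFib.Over (CompOp.Hom.oper (A.oper.map h)) x x')
      (k' : HFib.Over (t a').oper (η.fib x') y') (k : HFib.Over (t a).oper (η.fib x) y)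
      (f' : HFib.Over (CompOp.Hom.oper (B.oper.map h)) y y'),
      η.pm.map f.pt ≫ k'.pt = k.pt ≫ f'.pt →
      CompOp.Hom.app (A.oper.map h) f ≫ (t a').app k'
        = (t a).app k ≫ CompOp.Hom.app (B.oper.map h) f')
    (arg : ∀ e, HFib.Over (t (X.proj.obj e)).oper (η.fib (A.argAt e)) (B.argAt e))
    (par : ∀ e, HFib.Over ((t (X.proj.obj e)).app (arg e)) (A.parAt e) (B.parAt e))
    (arg_nat : ∀ {e e'} (f : e ⟶ e'), η.pm.map (CompPm.Hom.arg (A.pm.map f)).pt ≫ (arg e').pt =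
      (arg e).pt ≫ (CompPm.Hom.arg (B.pm.map f)).pt)
    (par_nat : ∀ {e e'} (f : e ⟶ e'), (CompPm.Hom.par (A.pm.map f)).pt ≫ (par e').pt =
      (par e).pt ≫ (CompPm.Hom.par (B.pm.map f)).pt)
    (src : ∀ e, P.src.map (par e).pt ≫ B.src.hom.app e = A.src.hom.app e)
    (tgt : ∀ b, Q'.tgt.map (t b).oper ≫ B.tgt.hom.app b
      = η.tgt.hom.app (CompOp.oper (A.oper.obj b)) ≫ A.tgt.hom.app b) :
    A.trans (η.whiskerLeft P) ⟶ B :=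
  compHom (φ := A.trans (η.whiskerLeft P)) (ψ := B)
    { app := fun a => (t a).toHom
      naturality := fun a a' h => by
        refine CompOp.hom_ext (oper_nat h) fun {x y} f => ?_
        rw [CompOp.comp_app, CompOp.comp_app]
        -- The lowered morphism becomes `f` conjugated by counits under `η`, and one of these
        -- counits cancels the one in `toHom`; the condition on points follows.
        refine app_nat h _ _ _ _ ?_
        dsimp
        rw [map_lower]
        simp
        rfl }
    (fun e => ⟨(arg e).pt, by
      have h := (arg e).path
      dsimp at h ⊢
      simp only [Functor.map_comp, Category.assoc] at h ⊢
      simpa using h⟩)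
    (fun e => ⟨(par e).pt, by
      refine (par e).path.trans ?_
      dsimp
      rw [Category.assoc, Category.assoc, Category.assoc]
      congr 1
      exact Het.un_app (A.proj.hom.app e) (t _) (arg e) (Category.id_comp _) _ _ (arg e).pt rfl
        (Category.id_comp _)⟩)
    arg_nat par_nat (fun e => by
      refine (src e).trans ?_
      exact (Category.id_comp _).symm) tgt

end Het

end Eqv

end GPoly

/-! ### The unitors. -/

namespace GPoly

variable {I J K L : Type u} [Groupoid.{u} I] [Groupoid.{u} J] [Groupoid.{u} K] [Groupoid.{u} L]

/-- A reducible form of the identity polynomial. -/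
protected abbrev unit (I : Type u) [Groupoid.{u} I] : GPoly I I where
  Op := I
  Pm := I
  src := 𝟭 I
  proj := 𝟭 I
  tgt := 𝟭 I

section LeftUnitor

variable (P : GPoly I J)

/-- The left unitor on operations. -/
noncomputable abbrev lamOper : CompOp (GPoly.unit I) P ⥤ P.Op where
  obj o := o.oper
  map h := h.oper

/-- The target functor of the identity polynomial is the identity and `typ` is invertible, so
compatibility with `typ` can be solved for the component: the family carries no information. -/
theorem lam_app {P : GPoly I J} {o o' : CompOp (GPoly.unit I) P} (h : o ⟶ o')
    {x : P.Params o.oper} {y : P.Params o'.oper} (f : HFib.Over h.oper x y) :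
    h.app f = (o.typ x ≫ P.src.map f.pt) ≫ inv (o'.typ y) := by
  rw [IsIso.eq_comp_inv]
  exact h.typ f

instance : (lamOper P).Faithful where
  map_injective {o o'} g h e := CompOp.hom_ext e fun f => by
    rw [lam_app, lam_app, HFib.Over.cast_pt]

/-- The operation of `(GPoly.unit I).comp P` determined by an operation of `P`. -/
noncomputable abbrev lamLift (c : P.Op) : CompOp (GPoly.unit I) P where
  oper := c
  fam := HFib.forget P.proj c ⋙ P.src
  typ x := 𝟙 (P.src.obj x.pt)
  typ_naturality _ := (Category.comp_id _).trans (Category.id_comp _).symm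

/-- The components are the only possible ones, by the formula of `lam_app`. -/
noncomputable abbrev lamPreimage {P : GPoly I J} {o o' : CompOp (GPoly.unit I) P}
    (F : o.oper ⟶ o'.oper) : o ⟶ o' where
  oper := F
  app {x y} f := (o.typ x ≫ P.src.map (HFib.Over.pt f)) ≫ inv (o'.typ y)
  naturality {x' x y y'} g f h := by
    have h₁ : o.fam.map g ≫ o.typ x = o.typ x' ≫ P.src.map g.pt := o.typ_naturality g
    have h₂ : o'.fam.map h ≫ o'.typ y' = o'.typ y ≫ P.src.map h.pt := o'.typ_naturality h
    rw [← cancel_mono (o'.typ y')]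
    simp only [Category.assoc, reassoc_of% h₁, h₂, IsIso.inv_hom_id_assoc, IsIso.inv_hom_id,
      Category.comp_id]
    simp
  typ {x y} f := by
    change ((o.typ x ≫ P.src.map f.pt) ≫ inv (o'.typ y)) ≫ o'.typ y = _
    simp

instance : (lamOper P).Full where
  map_surjective F := ⟨lamPreimage F, rfl⟩

instance : (lamOper P).EssSurj where
  mem_essImage c := ⟨lamLift P c, ⟨Iso.refl c⟩⟩

instance : (lamOper P).IsEquivalence where

/-- The left unitor on parameters. -/
noncomputable abbrev lamPm : CompPm (GPoly.unit I) P ⥤ P.Pm where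
  obj p := p.arg.pt
  map h := h.arg.pt

/-- The path of `p.arg` is invertible, so the point of `arg` determines the operation part; the
projection of the identity polynomial is the identity, so the path of `par` then determines the
second coordinate. -/
instance : (lamPm P).Faithful where
  map_injective {p p'} g h e := by
    have e₁ : g.oper = h.oper := (lamOper P).map_injective (by
      have hg := g.arg.path
      have hh := h.arg.path
      change g.arg.pt = h.arg.pt at e
      rw [e, hh] at hg
      exact ((cancel_epi _).1 hg).symm)
    refine CompPm.hom_ext e₁ e ?_
    have hg := g.par.path
    have hh := h.par.path
    exact (cancel_mono p'.par.path).1 (hg.trans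
      ((congrArg (p.par.path ≫ ·) (CompOp.app_congr_pt e₁ _ h.arg e)).trans hh.symm))

instance : (lamPm P).Full where
  map_surjective {p p'} F := ⟨
    { oper := lamPreimage (inv p.arg.path ≫ P.proj.map F ≫ p'.arg.path)
      arg := ⟨F, by simp⟩
      par := ⟨(p.par.path ≫ p.oper.typ p.arg ≫ P.src.map F) ≫
        inv (p'.par.path ≫ p'.oper.typ p'.arg), by
          change ((p.par.path ≫ p.oper.typ p.arg ≫ P.src.map F) ≫
            inv (p'.par.path ≫ p'.oper.typ p'.arg)) ≫ p'.par.path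
              = p.par.path ≫ (p.oper.typ p.arg ≫ P.src.map F) ≫ inv (p'.oper.typ p'.arg)
          simp⟩ }, rfl⟩

instance : (lamPm P).EssSurj where
  mem_essImage e := ⟨⟨lamLift P (P.proj.obj e), ⟨e, 𝟙 _⟩, ⟨P.src.obj e, 𝟙 (P.src.obj e)⟩⟩,
    ⟨Iso.refl e⟩⟩

instance : (lamPm P).IsEquivalence where

/-- The left unitor. -/
noncomputable abbrev lam : Eqv ((GPoly.unit I).comp P) P where
  oper := lamOper P
  pm := lamPm P
  src := NatIso.ofComponents
    (fun p => (asIso (show p.par.pt ⟶ _ from p.par.path ≫ p.oper.typ p.arg)).symm)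
    fun {p p'} f => by
      have h₁ := f.par.path
      have h₂ := f.oper.typ f.arg
      change f.par.pt ≫ p'.par.path = p.par.path ≫ f.oper.app f.arg at h₁
      change f.oper.app f.arg ≫ _ = _ at h₂
      change P.src.map f.arg.pt ≫ inv (p'.par.path ≫ p'.oper.typ p'.arg)
        = inv (p.par.path ≫ p.oper.typ p.arg) ≫ f.par.pt
      rw [IsIso.comp_inv_eq, Category.assoc, IsIso.eq_inv_comp, Category.assoc, ← h₂,
        reassoc_of% h₁]
  proj := NatIso.ofComponents (fun p => asIso p.arg.path) fun f => f.arg.path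
  tgt := Iso.refl _

end LeftUnitor

section RightUnitor

variable (P : GPoly I J)

/-- The parameter of the operation `j` of the identity polynomial. -/
abbrev idPt (j : J) : (GPoly.unit J).Params j := ⟨j, 𝟙 j⟩

/-- Morphisms to the parameter of an operation of the identity polynomial. -/
abbrev toIdPt {j : J} (x : (GPoly.unit J).Params j) : x ⟶ idPt j := ⟨x.path, Category.comp_id x.path⟩

/-- Homotopy fibres of an identity functor are contractible: the path condition can be solved for
the point. -/
theorem id_over_pt {i j : J} {f : i ⟶ j} {x : (GPoly.unit J).Params i} {y : (GPoly.unit J).Params j}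
    (k k' : HFib.Over (p := (GPoly.unit J).proj) f x y) : k = k' :=
  HFib.Over.ext ((cancel_mono y.path).1 (k.path.trans k'.path.symm))

/-- The right unitor on operations. -/
noncomputable abbrev rhoOper : CompOp P (GPoly.unit J) ⥤ P.Op where
  obj o := o.fam.obj (idPt o.oper)
  map {o o'} h := h.app ⟨h.oper, (Category.comp_id h.oper).trans (Category.id_comp h.oper).symm⟩
  map_id o := (congrArg o.fam.map (HFib.hom_ext rfl)).trans (o.fam.map_id _)
  map_comp g h := by
    rw [CompOp.app_comp_app]
    congr 1

variable {P}

/-- Each parameter of the identity polynomial is isomorphic to the canonical one by `toIdPt`, so the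
component at canonical parameters determines all others. -/
theorem rho_app {o o' : CompOp P (GPoly.unit J)} (h : o ⟶ o') {x : (GPoly.unit J).Params o.oper}
    {y : (GPoly.unit J).Params o'.oper} (f : HFib.Over h.oper x y) :
    h.app f = o.fam.map (toIdPt x) ≫ (rhoOper P).map h ≫ o'.fam.map (inv (toIdPt y)) := by
  rw [CompOp.Hom.naturality]
  congr 1
  exact id_over_pt _ _

/-- At the canonical parameter `typ` identifies the operation `j` with the type of the underlying
operation of `P`; hence the `J`-part of a morphism is redundant. -/
theorem rho_typ {o o' : CompOp P (GPoly.unit J)} (h : o ⟶ o') :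
    h.oper = inv (o.typ (idPt o.oper)) ≫ P.tgt.map ((rhoOper P).map h) ≫ o'.typ (idPt o'.oper) := by
  rw [IsIso.eq_inv_comp]
  exact (h.typ (x := idPt o.oper) (y := idPt o'.oper) ⟨h.oper, _⟩).symm

instance : (rhoOper P).Faithful where
  map_injective {o o'} g h e := by
    refine CompOp.hom_ext ?_ fun f => ?_
    · rw [rho_typ g, rho_typ h, e]
    · rw [rho_app, rho_app, e]

theorem typ_toIdPt (o : CompOp P (GPoly.unit J)) (x : (GPoly.unit J).Params o.oper) :
    P.tgt.map (o.fam.map (toIdPt x)) ≫ o.typ (idPt o.oper) = o.typ x ≫ x.path :=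
  o.typ_naturality _

noncomputable abbrev rhoPreimage {o o' : CompOp P (GPoly.unit J)}
    (F : o.fam.obj (idPt o.oper) ⟶ o'.fam.obj (idPt o'.oper)) : o ⟶ o' where
  oper := inv (o.typ (idPt o.oper)) ≫ P.tgt.map F ≫ o'.typ (idPt o'.oper)
  app {x y} f := o.fam.map (toIdPt x) ≫ F ≫ o'.fam.map (inv (toIdPt y))
  naturality {x' x y y'} g f h := by
    have e₁ : g ≫ toIdPt x = toIdPt x' := HFib.hom_ext g.path
    have e₂ : inv (toIdPt y) ≫ h = inv (toIdPt y') := by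
      rw [IsIso.inv_comp_eq, IsIso.eq_comp_inv]
      exact HFib.hom_ext h.path
    rw [← e₁, ← e₂]
    simp only [Functor.map_comp, Category.assoc]
  typ {x y} f := by
    have h := f.path
    change f.pt ≫ y.path = x.path ≫ _ at h
    change _ = o.typ x ≫ f.pt
    rw [← cancel_mono y.path, Category.assoc, Category.assoc, h, ← typ_toIdPt, ← P.tgt.map_comp_assoc,
      ← reassoc_of% typ_toIdPt]
    simp

instance : (rhoOper P).Full where
  map_surjective {o o'} F := ⟨rhoPreimage F, by
    change o.fam.map (toIdPt (idPt o.oper)) ≫ F ≫ o'.fam.map (inv (toIdPt (idPt o'.oper))) = F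
    have e (j : J) : toIdPt (idPt j) = 𝟙 _ := rfl
    simp [e]⟩

variable (P)

/-- The operation of `P.comp (GPoly.unit J)` determined by an operation of `P`. -/
noncomputable abbrev rhoLift (c : P.Op) : CompOp P (GPoly.unit J) where
  oper := P.tgt.obj c
  fam := (Functor.const _).obj c
  typ x := inv (show x.pt ⟶ P.tgt.obj c from x.path)
  typ_naturality {x y} f := by
    have h := f.path
    change f.pt ≫ y.path = x.path at h
    change P.tgt.map (𝟙 c) ≫ inv (show y.pt ⟶ P.tgt.obj c from y.path)
      = inv (show x.pt ⟶ P.tgt.obj c from x.path) ≫ f.pt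
    rw [P.tgt.map_id, Category.id_comp, IsIso.eq_inv_comp, ← h]
    simp

instance : (rhoOper P).EssSurj where
  mem_essImage c := ⟨rhoLift P c, ⟨Iso.refl c⟩⟩

instance : (rhoOper P).IsEquivalence where

/-- The right unitor on parameters. -/
noncomputable abbrev rhoPm : CompPm P (GPoly.unit J) ⥤ P.Pm where
  obj p := p.par.pt
  map h := h.par.pt

/-- The parameter lies over the member of the family at `p.arg`, while `rhoOper` reads the member at
the canonical parameter; `toIdPt` leads from one to the other. -/
noncomputable abbrev rhoProj (p : CompPm P (GPoly.unit J)) :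
    P.proj.obj p.par.pt ⟶ (rhoOper P).obj p.oper :=
  p.par.path ≫ p.oper.fam.map (toIdPt p.arg)

theorem rhoProj_naturality {p p' : CompPm P (GPoly.unit J)} (f : p ⟶ p') :
    P.proj.map f.par.pt ≫ rhoProj P p' = rhoProj P p ≫ (rhoOper P).map f.oper := by
  rw [f.par.path_assoc, Category.assoc, CompOp.Hom.app_map, CompOp.Hom.map_app]
  congr 2
  exact id_over_pt _ _

instance : (rhoPm P).Faithful where
  map_injective {p p'} g h e := by
    have e₁ : g.oper = h.oper := (rhoOper P).map_injective (by
      have hg := rhoProj_naturality P g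
      have hh := rhoProj_naturality P h
      change g.par.pt = h.par.pt at e
      rw [e, hh] at hg
      exact ((cancel_epi _).1 hg).symm)
    refine CompPm.hom_ext e₁ ?_ e
    exact congrArg HFib.Over.pt (id_over_pt (g.arg.cast (congrArg CompOp.Hom.oper e₁)) h.arg)

instance : (rhoPm P).Full where
  map_surjective {p p'} F := by
    obtain ⟨k, hk⟩ := (rhoOper P).map_surjective
      (inv (rhoProj P p) ≫ P.proj.map F ≫ rhoProj P p')
    let a : HFib.Over k.oper p.arg p'.arg := ⟨p.arg.path ≫ k.oper ≫ inv p'.arg.path, by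
      change (p.arg.path ≫ k.oper ≫ inv p'.arg.path) ≫ p'.arg.path = p.arg.path ≫ k.oper
      simp⟩
    refine ⟨
      { oper := k
        arg := a
        par := ⟨F, ?_⟩ }, rfl⟩
    rw [rho_app, hk]
    simp

instance : (rhoPm P).EssSurj where
  mem_essImage e := ⟨⟨rhoLift P (P.proj.obj e), idPt _, ⟨e, 𝟙 _⟩⟩, ⟨Iso.refl e⟩⟩

instance : (rhoPm P).IsEquivalence where

/-- The right unitor. -/
noncomputable abbrev rho : Eqv (P.comp (GPoly.unit J)) P where
  oper := rhoOper P
  pm := rhoPm P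
  src := Iso.refl _
  proj := NatIso.ofComponents (fun p => asIso (rhoProj P p)) fun f => rhoProj_naturality P f
  tgt := NatIso.ofComponents (fun o => asIso (o.typ (idPt o.oper))) fun h => h.typ _

end RightUnitor

end GPoly

/-! ### The associator. -/

namespace GPoly

variable {I J K L : Type u} [Groupoid.{u} I] [Groupoid.{u} J] [Groupoid.{u} K] [Groupoid.{u} L]

theorem comp_comp_comp_eq {C : Type u} [Category.{u} C] {a b c d e : C} {f : a ⟶ b} {g : b ⟶ c}
    {h : c ⟶ d} {k : a ⟶ d} (w : f ≫ g ≫ h = k) (l : d ⟶ e) : f ≫ g ≫ h ≫ l = k ≫ l := by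
  rw [← w, Category.assoc, Category.assoc]

theorem comp_map_four {C D : Type u} [Category.{u} C] [Category.{u} D] (F : C ⥤ D) {d : D}
    {a a₁ a₂ a₃ : C} (π : d ⟶ F.obj a) (f : a ⟶ a₁) (g : a₁ ⟶ a₂) (h : a₂ ⟶ a₃) (k : a₃ ⟶ a)
    (w : f ≫ g ≫ h ≫ k = 𝟙 a) :
    (((π ≫ F.map f) ≫ F.map g) ≫ F.map h) ≫ F.map k = π := by
  simp only [Category.assoc, ← F.map_comp, w, F.map_id, Category.comp_id]

theorem conj_comp_eq {C : Type u} [Category.{u} C] {a b c d a' b' c' d' : C} {n₁ : a ⟶ a'}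
    {n₂ : b ⟶ b'} {n₃ : c ⟶ c'} {n₄ : d ⟶ d'} [IsIso n₃] [IsIso n₄] {f : a ⟶ b} {f' : a' ⟶ b'}
    {g : b' ⟶ c'} {h : c ⟶ d} {h' : c' ⟶ d'} {k : a' ⟶ d'} (e₁ : f ≫ n₂ = n₁ ≫ f')
    (e₂ : h ≫ n₄ = n₃ ≫ h') (e₃ : f' ≫ g ≫ h' = k) :
    f ≫ (n₂ ≫ g ≫ inv n₃) ≫ h = n₁ ≫ k ≫ inv n₄ := by
  rw [← e₃, ← cancel_mono n₄]
  simp only [Category.assoc, IsIso.inv_hom_id, Category.comp_id, e₂, IsIso.inv_hom_id_assoc]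
  rw [reassoc_of% e₁]

namespace CompOp

variable {P : GPoly I J} {Q : GPoly J K}

theorem app_comp_eq {o o₁ o' : CompOp P Q} {g : o ⟶ o₁} {h : o₁ ⟶ o'} {k : o ⟶ o'} (e : g ≫ h = k)
    {x : Q.Params o.oper} {x₁ : Q.Params o₁.oper} {x' : Q.Params o'.oper}
    (f : HFib.Over g.oper x x₁) (f' : HFib.Over h.oper x₁ x') (f'' : HFib.Over k.oper x x')
    (e' : f.pt ≫ f'.pt = f''.pt) : g.app f ≫ h.app f' = k.app f'' :=
  (app_comp_app g h f f').trans (app_congr_pt e _ _ e')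

theorem app_comp_comp_eq {o o₁ o₂ o' : CompOp P Q} {g : o ⟶ o₁} {h : o₁ ⟶ o₂} {l : o₂ ⟶ o'}
    {k : o ⟶ o'} (e : g ≫ h ≫ l = k) {x : Q.Params o.oper} {x₁ : Q.Params o₁.oper}
    {x₂ : Q.Params o₂.oper} {x' : Q.Params o'.oper} (f : HFib.Over g.oper x x₁)
    (f₁ : HFib.Over h.oper x₁ x₂) (f₂ : HFib.Over l.oper x₂ x') (f' : HFib.Over k.oper x x')
    (e' : f.pt ≫ f₁.pt ≫ f₂.pt = f'.pt) : g.app f ≫ h.app f₁ ≫ l.app f₂ = k.app f' :=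
  (congrArg (g.app f ≫ ·) (app_comp_app h l f₁ f₂)).trans (app_comp_eq e f (f₁.comp f₂) f' e')

end CompOp

section CompParams

variable {Q : GPoly J K} {R : GPoly K L} {o o' o'' : CompOp Q R}

/-- The first coordinate of a parameter of an operation of a composite. -/
noncomputable abbrev fst (z : (Q.comp R).Params o) : R.Params o.oper :=
  z.pt.arg.push (CompOp.Hom.oper z.path)

/-- The second coordinate of a parameter of an operation of a composite. -/
noncomputable abbrev snd (z : (Q.comp R).Params o) : Q.Params (o.fam.obj (fst z)) :=
  z.pt.par.push (CompOp.Hom.app z.path (z.pt.arg.toPush _))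

theorem over_path {h : o ⟶ o'} {z : (Q.comp R).Params o} {z' : (Q.comp R).Params o'}
    (k : HFib.Over h z z') : CompPm.Hom.oper k.pt ≫ z'.path = z.path ≫ h := k.path

theorem over_path_oper {h : o ⟶ o'} {z : (Q.comp R).Params o} {z' : (Q.comp R).Params o'}
    (k : HFib.Over h z z') : (CompPm.Hom.oper k.pt).oper ≫ CompOp.Hom.oper z'.path
      = CompOp.Hom.oper z.path ≫ h.oper :=
  congrArg CompOp.Hom.oper (over_path k)

noncomputable abbrev fstOver {h : o ⟶ o'} {z : (Q.comp R).Params o} {z' : (Q.comp R).Params o'}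
    (k : HFib.Over h z z') : HFib.Over h.oper (fst z) (fst z') :=
  ⟨(CompPm.Hom.arg k.pt).pt, by
    dsimp only
    rw [(CompPm.Hom.arg k.pt).path_assoc, over_path_oper k, Category.assoc]⟩

noncomputable abbrev sndOver {h : o ⟶ o'} {z : (Q.comp R).Params o} {z' : (Q.comp R).Params o'}
    (k : HFib.Over h z z') : HFib.Over (h.app (fstOver k)) (snd z) (snd z') :=
  ⟨(CompPm.Hom.par k.pt).pt, by
    dsimp only
    rw [(CompPm.Hom.par k.pt).path_assoc, Category.assoc]
    congr 1
    exact CompOp.app_square (over_path k) _ _ _ _ (by simp)⟩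

noncomputable abbrev fstHom {z z' : (Q.comp R).Params o} (k : z ⟶ z') : fst z ⟶ fst z' :=
  ⟨(CompPm.Hom.arg k.pt).pt, by
    have h : (CompPm.Hom.oper k.pt).oper ≫ CompOp.Hom.oper z'.path = CompOp.Hom.oper z.path :=
      congrArg CompOp.Hom.oper k.path
    dsimp only
    rw [(CompPm.Hom.arg k.pt).path_assoc, h]⟩

noncomputable abbrev sndHom {z z' : (Q.comp R).Params o} (k : z ⟶ z') :
    HFib.Over (o.fam.map (fstHom k)) (snd z) (snd z') :=
  ⟨(CompPm.Hom.par k.pt).pt, by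
    have h : CompPm.Hom.oper k.pt ≫ z'.path = z.path := k.path
    dsimp only
    rw [(CompPm.Hom.par k.pt).path_assoc, Category.assoc, CompOp.Hom.app_map, CompOp.app_comp_app]
    congr 1
    refine CompOp.app_congr_pt h _ _ ?_
    simp⟩

/-- The operation part is forced by `h`, because the path of `z'` is a monomorphism. -/
theorem compOver_ext {h : o ⟶ o'} {z : (Q.comp R).Params o} {z' : (Q.comp R).Params o'}
    {k k' : HFib.Over h z z'} (e₁ : (CompPm.Hom.arg k.pt).pt = (CompPm.Hom.arg k'.pt).pt)
    (e₂ : (CompPm.Hom.par k.pt).pt = (CompPm.Hom.par k'.pt).pt) : k = k' :=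
  HFib.Over.ext (CompPm.hom_ext
    ((cancel_mono z'.path).1 ((over_path k).trans (over_path k').symm)) e₁ e₂)

theorem compParams_ext {z z' : (Q.comp R).Params o}
    {k k' : z ⟶ z'} (e₁ : (CompPm.Hom.arg k.pt).pt = (CompPm.Hom.arg k'.pt).pt)
    (e₂ : (CompPm.Hom.par k.pt).pt = (CompPm.Hom.par k'.pt).pt) : k = k' :=
  HFib.hom_ext (CompPm.hom_ext
    ((cancel_mono z'.path).1 (k.path.trans k'.path.symm)) e₁ e₂)

/-- Morphisms of parameters of a composite are given by their coordinates. -/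
noncomputable abbrev overMk {h : o ⟶ o'} {z : (Q.comp R).Params o} {z' : (Q.comp R).Params o'}
    (f : HFib.Over h.oper (fst z) (fst z')) (g : HFib.Over (h.app f) (snd z) (snd z')) :
    HFib.Over h z z' :=
  ⟨CompPm.homMk z.path z'.path h f g, by
    change (_ ≫ _ ≫ inv _) ≫ _ = _
    simp⟩

noncomputable abbrev paramsHomMk {z z' : (Q.comp R).Params o} (f : fst z ⟶ fst z')
    (g : HFib.Over (o.fam.map f) (snd z) (snd z')) : z ⟶ z' :=
  (overMk (h := 𝟙 o) ⟨f.pt, by simpa using f.path⟩ ⟨g.pt, g.path⟩).toHom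

/-- The parameter of an operation of a composite with given coordinates. -/
noncomputable abbrev mkParam (o : CompOp Q R) (x : R.Params o.oper) (y : Q.Params (o.fam.obj x)) :
    (Q.comp R).Params o := ⟨⟨o, x, y⟩, 𝟙 o⟩

/-- Every parameter of `o` is isomorphic, with identity coordinates, to one whose path to `o` is an
identity. This reduces families indexed by parameters of a composite to families indexed by pairs of
coordinates. -/
noncomputable abbrev toMkParam (z : (Q.comp R).Params o) : z ⟶ mkParam o (fst z) (snd z) :=
  paramsHomMk ⟨𝟙 _, by simp⟩ ⟨𝟙 _, by
    dsimp only
    rw [Q.proj.map_id, Category.id_comp]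
    congr 1⟩

noncomputable abbrev fromMkParam (z : (Q.comp R).Params o) : mkParam o (fst z) (snd z) ⟶ z :=
  paramsHomMk ⟨𝟙 _, by simp⟩ ⟨𝟙 _, by
    dsimp only
    rw [Q.proj.map_id, Category.id_comp]
    have e := (o.fam.map_comp (HFib.Over.toHom (HFib.toPush (𝟙 o.oper) (fst z)))
      ⟨𝟙 z.pt.arg.pt, by simp⟩).symm.trans
        ((congrArg o.fam.map (HFib.hom_ext (Category.id_comp _))).trans (o.fam.map_id (fst z)))
    exact ((Category.assoc _ _ _).trans ((congrArg (_ ≫ ·) e).trans (Category.comp_id _))).symm⟩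

noncomputable abbrev mkParamOver {h : o ⟶ o'} {x : R.Params o.oper} {y : Q.Params (o.fam.obj x)}
    {x' : R.Params o'.oper} {y' : Q.Params (o'.fam.obj x')} (f : HFib.Over h.oper x x')
    (g : HFib.Over (h.app f) y y') : HFib.Over h (mkParam o x y) (mkParam o' x' y') :=
  ⟨⟨h, f, g⟩, (Category.comp_id _).trans (Category.id_comp _).symm⟩

noncomputable abbrev mkParamHom {x : R.Params o.oper} {y : Q.Params (o.fam.obj x)}
    {x' : R.Params o.oper} {y' : Q.Params (o.fam.obj x')} (f : x ⟶ x')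
    (g : HFib.Over (o.fam.map f) y y') : mkParam o x y ⟶ mkParam o x' y' :=
  ⟨⟨𝟙 o, ⟨f.pt, by simp⟩, ⟨g.pt, g.path⟩⟩, Category.comp_id _⟩

end CompParams

section Associator

variable (P : GPoly I J) (Q : GPoly J K) (R : GPoly K L)

variable {P Q R} in
/-- The underlying operation of the associated operation. -/
noncomputable abbrev assocOperObjOper (o : CompOp (P.comp Q) R) : CompOp Q R where
  oper := o.oper
  fam := o.fam ⋙ { obj := fun q => q.oper, map := fun f => f.oper }
  typ x := o.typ x
  typ_naturality f := o.typ_naturality f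

variable {P Q R} in
noncomputable abbrev assocOperMapOper {o o' : CompOp (P.comp Q) R} (h : o ⟶ o') :
    assocOperObjOper o ⟶ assocOperObjOper o' where
  oper := h.oper
  app f := CompOp.Hom.oper (h.app f)
  naturality g f k := congrArg CompOp.Hom.oper (h.naturality g f k)
  typ f := h.typ f

variable {P Q R} in
noncomputable abbrev assocOperObj (o : CompOp (P.comp Q) R) : CompOp P (Q.comp R) where
  oper := assocOperObjOper o
  fam :=
    { obj := fun z => CompOp.fam (o.fam.obj (fst z :)) |>.obj (snd z)
      map := fun k => CompOp.Hom.app (o.fam.map (fstHom k :)) (sndHom k)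
      map_id := fun z => by
        refine (CompOp.app_congr_pt (o.fam.map_id (fst z :)) _ ⟨𝟙 _, by simp⟩ rfl).trans ?_
        exact (congrArg (CompOp.fam (o.fam.obj (fst z :))).map (HFib.hom_ext rfl)).trans
          ((CompOp.fam (o.fam.obj (fst z :))).map_id _)
      map_comp := fun f g => by
        rw [CompOp.app_comp_app]
        exact CompOp.app_congr_pt (o.fam.map_comp (fstHom f :) (fstHom g :)) _ _ rfl }
  typ z := CompOp.typ (o.fam.obj (fst z :)) (snd z)
  typ_naturality k := CompOp.Hom.typ (o.fam.map (fstHom k :)) (sndHom k)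

variable {P Q R} in
noncomputable abbrev assocOperMap {o o' : CompOp (P.comp Q) R} (h : o ⟶ o') :
    assocOperObj o ⟶ assocOperObj o' where
  oper := assocOperMapOper h
  app k := CompOp.Hom.app (h.app (fstOver k :)) (sndOver k)
  naturality g f k := by
    exact CompOp.app_comp_comp_eq (h.naturality (fstHom g :) (fstOver f :) (fstHom k :)) _ _ _ _
      (Category.assoc _ _ _).symm
  typ k := CompOp.Hom.typ (h.app (fstOver k :)) (sndOver k)

/-- The associator on operations. -/
noncomputable abbrev assocOper : CompOp (P.comp Q) R ⥤ CompOp P (Q.comp R) where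
  obj := assocOperObj
  map := assocOperMap
  map_id o := CompOp.hom_ext (CompOp.hom_ext rfl fun _ => rfl) fun _ => rfl
  map_comp g h := CompOp.hom_ext (CompOp.hom_ext rfl fun _ => rfl) fun f => by
    rw [CompOp.comp_app]
    dsimp only
    refine (CompOp.app_comp_eq ?_ _ _ (sndOver f) (Category.id_comp _)).symm
    exact CompOp.app_comp_eq (P := P.comp Q) rfl _ _ _ (Category.id_comp _)

section

variable {P Q R} {o o' : CompOp (P.comp Q) R}

/-- Comparison of a nested value of an associated operation with the original one. -/
noncomputable abbrev nestIn (o : CompOp (P.comp Q) R) (x : R.Params o.oper)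
    (y : Q.Params (CompOp.oper (o.fam.obj x))) :
    (CompOp.fam (o.fam.obj x)).obj y
      ⟶ (assocOperObj o).fam.obj (mkParam (assocOperObjOper o) x y) :=
  -- The first coordinate of `mkParam` has the path of `x` followed by an identity. It is isomorphic
  -- to `x` through an identity point, but not the same by definition; this is why a comparison is
  -- needed.
  CompOp.Hom.app (o.fam.map (⟨𝟙 x.pt, by simp⟩ : x ⟶ (fst (mkParam (assocOperObjOper o) x y) :)))
    ⟨𝟙 y.pt, by simp; rfl⟩

theorem nestIn_naturality (h : o ⟶ o') {x : R.Params o.oper} {x' : R.Params o'.oper}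
    (f : HFib.Over h.oper x x') {y : Q.Params (CompOp.oper (o.fam.obj x))}
    {y' : Q.Params (CompOp.oper (o'.fam.obj x'))} (g : HFib.Over (CompOp.Hom.oper (h.app f)) y y') :
    CompOp.Hom.app (h.app f) g ≫ nestIn o' x' y'
      = nestIn o x y ≫ (assocOperMap h).app (mkParamOver (h := assocOperMapOper h) f g) := by
  refine CompOp.app_square ?_ _ _ _ _ ((Category.comp_id _).trans (Category.id_comp _).symm)
  rw [CompOp.Hom.app_map, CompOp.Hom.map_app]
  refine CompOp.app_congr_pt (P := P.comp Q) rfl _ _ ?_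
  exact (Category.comp_id _).trans (Category.id_comp _).symm

instance (o : CompOp (P.comp Q) R) (x : R.Params o.oper)
    (y : Q.Params (CompOp.oper (o.fam.obj x))) : IsIso (nestIn o x y) := inferInstance

/-- The comparison `nestIn` is invertible and natural, so each nested component of `h` can be
recovered from a component of its image at a pair `mkParam`. -/
instance : (assocOper P Q R).Faithful where
  map_injective {o o'} h h' e := by
    have e₁ : h.oper = h'.oper := congrArg (fun k => CompOp.Hom.oper (CompOp.Hom.oper k)) e
    refine CompOp.hom_ext e₁ fun {x x'} f => ?_
    refine CompOp.hom_ext ?_ fun {y y'} g => ?_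
    · exact CompOp.app_congr (congrArg CompOp.Hom.oper e) f
    · rw [← cancel_mono (nestIn o' x' y'), nestIn_naturality]
      refine Eq.trans ?_ (nestIn_naturality h' _ _).symm
      congr 1
      exact CompOp.app_congr_pt e _ _ (CompPm.hom_ext (congrArg CompOp.Hom.oper e) rfl rfl)

theorem nestIn_map (o : CompOp (P.comp Q) R) {x x' : R.Params o.oper} (f : x ⟶ x')
    {y : Q.Params (CompOp.oper (o.fam.obj x))} {y' : Q.Params (CompOp.oper (o.fam.obj x'))}
    (g : HFib.Over (CompOp.Hom.oper (o.fam.map f)) y y') :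
    CompOp.Hom.app (o.fam.map f) g ≫ nestIn o x' y' = nestIn o x y ≫
      (assocOperObj o).fam.map (mkParamHom (o := assocOperObjOper o) f g) := by
  refine CompOp.app_square ?_ _ _ _ _ ((Category.comp_id _).trans (Category.id_comp _).symm)
  rw [← o.fam.map_comp, ← o.fam.map_comp]
  congr 1
  ext
  simp

theorem nestIn_fam (o : CompOp (P.comp Q) R) (x : R.Params o.oper)
    {y y' : Q.Params (CompOp.oper (o.fam.obj x))} (k : y ⟶ y') :
    (CompOp.fam (o.fam.obj x)).map k ≫ nestIn o x y' = nestIn o x y ≫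
      (assocOperObj o).fam.map (mkParamHom (o := assocOperObjOper o) (𝟙 x)
        ⟨k.pt, by simp⟩) := by
  rw [← nestIn_map]
  congr 1
  exact CompOp.app_congr_pt (o.fam.map_id x).symm ⟨k.pt, by simp⟩ _ rfl

theorem nestIn_typ (o : CompOp (P.comp Q) R) (x : R.Params o.oper)
    (y : Q.Params (CompOp.oper (o.fam.obj x))) :
    P.tgt.map (nestIn o x y) ≫ (assocOperObj o).typ (mkParam (assocOperObjOper o) x y)
      = CompOp.typ (o.fam.obj x) y := by
  refine (CompOp.Hom.typ (o.fam.map _) _).trans ?_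
  rw [Q.src.map_id]
  exact Category.comp_id _

/-- A morphism between associated operations, on families. -/
noncomputable abbrev assocPreimageApp (F : assocOperObj o ⟶ assocOperObj o') {x : R.Params o.oper}
    {x' : R.Params o'.oper} (f : HFib.Over (CompOp.Hom.oper F.oper :) x x') :
    o.fam.obj x ⟶ o'.fam.obj x' where
  oper := (F.oper.app f :)
  app {y y'} g := nestIn o x y ≫ F.app (mkParamOver (h := F.oper) f g) ≫ inv (nestIn o' x' y')
  naturality {y₁ y y' y₁'} g k l := by
    have h : inv (nestIn o' x' y') ≫ (CompOp.fam (o'.fam.obj x')).map l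
        = (assocOperObj o').fam.map (mkParamHom (o := assocOperObjOper o') (𝟙 x')
          ⟨l.pt, by simp⟩) ≫ inv (nestIn o' x' y₁') := by
      rw [IsIso.inv_comp_eq, ← Category.assoc, IsIso.eq_comp_inv]
      exact nestIn_fam o' x' l
    rw [Category.assoc, Category.assoc, h, ← Category.assoc, nestIn_fam, Category.assoc]
    congr 1
    refine (comp_comp_comp_eq (F.naturality _ _ _) _).trans ?_
    congr 2
    refine compOver_ext ?_ rfl
    change (𝟙 _ ≫ f.pt) ≫ 𝟙 _ = f.pt
    simp
  typ {y y'} g := by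
    have h := F.typ (mkParamOver (h := F.oper) f g)
    rw [← nestIn_typ o x y, Category.assoc, P.tgt.map_comp, P.tgt.map_comp, Category.assoc,
      Category.assoc]
    refine congrArg _ (Eq.trans ?_ h)
    congr 1
    rw [Functor.map_inv, IsIso.inv_comp_eq]
    exact (nestIn_typ o' x' y').symm

/-- A morphism between associated operations comes from a morphism of operations. -/
noncomputable abbrev assocPreimage (F : assocOperObj o ⟶ assocOperObj o') : o ⟶ o' where
  oper := (CompOp.Hom.oper F.oper :)
  app f := assocPreimageApp F f
  naturality {x₁ x x' x₁'} g k l := by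
    refine CompOp.hom_ext (F.oper.naturality g k l) fun {y y'} m => ?_
    rw [CompOp.comp_app, CompOp.comp_app]
    refine conj_comp_eq (nestIn_map o g _) (nestIn_map o' l _) ((F.naturality _ _ _).trans ?_)
    congr 1
    refine compOver_ext rfl ?_
    change (𝟙 _ ≫ 𝟙 _) ≫ m.pt = m.pt
    simp
  typ {x x'} f := F.oper.typ f

instance : (assocOper P Q R).Full where
  map_surjective {o o'} F := ⟨assocPreimage F, by
    refine CompOp.hom_ext (CompOp.hom_ext rfl fun f => rfl) fun {z z'} f => ?_
    change nestIn o (fst z :) (snd z) ≫ F.app _ ≫ inv (nestIn o' (fst z' :) (snd z')) = F.app f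
    -- On coordinates of `z` the comparison is the action of the associated family on `toMkParam z`,
    -- so naturality of `F` along `toMkParam` undoes the conjugation in the preimage.
    have e (o : CompOp (P.comp Q) R) (z : (Q.comp R).Params (assocOperObjOper o)) :
        nestIn o (fst z :) (snd z) = (assocOperObj o).fam.map (toMkParam z) :=
      CompOp.app_congr_pt (P := P) rfl _ _ rfl
    rw [← Category.assoc, IsIso.comp_inv_eq, e, e, F.map_app, F.app_map]
    congr 1
    refine compOver_ext ?_ ?_
    · exact (Category.id_comp _).trans (Category.comp_id _).symm
    · exact (Category.id_comp _).trans (Category.comp_id _).symm⟩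

noncomputable abbrev assocLiftObj (o : CompOp P (Q.comp R)) (x : R.Params o.oper.oper) :
    CompOp P Q where
  oper := o.oper.fam.obj x
  fam :=
    { obj := fun y => o.fam.obj (mkParam o.oper x y)
      map := fun k => o.fam.map (mkParamHom (𝟙 x) ⟨k.pt, by simp⟩)
      map_id := fun y => (congrArg o.fam.map (HFib.hom_ext rfl)).trans (o.fam.map_id _)
      map_comp := fun f g => by
        rw [← o.fam.map_comp]
        congr 1
        exact compParams_ext (Category.comp_id _).symm rfl }
  typ y := o.typ (mkParam o.oper x y)
  typ_naturality {y y'} k := o.typ_naturality (mkParamHom (𝟙 x) ⟨k.pt, by simp⟩)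

noncomputable abbrev assocLiftMap (o : CompOp P (Q.comp R)) {x x' : R.Params o.oper.oper}
    (f : x ⟶ x') : assocLiftObj o x ⟶ assocLiftObj o x' where
  oper := o.oper.fam.map f
  app g := o.fam.map (mkParamHom f g)
  naturality g k l := by
    dsimp only
    rw [← o.fam.map_comp, ← o.fam.map_comp]
    congr 1
    refine compParams_ext ?_ (Category.assoc _ _ _).symm
    change 𝟙 _ ≫ f.pt ≫ 𝟙 _ = f.pt
    simp
  typ g := o.typ_naturality (mkParamHom f g)

/-- The operation of the left bracketing with given image. -/
noncomputable abbrev assocLift (o : CompOp P (Q.comp R)) : CompOp (P.comp Q) R where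
  oper := o.oper.oper
  fam :=
    { obj := assocLiftObj o
      map := assocLiftMap o
      map_id := fun x => CompOp.hom_ext (o.oper.fam.map_id x) fun f => rfl
      map_comp := fun f g => CompOp.hom_ext (o.oper.fam.map_comp f g) fun k => by
        rw [CompOp.comp_app]
        dsimp only
        rw [← o.fam.map_comp]
        congr 1
        exact compParams_ext rfl (Category.id_comp _).symm }
  typ x := o.oper.typ x
  typ_naturality f := o.oper.typ_naturality f

/-- The lifted operation has as values those of `o` at pairs `mkParam`; `fromMkParam` compares them
with the values at arbitrary parameters. -/
noncomputable abbrev assocLiftHom (o : CompOp P (Q.comp R)) : assocOperObj (assocLift o) ⟶ o where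
  oper := 𝟙 o.oper
  app {z z'} k := o.fam.map (fromMkParam z ≫ k.toHom)
  naturality g f h := by
    refine (congrArg (_ ≫ ·) (o.fam.map_comp _ _).symm).trans ((o.fam.map_comp _ _).symm.trans ?_)
    congr 1
    refine compParams_ext ?_ ?_
    · change (fstHom g).pt ≫ (𝟙 _ ≫ (fstOver f).pt) ≫ (fstHom h).pt = 𝟙 _ ≫ ((fstHom g).pt ≫ _) ≫ _
      simp
    · change (sndHom g).pt ≫ (𝟙 _ ≫ (sndOver f).pt) ≫ (sndHom h).pt = 𝟙 _ ≫ ((sndHom g).pt ≫ _) ≫ _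
      simp
  typ f := by
    refine (o.typ_naturality _).trans (congrArg (_ ≫ ·) (congrArg Q.src.map ?_))
    exact Category.id_comp _

instance : (assocOper P Q R).EssSurj where
  mem_essImage o := ⟨assocLift o, ⟨asIso (assocLiftHom o)⟩⟩

instance : (assocOper P Q R).IsEquivalence where


/-- The image of a parameter under the associator. -/
noncomputable abbrev assocPmObj (p : CompPm (P.comp Q) R) : CompPm P (Q.comp R) where
  oper := assocOperObj p.oper
  arg := mkParam (assocOperObjOper p.oper) p.arg (fst p.par)
  par := (snd p.par).push (nestIn p.oper p.arg (fst p.par))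

noncomputable abbrev assocPmMap {p p' : CompPm (P.comp Q) R} (f : p ⟶ p') :
    assocPmObj p ⟶ assocPmObj p' where
  oper := assocOperMap f.oper
  arg := mkParamOver (h := assocOperMapOper f.oper) f.arg (fstOver f.par)
  par := ⟨(sndOver f.par).pt, by
    dsimp only
    rw [(sndOver f.par).path_assoc, nestIn_naturality]
    exact (Category.assoc _ _ _).symm⟩

variable (P Q R) in
/-- The associator on parameters. -/
noncomputable abbrev assocPm : CompPm (P.comp Q) R ⥤ CompPm P (Q.comp R) where
  obj := assocPmObj
  map := assocPmMap
  map_id _ := CompPm.hom_ext ((assocOper P Q R).map_id _)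
    (CompPm.hom_ext (congrArg CompOp.Hom.oper ((assocOper P Q R).map_id _)) rfl rfl) rfl
  map_comp _ _ := CompPm.hom_ext ((assocOper P Q R).map_comp _ _)
    (CompPm.hom_ext (congrArg CompOp.Hom.oper ((assocOper P Q R).map_comp _ _)) rfl rfl) rfl

instance : (assocPm P Q R).Faithful where
  map_injective {p p'} f f' e := by
    have e₁ : f.oper = f'.oper := (assocOper P Q R).map_injective (congrArg CompPm.Hom.oper e :)
    have e₂ : f.arg.pt = f'.arg.pt := congrArg (fun k => (CompPm.Hom.arg k.arg.pt).pt) e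
    refine CompPm.hom_ext e₁ e₂ (CompPm.hom_ext ?_ ?_ (congrArg (fun k => k.par.pt) e :))
    · exact (cancel_mono p'.par.path).1 ((over_path f.par).trans
        ((congrArg (p.par.path ≫ ·) (CompOp.app_congr_pt e₁ _ _ e₂)).trans (over_path f'.par).symm))
    · exact congrArg (fun k => (CompPm.Hom.par k.arg.pt).pt) e

instance : (assocPm P Q R).Full where
  map_surjective {p p'} F := by
    obtain ⟨Fo, Fa, Fp⟩ := F
    obtain ⟨k, rfl⟩ := (assocOper P Q R).map_surjective Fo
    -- Both first coordinates are of the form `mkParam`, with identity paths, so the operation part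
    -- of `Fa` is exactly the image of `k`.
    have e : CompPm.Hom.oper Fa.pt = assocOperMapOper k :=
      (Category.comp_id _).symm.trans ((over_path Fa).trans (Category.id_comp _))
    let a : HFib.Over k.oper p.arg p'.arg := ⟨(CompPm.Hom.arg Fa.pt).pt, by
      have h := (CompPm.Hom.arg Fa.pt).path
      exact h.trans (congrArg (fun t : assocOperObjOper p.oper ⟶ assocOperObjOper p'.oper =>
        p.arg.path ≫ (CompOp.Hom.oper t :)) e)⟩
    let b : HFib.Over (CompOp.Hom.oper (k.app a)) (fst p.par) (fst p'.par) :=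
      ⟨(CompPm.Hom.par Fa.pt).pt, (CompPm.Hom.par Fa.pt).path.trans
        (congrArg (_ ≫ ·) (CompOp.app_congr_pt e _ _ rfl))⟩
    have e' : Fa = mkParamOver (h := assocOperMapOper k) a b := compOver_ext rfl rfl
    refine ⟨
      { oper := k
        arg := a
        par := overMk b ⟨Fp.pt, ?_⟩ },
      CompPm.hom_ext rfl (congrArg HFib.Over.pt e').symm rfl⟩
    apply (cancel_mono (nestIn p'.oper p'.arg (fst p'.par))).1
    refine (Category.assoc _ _ _).trans (Fp.path.trans ((Category.assoc _ _ _).trans (Eq.trans ?_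
      (Category.assoc _ _ _).symm)))
    refine congrArg ((snd p.par).path ≫ ·) (Eq.trans ?_ (nestIn_naturality k a b).symm)
    exact congrArg (fun t => nestIn p.oper p.arg (fst p.par) ≫ (assocOperMap k).app t) e'

instance : (assocPm P Q R).EssSurj where
  mem_essImage x := by
    let p : CompPm (P.comp Q) R :=
      { oper := assocLift x.oper
        arg := (fst x.arg :)
        par := mkParam (assocLiftObj x.oper (fst x.arg)) (snd x.arg)
          (x.par.push (x.oper.fam.map (toMkParam x.arg))) }
    let a : mkParam x.oper.oper (fst x.arg) (fst p.par) ⟶ x.arg :=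
      (mkParamHom (y := fst p.par) (y' := snd x.arg) (𝟙 (fst x.arg)) ⟨𝟙 _, by simp [p]⟩) ≫
        fromMkParam x.arg
    let f : assocPmObj p ⟶ x :=
      { oper := assocLiftHom x.oper
        arg := ⟨a.pt, a.path.trans (Category.comp_id _).symm⟩
        par := ⟨𝟙 x.par.pt, ?_⟩ }
    · exact ⟨p, ⟨asIso f⟩⟩
    rw [P.proj.map_id, Category.id_comp]
    -- The comparison maps between `x.arg` and the pair of its coordinates all have identity points,
    -- so they compose to the identity.
    refine (comp_map_four x.oper.fam _ _ _ _ _ ?_).symm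
    refine compParams_ext ?_ ?_
    · change 𝟙 x.arg.pt.arg.pt ≫ 𝟙 _ ≫ 𝟙 _ ≫ 𝟙 _ ≫ 𝟙 _ ≫ 𝟙 _ = 𝟙 x.arg.pt.arg.pt
      simp
    · change 𝟙 x.arg.pt.par.pt ≫ 𝟙 _ ≫ 𝟙 _ ≫ 𝟙 _ ≫ 𝟙 _ ≫ 𝟙 _ = 𝟙 x.arg.pt.par.pt
      simp

instance : (assocPm P Q R).IsEquivalence where

variable (P Q R) in
/-- The associator. -/
noncomputable abbrev assoc : Eqv ((P.comp Q).comp R) (P.comp (Q.comp R)) where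
  oper := assocOper P Q R
  pm := assocPm P Q R
  src := Iso.refl _
  proj := Iso.refl _
  tgt := Iso.refl _

end

end Associator

end GPoly

/-! ### Functoriality of left whiskering and the exchange law. -/

namespace GPoly

variable {I J K L M : Type u} [Groupoid.{u} I] [Groupoid.{u} J] [Groupoid.{u} K] [Groupoid.{u} L]
  [Groupoid.{u} M]

/-- Whiskerings and associators preserve identities by extensionality, not by definition. Here and
below, morphisms that ought to be identities are therefore variables with a hypothesis `k = 𝟙 _`,
which is substituted away. -/
theorem CompOp.app_eq_map {P : GPoly I J} {Q : GPoly J K} {o : CompOp P Q} {k : o ⟶ o}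
    (e : k = 𝟙 o) {x y : Q.Params o.oper} (f : HFib.Over k.oper x y) (g : x ⟶ y)
    (e' : f.pt = g.pt) : k.app f = o.fam.map g :=
  (app_congr_pt e f ⟨g.pt, by simp⟩ e').trans rfl

namespace Eqv

section Adj

variable {Q Q' Q'' : GPoly J K} (η : Eqv Q Q') {c : Q.Op}

/-- The adjunct of a morphism out of the image of a parameter. -/
noncomputable abbrev adj {x : Q.Params c} {y : Q'.Params (η.oper.obj c)} (g : η.fib x ⟶ y) :
    x ⟶ (η.unfib c).obj y := η.un x ≫ (η.unfib c).map g

@[simp] theorem map_adj {x : Q.Params c} {y : Q'.Params (η.oper.obj c)} (g : η.fib x ⟶ y) :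
    η.pm.map (η.adj g).pt = g.pt ≫ inv (η.cu y).pt := by
  rw [IsIso.eq_comp_inv, HFib.comp_pt, η.pm.map_comp, Category.assoc, η.cu_naturality, map_un,
    IsIso.inv_hom_id_assoc]

theorem adj_comp {x : Q.Params c} {y z : Q'.Params (η.oper.obj c)} (g : η.fib x ⟶ y)
    (h : y ⟶ z) : η.adj g ≫ (η.unfib c).map h = η.adj (g ≫ h) := by
  rw [adj, adj, Functor.map_comp, Category.assoc]

theorem comp_adj {w x : Q.Params c} {y : Q'.Params (η.oper.obj c)} (k : w ⟶ x)
    (g : η.fib x ⟶ y) : k ≫ η.adj g = η.adj ((η.fibFunctor c).map k ≫ g) := by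
  rw [adj, adj, Functor.map_comp, ← Category.assoc, un_naturality, Category.assoc]

theorem adj_conj {w x : Q.Params c} {y z : Q'.Params (η.oper.obj c)} (k : w ⟶ x)
    (g : η.fib x ⟶ y) (h : y ⟶ z) (g' : η.fib w ⟶ z)
    (e : η.pm.map k.pt ≫ g.pt ≫ h.pt = g'.pt) :
    k ≫ η.adj g ≫ (η.unfib c).map h = η.adj g' := by
  rw [adj_comp, comp_adj]
  congr 1
  exact HFib.hom_ext e

theorem fam_adj_conj {P : GPoly I J} (o : CompOp P Q) {w x : Q.Params o.oper}
    {y z : Q'.Params (η.oper.obj o.oper)} (k : w ⟶ x) (g : η.fib x ⟶ y) (h : y ⟶ z)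
    (g' : η.fib w ⟶ z) (e : η.pm.map k.pt ≫ g.pt ≫ h.pt = g'.pt) :
    o.fam.map k ≫ o.fam.map (η.adj g) ≫ o.fam.map ((η.unfib _).map h) = o.fam.map (η.adj g') := by
  rw [← o.fam.map_comp, ← o.fam.map_comp]
  exact congrArg o.fam.map (η.adj_conj k g h g' e)

/-- Naturality of transposition over a changing operation. It may be checked after applying the
faithful functor `η.pm`, where transposition appends an inverse counit and lowering conjugates by
counits. -/
theorem adj_lower {d : Q.Op} {γ : c ⟶ d} {w : Q.Params c} {w' : Q.Params d}
    {y : Q'.Params (η.oper.obj c)} {y' : Q'.Params (η.oper.obj d)} (f : HFib.Over γ w w')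
    (g' : η.fib w' ⟶ y') (g : η.fib w ⟶ y) (f' : HFib.Over (η.oper.map γ) y y')
    (e : η.pm.map f.pt ≫ g'.pt = g.pt ≫ f'.pt) :
    f.post (η.adj g') = (η.lower f').pre (η.adj g) := by
  apply η.over_ext
  rw [HFib.Over.pre_pt, HFib.Over.post_pt, η.pm.map_comp, η.pm.map_comp, map_lower, map_adj,
    map_adj, reassoc_of% e]
  simp

theorem adj_typ {P : GPoly I J} (o : CompOp P Q) {x : Q.Params o.oper}
    {y : Q'.Params (η.oper.obj o.oper)} (g : η.fib x ⟶ y) :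
    P.tgt.map (o.fam.map (η.adj g)) ≫ (η.operLeftObj P o).typ y
      = o.typ x ≫ η.src.inv.app x.pt ≫ Q'.src.map g.pt := by
  rw [o.fam.map_comp, P.tgt.map_comp, Category.assoc]
  refine (congrArg (_ ≫ ·) ((η.operLeftObj P o).typ_naturality g)).trans ?_
  rw [← Category.assoc, un_typ, Category.assoc]

end Adj

section Laws

variable {P P' P'' : GPoly I J} {Q Q' Q'' : GPoly J K}

/-- The canonical morphism over an equivalence from an operation to the whiskered one. -/
noncomputable abbrev Het.unit (η : Eqv Q Q') (o : CompOp P Q) : Het η o (η.operLeftObj P o) where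
  oper := 𝟙 _
  app f := o.fam.map (η.adj f.toHom)
  naturality {x' x y y'} g f h := by
    exact η.fam_adj_conj o _ _ _ _ (Category.assoc _ _ _).symm
  typ f := η.adj_typ o f.toHom

/-- `leftHom` expects an equivalence before the whiskering; the identity takes that place. Over the
identity equivalence the action on parameters keeps points, so the family of `o` itself provides the
components. -/
noncomputable def whiskerLeftRefl (P : GPoly I J) (Q : GPoly J K) :
    (Eqv.refl (P.comp Q)).trans ((Eqv.refl Q).whiskerLeft P) ⟶ Eqv.refl (P.comp Q) :=
  leftHom (A := Eqv.refl (P.comp Q)) (B := Eqv.refl (P.comp Q))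
    (fun o =>
      { oper := 𝟙 o.oper
        app := fun f => o.fam.map ⟨f.pt, by simp⟩
        naturality := fun g f h => by
          dsimp only [Functor.id_obj, Functor.id_map]
          rw [← o.fam.map_comp, ← o.fam.map_comp]
          congr 1
          ext
          simp
        typ := fun f => by
          refine (o.typ_naturality _).trans ?_
          simp })
    (fun h => (Category.comp_id _).trans (Category.id_comp _).symm)
    (fun {a a'} h {x x' y y'} f k' k f' w => by
      refine (CompOp.Hom.app_map h _ _).trans (Eq.trans ?_ (CompOp.Hom.map_app h _ _).symm)
      congr 1
      exact HFib.Over.ext w)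
    (fun e => ⟨𝟙 _, by simp⟩)
    (fun e => ⟨𝟙 _, by
      rw [P.proj.map_id, Category.id_comp]
      exact ((congrArg (_ ≫ ·) (e.oper.fam.map_id _)).trans (Category.comp_id _)).symm⟩)
    (fun f => (Category.comp_id _).trans (Category.id_comp _).symm)
    (fun f => (Category.comp_id _).trans (Category.id_comp _).symm)
    (fun e => by simp)
    (fun b => by simp)

theorem trans_src_inv (η : Eqv Q Q') (θ : Eqv Q' Q'') (x : Q.Pm) :
    (η.trans θ).src.inv.app x = η.src.inv.app x ≫ θ.src.inv.app (η.pm.obj x) := rfl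

/-- A morphism out of the image of a parameter under a composite. -/
abbrev transFibHom (η : Eqv Q Q') (θ : Eqv Q' Q'') {c : Q.Op} {x : Q.Params c}
    {y : Q''.Params (θ.oper.obj (η.oper.obj c))} (f : HFib.Over (𝟙 _) ((η.trans θ).fib x) y) :
    θ.fib (η.fib x) ⟶ y := ⟨f.pt, by simp⟩

/-- A morphism over the composite is transposed first across `θ` and then across `η`, which is where
the iterated whiskering reads the family. -/
noncomputable abbrev Het.transUnit (η : Eqv Q Q') (θ : Eqv Q' Q'') (o : CompOp P Q) :
    Het (η.trans θ) o (θ.operLeftObj P (η.operLeftObj P o)) where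
  oper := 𝟙 _
  app f := o.fam.map (η.adj (θ.adj (transFibHom η θ f)))
  naturality g f h := by
    refine η.fam_adj_conj o _ _ _ _ (congrArg HFib.Hom.pt
      (θ.adj_conj ((η.fibFunctor _).map g) _ h _ ?_) :)
    exact (Category.assoc _ _ _).symm
  typ {x y} f := by
    rw [o.fam.map_comp, P.tgt.map_comp, Category.assoc]
    refine (congrArg (_ ≫ ·) (θ.adj_typ (η.operLeftObj P o) _)).trans ?_
    rw [← Category.assoc, un_typ, Category.assoc]
    exact congrArg (_ ≫ ·) ((Category.assoc _ _ _).symm.trans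
      (congrArg (· ≫ _) (trans_src_inv η θ x.pt).symm))

theorem transUnit_naturality (η : Eqv Q Q') (θ : Eqv Q' Q'') {a a' : CompOp P Q} (h : a ⟶ a')
    {x : Q.Params a.oper} {x' : Q.Params a'.oper} {y : Q''.Params (θ.oper.obj (η.oper.obj a.oper))}
    {y' : Q''.Params (θ.oper.obj (η.oper.obj a'.oper))} (f : HFib.Over h.oper x x')
    (k' : HFib.Over (𝟙 _) ((η.trans θ).fib x') y') (k : HFib.Over (𝟙 _) ((η.trans θ).fib x) y)
    (f' : HFib.Over (θ.oper.map (η.oper.map h.oper)) y y')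
    (w : θ.pm.map (η.pm.map f.pt) ≫ k'.pt = k.pt ≫ f'.pt) :
    h.app f ≫ (Het.transUnit η θ a').app k'
      = (Het.transUnit η θ a).app k ≫ (θ.operLeftMap P (η.operLeftMap P h)).app f' := by
  refine (h.app_map _ _).trans (Eq.trans ?_ (h.map_app _ _).symm)
  congr 1
  exact η.adj_lower _ _ _ _ (congrArg HFib.Over.pt (θ.adj_lower (η.fibOver f)
    (transFibHom η θ k') (transFibHom η θ k) f' w))

/-- The iterated whiskering moves the second coordinate along two units; pulling `i` through both
transpositions by `comp_adj` gives the same element of the family. -/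
theorem par_transUnit (η : Eqv Q Q') (θ : Eqv Q' Q'') (o : CompOp P Q) {x x' : Q.Params o.oper}
    {y : Q''.Params (θ.oper.obj (η.oper.obj o.oper))} {c : P.Op} (π : c ⟶ o.fam.obj x)
    {k : θ.operLeftObj P (η.operLeftObj P o) ⟶ θ.operLeftObj P (η.operLeftObj P o)} (hk : k = 𝟙 _)
    {k₀ : o ⟶ o} (hk₀ : k₀ = 𝟙 _) (g : HFib.Over k.oper (θ.fib (η.fib x)) y)
    (i : HFib.Over k₀.oper x x') (g' : HFib.Over (𝟙 _) ((η.trans θ).fib x') y)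
    (h : g.pt = θ.pm.map (η.pm.map i.pt) ≫ g'.pt) :
    ((π ≫ o.fam.map (η.un x)) ≫ (η.operLeftObj P o).fam.map (θ.un (η.fib x))) ≫ k.app g
        = (π ≫ k₀.app i) ≫ (Het.transUnit η θ o).app g' := by
  subst hk hk₀
  have e : HFib.Over.toHom g = (θ.fibFunctor _).map ((η.fibFunctor _).map (HFib.Over.toHom i)) ≫
    transFibHom η θ g' := HFib.hom_ext h
  change ((π ≫ o.fam.map _) ≫ o.fam.map ((η.unfib _).map _)) ≫
    o.fam.map ((η.unfib _).map ((θ.unfib _).map (HFib.Over.toHom g)))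
      = (π ≫ o.fam.map (HFib.Over.toHom i)) ≫ o.fam.map _
  rw [e]
  simp only [Category.assoc, ← o.fam.map_comp, ← Functor.map_comp]
  rw [comp_adj, comp_adj]

noncomputable def whiskerLeftTrans (P : GPoly I J) (η : Eqv Q Q') (θ : Eqv Q' Q'') :
    (Eqv.refl (P.comp Q)).trans ((η.trans θ).whiskerLeft P)
      ⟶ (η.whiskerLeft P).trans (θ.whiskerLeft P) :=
  leftHom (A := Eqv.refl (P.comp Q)) (B := (η.whiskerLeft P).trans (θ.whiskerLeft P))
    (fun o => Het.transUnit η θ o)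
    (fun h => (Category.comp_id _).trans (Category.id_comp _).symm)
    (fun {a a'} h {x x' y y'} f k' k f' w => transUnit_naturality η θ h f k' k f' w)
    (fun e => ⟨𝟙 _, by simp⟩)
    (fun e => ⟨𝟙 _, by
      rw [P.proj.map_id, Category.id_comp]
      exact par_transUnit η θ e.oper e.par.path ((Category.id_comp _).trans
        ((θ.operLeft P).map_id _)) rfl _ _ _ (by simp)⟩)
    (fun f => (Category.comp_id _).trans (Category.id_comp _).symm)
    (fun f => (Category.comp_id _).trans (Category.id_comp _).symm)
    (fun e => by simp)
    (fun b => by simp)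

/-- Left whiskering changes the index of a family and right whiskering changes its values, so the
two do not interfere: the component is `η` applied to the one of `Het.unit`. -/
noncomputable abbrev Het.exchange (η : Eqv P P') (θ : Eqv Q Q') (o : CompOp P Q) :
    Het θ ((η.operRight Q).obj o) ((η.operRight Q').obj (θ.operLeftObj P o)) where
  oper := 𝟙 _
  app f := η.oper.map (o.fam.map (θ.adj f.toHom))
  naturality g f h := by
    dsimp only [Functor.comp_map, Functor.comp_obj]
    rw [← η.oper.map_comp, ← η.oper.map_comp]
    exact congrArg η.oper.map ((Het.unit θ o).naturality g f h)
  typ f := by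
    dsimp only [Functor.comp_map, Functor.comp_obj]
    rw [η.tgt_naturality_assoc, θ.adj_typ, Category.assoc]
    rfl

theorem exchange_naturality (η : Eqv P P') (θ : Eqv Q Q') {a a' : CompOp P Q} (h : a ⟶ a')
    {x : Q.Params a.oper} {x' : Q.Params a'.oper} {y : Q'.Params (θ.oper.obj a.oper)}
    {y' : Q'.Params (θ.oper.obj a'.oper)} (f : HFib.Over h.oper x x')
    (k' : HFib.Over (𝟙 _) (θ.fib x') y') (k : HFib.Over (𝟙 _) (θ.fib x) y)
    (f' : HFib.Over (θ.oper.map h.oper) y y') (w : θ.pm.map f.pt ≫ k'.pt = k.pt ≫ f'.pt) :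
    η.oper.map (h.app f) ≫ (Het.exchange η θ a').app k'
      = (Het.exchange η θ a).app k ≫ η.oper.map ((θ.operLeftMap P h).app f') := by
  dsimp only
  rw [← η.oper.map_comp, ← η.oper.map_comp, h.app_map, h.map_app]
  exact congrArg (fun t => η.oper.map (h.app t)) (θ.adj_lower f _ _ f' w)

theorem par_exchange (η : Eqv P P') (θ : Eqv Q Q') (o : CompOp P Q) {x x' : Q.Params o.oper}
    {y : Q'.Params (θ.oper.obj o.oper)} {c : P.Op} {d : P'.Op} (ρ : d ⟶ η.oper.obj c)
    (π : c ⟶ o.fam.obj x)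
    {k : (η.operRight Q').obj (θ.operLeftObj P o) ⟶ (η.operRight Q').obj (θ.operLeftObj P o)}
    (hk : k = 𝟙 _) {k₀ : (η.operRight Q).obj o ⟶ (η.operRight Q).obj o} (hk₀ : k₀ = 𝟙 _)
    (g : HFib.Over k.oper (θ.fib x) y) (i : HFib.Over k₀.oper x x')
    (g' : HFib.Over (𝟙 _) (θ.fib x') y) (h : g.pt = θ.pm.map i.pt ≫ g'.pt) :
    (ρ ≫ η.oper.map (π ≫ o.fam.map (θ.un x))) ≫ k.app g
      = ((ρ ≫ η.oper.map π) ≫ k₀.app i) ≫ (Het.exchange η θ o).app g' := by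
  subst hk hk₀
  have e : HFib.Over.toHom g = (θ.fibFunctor _).map (HFib.Over.toHom i) ≫ HFib.Over.toHom g' :=
    HFib.hom_ext h
  change (ρ ≫ _) ≫ η.oper.map (o.fam.map ((θ.unfib _).map (HFib.Over.toHom g)))
      = ((ρ ≫ η.oper.map π) ≫ η.oper.map (o.fam.map (HFib.Over.toHom i))) ≫ _
  rw [e]
  simp only [Category.assoc, ← Functor.map_comp]
  rw [comp_adj]

noncomputable def exchange (η : Eqv P P') (θ : Eqv Q Q') :
    (η.whiskerRight Q).trans (θ.whiskerLeft P') ⟶ (θ.whiskerLeft P).trans (η.whiskerRight Q') :=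
  leftHom (A := η.whiskerRight Q) (B := (θ.whiskerLeft P).trans (η.whiskerRight Q'))
    (fun o => Het.exchange η θ o)
    (fun h => (Category.comp_id _).trans (Category.id_comp _).symm)
    (fun {a a'} h {x x' y y'} f k' k f' w => exchange_naturality η θ h f k' k f' w)
    (fun e => ⟨𝟙 _, by simp⟩)
    (fun e => ⟨𝟙 _, by
      rw [P'.proj.map_id, Category.id_comp]
      exact par_exchange η θ e.oper (η.proj.hom.app _) e.par.path ((congrArg (_ ≫ ·)
        ((η.operRight Q').map_id _)).trans (Category.comp_id _)) rfl _ _ _ (by simp)⟩)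
    (fun f => (Category.comp_id _).trans (Category.id_comp _).symm)
    (fun f => (Category.comp_id _).trans (Category.id_comp _).symm)
    (fun e => by simp)
    (fun b => by simp)

end Laws

end Eqv

end GPoly

/-! ### Functoriality of right whiskering and naturality of the unitors. -/

namespace GPoly

variable {I J K L M : Type u} [Groupoid.{u} I] [Groupoid.{u} J] [Groupoid.{u} K] [Groupoid.{u} L]
  [Groupoid.{u} M]

/-- Operations of a composite with the same underlying operation and the same family. -/
noncomputable abbrev CompOp.homOfTyp {P : GPoly I J} {Q : GPoly J K} (o : CompOp P Q)
    (t : ∀ x : Q.Params o.oper, P.tgt.obj (o.fam.obj x) ⟶ Q.src.obj x.pt)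
    (n : ∀ {x y : Q.Params o.oper} (f : x ⟶ y),
      P.tgt.map (o.fam.map f) ≫ t y = t x ≫ Q.src.map f.pt)
    (h : ∀ x, o.typ x = t x) : o ⟶ CompOp.mk o.oper o.fam t n where
  oper := 𝟙 o.oper
  app f := o.fam.map (HFib.Over.toHom f)
  naturality g f k := by
    dsimp only
    rw [← o.fam.map_comp, ← o.fam.map_comp]
    congr 1
    ext
    simp
  typ {x y} f := by
    dsimp only
    rw [← h, o.typ_naturality]
    rfl

theorem CompOp.par_homOfTyp {P : GPoly I J} {Q : GPoly J K} {o : CompOp P Q}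
    {t : ∀ x : Q.Params o.oper, P.tgt.obj (o.fam.obj x) ⟶ Q.src.obj x.pt}
    (n : ∀ {x y : Q.Params o.oper} (f : x ⟶ y),
      P.tgt.map (o.fam.map f) ≫ t y = t x ≫ Q.src.map f.pt)
    {k : CompOp.mk o.oper o.fam t n ⟶ CompOp.mk o.oper o.fam t n} (hk : k = 𝟙 _)
    {k₀ : o ⟶ o} (hk₀ : k₀ = 𝟙 _) {x y x' : Q.Params o.oper} {c : P.Op}
    {π π' : c ⟶ o.fam.obj x} (e : π = π') (g : HFib.Over k.oper x y)
    (i : HFib.Over k₀.oper x x') (g' : HFib.Over (𝟙 o.oper) x' y) (h : g.pt = i.pt ≫ g'.pt) :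
    π ≫ k.app g = (π' ≫ k₀.app i) ≫ o.fam.map g'.toHom := by
  subst hk hk₀ e
  change π ≫ o.fam.map (HFib.Over.toHom g) = (π ≫ o.fam.map (HFib.Over.toHom i)) ≫ _
  rw [Category.assoc, ← o.fam.map_comp]
  congr 2
  exact HFib.hom_ext h

namespace Eqv

/-- Whiskering the identity keeps the operation and the values of the family and merely composes
`typ` with an identity, a difference that `homOfTyp` absorbs. -/
noncomputable def reflWhiskerRight (P : GPoly I J) (Q : GPoly J K) :
    (Eqv.refl P).whiskerRight Q ⟶ Eqv.refl (P.comp Q) :=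
  compHom (φ := (Eqv.refl P).whiskerRight Q) (ψ := Eqv.refl (P.comp Q))
    { app := fun o => CompOp.homOfTyp ((Eqv.operRight Q (Eqv.refl P)).obj o) o.typ o.typ_naturality
        fun x => Category.id_comp _
      naturality := fun o o' h => CompOp.hom_ext
        ((Category.comp_id _).trans (Category.id_comp _).symm) fun f => by
          rw [CompOp.comp_app, CompOp.comp_app]
          refine (h.app_map _ _).trans (Eq.trans ?_ (h.map_app _ _).symm)
          rfl }
    (fun e => ⟨𝟙 _, by simp⟩)
    (fun e => ⟨𝟙 _, by
      refine (congrArg (· ≫ _) (P.proj.map_id _)).trans ((Category.id_comp _).trans ?_)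
      exact CompOp.par_homOfTyp (o := ((Eqv.refl P).operRight Q).obj e.oper)
        e.oper.typ_naturality rfl rfl
        (Category.id_comp _).symm _ _ _ (Category.id_comp _).symm⟩)
    (fun {_ _} f => (Category.comp_id _).trans (Category.id_comp _).symm)
    (fun {_ _} f => (Category.comp_id _).trans (Category.id_comp _).symm)
    (fun e => by simp)
    (fun b => by simp)

variable {P P' P'' : GPoly I J}

/-- The two sides have the same families and differ only in the bracketing of `typ`. -/
noncomputable def transWhiskerRight (η : Eqv P P') (θ : Eqv P' P'') (Q : GPoly J K) :
    (η.trans θ).whiskerRight Q ⟶ (η.whiskerRight Q).trans (θ.whiskerRight Q) :=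
  compHom (φ := (η.trans θ).whiskerRight Q) (ψ := (η.whiskerRight Q).trans (θ.whiskerRight Q))
    { app := fun o => CompOp.homOfTyp (((η.trans θ).operRight Q).obj o) _
          (CompOp.typ_naturality ((θ.operRight Q).obj ((η.operRight Q).obj o)))
        fun x => Category.assoc _ _ _
      naturality := fun o o' h => CompOp.hom_ext
        ((Category.comp_id _).trans (Category.id_comp _).symm) fun f => by
          rw [CompOp.comp_app, CompOp.comp_app]
          refine (CompOp.Hom.app_map (((η.trans θ).operRight Q).map h) _ _).trans
            (Eq.trans ?_ (CompOp.Hom.map_app (((η.trans θ).operRight Q).map h) _ _).symm)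
          rfl }
    (fun e => ⟨𝟙 _, by simp⟩)
    (fun e => ⟨𝟙 _, by
      refine (congrArg (· ≫ _) (P''.proj.map_id _)).trans ((Category.id_comp _).trans ?_)
      refine CompOp.par_homOfTyp (o := ((η.trans θ).operRight Q).obj e.oper)
        (CompOp.typ_naturality ((θ.operRight Q).obj ((η.operRight Q).obj e.oper))) ?_ rfl
        ?_ _ _ _ (Category.id_comp _).symm
      · exact (Category.id_comp _).trans ((θ.operRight Q).map_id _)
      · simp⟩)
    (fun {_ _} f => (Category.comp_id _).trans (Category.id_comp _).symm)
    (fun {_ _} f => (Category.comp_id _).trans (Category.id_comp _).symm)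
    (fun e => by simp)
    (fun b => by simp)

/-- The unitor forgets the family, so both composites have the same underlying functors by
definition. The isomorphism has identity components and only the fillers are compared. -/
noncomputable def unitWhiskerLeft (η : Eqv P P') :
    (η.whiskerLeft (GPoly.unit I)).trans (lam P') ⟶ (lam P).trans η where
  oper := 𝟙 (lamOper P ⋙ η.oper)
  pm := 𝟙 (lamPm P ⋙ η.pm)
  src e := by
    -- Along the unit, the whiskered `typ` is the original one followed by the inverse source
    -- filler; thus the quasi-inverse disappears from the source filler of the unitor.
    have h := η.un_typ (GPoly.unit I) e.oper e.arg
    change e.oper.fam.map _ ≫ _ = _ at h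
    change P'.src.map (𝟙 _) ≫ η.src.hom.app e.arg.pt ≫ inv (e.par.path ≫ e.oper.typ e.arg)
      = inv ((e.par.path ≫ e.oper.fam.map (η.un e.arg)) ≫
        (η.operLeftObj (GPoly.unit I) e.oper).typ (η.fib e.arg)) ≫ 𝟙 _
    rw [← cancel_mono ((e.par.path ≫ e.oper.fam.map (η.un e.arg)) ≫
      (η.operLeftObj (GPoly.unit I) e.oper).typ (η.fib e.arg)), Category.comp_id,
      IsIso.inv_hom_id, Category.assoc (e.par.path), h]
    simp
  proj e := by
    change P'.proj.map (𝟙 _) ≫ η.proj.hom.app e.arg.pt ≫ η.oper.map e.arg.path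
      = ((η.fib e.arg).path ≫ 𝟙 _) ≫ 𝟙 _
    simp
  tgt b := by simp

noncomputable def whiskerRightUnit (η : Eqv P P') :
    (η.whiskerRight (GPoly.unit J)).trans (rho P') ⟶ (rho P).trans η where
  oper := 𝟙 (rhoOper P ⋙ η.oper)
  pm := 𝟙 (rhoPm P ⋙ η.pm)
  src e := by
    simp
  proj e := by
    change P'.proj.map (𝟙 _) ≫ η.proj.hom.app e.par.pt ≫ η.oper.map (rhoProj P e)
      = (((η.proj.hom.app e.par.pt ≫ η.oper.map e.par.path) ≫
        η.oper.map (e.oper.fam.map (toIdPt e.arg))) ≫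
        (rhoOper P').map (𝟙 ((η.operRight (GPoly.unit J)).obj e.oper))) ≫ 𝟙 _
    rw [(rhoOper P').map_id]
    simp
  tgt b := by
    change P'.tgt.map (𝟙 _) ≫ η.tgt.hom.app _ ≫ b.typ _ = (η.tgt.hom.app _ ≫ b.typ _) ≫ 𝟙 _
    simp

end Eqv

end GPoly

/-! ### Naturality of the associator in the third polynomial. -/

namespace GPoly

variable {I J K L M : Type u} [Groupoid.{u} I] [Groupoid.{u} J] [Groupoid.{u} K] [Groupoid.{u} L]
  [Groupoid.{u} M]

theorem CompOp.app_eq_id {P : GPoly I J} {Q : GPoly J K} {o : CompOp P Q} {k : o ⟶ o}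
    (hk : k = 𝟙 o) {x : Q.Params o.oper} (f : HFib.Over k.oper x x) (h : f.pt = 𝟙 _) :
    k.app f = 𝟙 _ :=
  (app_eq_map hk f (𝟙 x) h).trans (o.fam.map_id x)

theorem assocOperMapOper_id_path {P : GPoly I J} {Q : GPoly J K} {R : GPoly K L}
    (o : CompOp (P.comp Q) R) : 𝟙 (assocOperObjOper o) ≫ 𝟙 (assocOperObjOper o) ≫
      𝟙 (assocOperObjOper o) ≫ assocOperMapOper (𝟙 o) = 𝟙 (assocOperObjOper o) := by
  rw [Category.id_comp, Category.id_comp, Category.id_comp]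
  rfl

theorem map_id_path {C D : Type u} [Category.{u} C] [Category.{u} D] (F : C ⥤ D) (c : C) :
    (𝟙 (F.obj c) ≫ F.map (𝟙 c ≫ 𝟙 c)) ≫ 𝟙 (F.obj c) = 𝟙 (F.obj c) := by
  simp

section Nest

variable {P : GPoly I J} {Q : GPoly J K} {R : GPoly K L}

/-- The action of a family of families on a pair of morphisms of parameters. -/
noncomputable abbrev nest (o : CompOp (P.comp Q) R) {x x' : R.Params o.oper} (a : x ⟶ x')
    {y : Q.Params (CompOp.oper (o.fam.obj x))} {y' : Q.Params (CompOp.oper (o.fam.obj x'))}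
    (b : HFib.Over (CompOp.Hom.oper (o.fam.map a)) y y') :
    (CompOp.fam (o.fam.obj x)).obj y ⟶ (CompOp.fam (o.fam.obj x')).obj y' :=
  CompOp.Hom.app (o.fam.map a) b

theorem nest_comp_nest (o : CompOp (P.comp Q) R) {x x' x'' : R.Params o.oper} (a : x ⟶ x')
    (a' : x' ⟶ x'') {y : Q.Params (CompOp.oper (o.fam.obj x))}
    {y' : Q.Params (CompOp.oper (o.fam.obj x'))} {y'' : Q.Params (CompOp.oper (o.fam.obj x''))}
    (b : HFib.Over (CompOp.Hom.oper (o.fam.map a)) y y')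
    (b' : HFib.Over (CompOp.Hom.oper (o.fam.map a')) y' y'') :
    nest o a b ≫ nest o a' b' = nest o (a ≫ a')
      ((b.comp b').cast (congrArg CompOp.Hom.oper (o.fam.map_comp a a').symm)) :=
  CompOp.app_comp_eq (o.fam.map_comp a a').symm _ _ _ rfl

section

variable {o : CompOp (P.comp Q) R} {x : R.Params o.oper}
    {y : Q.Params (CompOp.oper (o.fam.obj x))} {k : assocOperObj o ⟶ assocOperObj o} (hk : k = 𝟙 _)
    {z : (Q.comp R).Params (assocOperObjOper o)}
    (t : HFib.Over k.oper (mkParam (assocOperObjOper o) x y) z)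

include hk in
noncomputable abbrev nestFst : x ⟶ (fst z :) :=
  ⟨(CompPm.Hom.arg t.pt).pt, by
    subst hk
    simpa using (fstOver t).path⟩

noncomputable abbrev nestSnd : HFib.Over (CompOp.Hom.oper (o.fam.map (nestFst hk t))) y (snd z) :=
  ⟨(CompPm.Hom.par t.pt).pt, by
    subst hk
    refine (sndOver t).path.trans ?_
    rw [Category.assoc]
    congr 1
    refine (congrArg CompOp.Hom.oper (o.fam.map_comp _ _).symm).trans ?_
    congr 2
    exact HFib.hom_ext (Category.id_comp _)⟩

/-- The comparison followed by a projection filler that is an identity collapses to one action of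
the nested family. Images of parameters under the associator can then be compared coordinate by
coordinate. -/
theorem nestIn_app : nestIn o x y ≫ k.app t = nest o (nestFst hk t) (nestSnd hk t) := by
  subst hk
  refine CompOp.app_comp_eq (P := P) (Q := Q)
    (h := o.fam.map (fstHom (HFib.Over.toHom t) :)) ?_ _ (sndHom (HFib.Over.toHom t)) _ ?_
  · rw [← o.fam.map_comp]
    congr 1
    exact HFib.hom_ext (Category.id_comp _)
  · exact Category.id_comp _

end

end Nest

namespace Eqv

section LeftComp

variable {Q Q' : GPoly J K} (η : Eqv Q Q')

/-- Under the faithful functor `η.pm` the unit and the counits cancel, and both sides have the point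
of `a` followed by an inverse counit. -/
theorem un_app_adj {P : GPoly I J} {o o₁ : CompOp P Q} (k : o₁ ⟶ o) {x : Q.Params o₁.oper}
    {x' y : Q'.Params (η.oper.obj o.oper)} {g : η.operLeftObj P o₁ ⟶ η.operLeftObj P o}
    (hg : g = η.operLeftMap P k) {m : η.operLeftObj P o ⟶ η.operLeftObj P o} (hm : m = 𝟙 _)
    (l : HFib.Over g.oper (η.fib x) x') (l' : HFib.Over m.oper x' y)
    (a : η.fib (x.push k.oper) ⟶ y) (h : l.pt ≫ l'.pt = a.pt) :
    o₁.fam.map (η.un x) ≫ g.app l ≫ m.app l' = k.app (x.toPush k.oper) ≫ o.fam.map (η.adj a) := by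
  subst hg hm
  change o₁.fam.map _ ≫ k.app _ ≫ o.fam.map ((η.unfib _).map (HFib.Over.toHom l')) = _
  rw [k.naturality, k.app_map]
  congr 1
  apply η.over_ext
  rw [HFib.Over.post_pt, HFib.Over.post_pt, HFib.Over.pre_pt]
  simp only [Functor.map_comp, map_un, map_lower, Category.assoc, map_adj, ← h]
  rw [← cancel_mono (η.cu y).pt]
  simp [η.cu_naturality]
  rfl

end LeftComp

section

variable {P : GPoly I J} {Q : GPoly J K} {R R' : GPoly K L} (η : Eqv R R')

noncomputable abbrev leftCompFst {o : CompOp (P.comp Q) R}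
    {z : (Q.comp R).Params (assocOperObjOper o)}
    {w : (Q.comp R').Params (assocOperObjOper (η.operLeftObj (P.comp Q) o))}
    (f : HFib.Over (𝟙 (η.operLeftObj Q (assocOperObjOper o))) ((η.whiskerLeft Q).fib z) w) :
    η.fib (fst z :) ⟶ fst w :=
  ⟨(CompPm.Hom.arg f.pt).pt, by
    have h := (fstOver f).path
    dsimp at h ⊢
    simpa using h⟩

noncomputable abbrev leftCompSnd {o : CompOp (P.comp Q) R}
    {z : (Q.comp R).Params (assocOperObjOper o)}
    {w : (Q.comp R').Params (assocOperObjOper (η.operLeftObj (P.comp Q) o))}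
    (f : HFib.Over (𝟙 (η.operLeftObj Q (assocOperObjOper o))) ((η.whiskerLeft Q).fib z) w) :
    HFib.Over (CompOp.Hom.oper (o.fam.map (η.adj (leftCompFst η f)))) (snd z) (snd w) :=
  ⟨(CompPm.Hom.par f.pt).pt, by
    refine (sndOver f).path.trans ?_
    dsimp only
    rw [Category.assoc, Category.assoc, Category.assoc]
    congr 1
    exact η.un_app_adj z.path (Category.id_comp _) rfl _ _ _ (Category.id_comp _)⟩

/-- Only the first coordinate is indexed through `η`, hence it is transposed; the second keeps its
point and lies over the transposed one. -/
noncomputable abbrev leftCompHet (o : CompOp (P.comp Q) R) : Het (η.whiskerLeft Q)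
    (assocOperObj o) (assocOperObj (η.operLeftObj (P.comp Q) o)) where
  oper := 𝟙 (η.operLeftObj Q (assocOperObjOper o))
  app f := nest o (η.adj (leftCompFst η f)) (leftCompSnd η f)
  naturality g f h := by
    refine CompOp.app_comp_comp_eq (P := P) (Q := Q) (η.fam_adj_conj o _ _ _ _ ?_) _ _ _ _ ?_
    · exact (Category.assoc _ _ _).symm
    · exact (Category.assoc _ _ _).symm
  typ f := (CompOp.Hom.typ (o.fam.map _) (leftCompSnd η f)).trans
    (congrArg (_ ≫ ·) (Category.id_comp _).symm)

theorem par_leftComp {p : CompPm (P.comp Q) R} {k₀ : assocOperObj p.oper ⟶ assocOperObj p.oper}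
    (hk₀ : k₀ = 𝟙 _) {k : assocOperObj (η.operLeftObj (P.comp Q) p.oper) ⟶
      assocOperObj (η.operLeftObj (P.comp Q) p.oper)} (hk : k = 𝟙 _)
    {z : (Q.comp R).Params (assocOperObjOper p.oper)}
    {w : (Q.comp R').Params (assocOperObjOper (η.operLeftObj (P.comp Q) p.oper))}
    (t : HFib.Over k₀.oper (mkParam (assocOperObjOper p.oper) p.arg (fst p.par)) z)
    (t' : HFib.Over k.oper (mkParam (assocOperObjOper (η.operLeftObj (P.comp Q) p.oper))
      (η.fib p.arg) (fst (η.pmLeftObj (P.comp Q) p).par)) w)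
    (f : HFib.Over (𝟙 (η.operLeftObj Q (assocOperObjOper p.oper))) ((η.whiskerLeft Q).fib z) w)
    (h₁ : (CompPm.Hom.arg t'.pt).pt = η.pm.map (CompPm.Hom.arg t.pt).pt ≫ (CompPm.Hom.arg f.pt).pt)
    (h₂ : (CompPm.Hom.par t'.pt).pt = (CompPm.Hom.par t.pt).pt ≫ (CompPm.Hom.par f.pt).pt) :
    ((snd (η.pmLeftObj (P.comp Q) p).par).path ≫ nestIn (η.operLeftObj (P.comp Q) p.oper)
      (η.fib p.arg) (fst (η.pmLeftObj (P.comp Q) p).par)) ≫ k.app t'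
        = (((snd p.par).path ≫ nestIn p.oper p.arg (fst p.par)) ≫ k₀.app t) ≫
          nest p.oper (η.adj (leftCompFst η f)) (leftCompSnd η f) := by
  rw [Category.assoc, nestIn_app hk, Category.assoc ((snd p.par).path), nestIn_app hk₀]
  dsimp only
  rw [Category.assoc, Category.assoc, Category.assoc]
  congr 1
  rw [nest_comp_nest]
  refine CompOp.app_square (P := P) (Q := Q) ?_ _ _ _ _ ?_
  · refine (Category.assoc _ _ _).trans (congrArg (p.par.path ≫ ·) ?_)
    refine (p.oper.fam.map_comp _ _).symm.trans (congrArg p.oper.fam.map ?_)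
    refine Eq.trans ?_ (comp_adj η _ _).symm
    exact congrArg η.adj (HFib.hom_ext h₁)
  · exact (Category.id_comp _).trans (h₂.trans (Category.id_comp _).symm)

/-- This is `comp_whiskerLeft` with the inverse associator moved across and the left whiskering by
`P` placed last, as `leftHom` requires. -/
noncomputable def leftComp (P : GPoly I J) (Q : GPoly J K) (η : Eqv R R') :
    (assoc P Q R).trans ((η.whiskerLeft Q).whiskerLeft P)
      ⟶ (η.whiskerLeft (P.comp Q)).trans (assoc P Q R') :=
  leftHom (A := assoc P Q R) (B := (η.whiskerLeft (P.comp Q)).trans (assoc P Q R'))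
    (fun o => leftCompHet η o)
    (fun {_ _} h => (Category.comp_id _).trans (Category.id_comp _).symm)
    (fun {a a'} h {x x' y y'} f k' k f' w => by
      have w₁ := congrArg (fun m => (CompPm.Hom.arg m).pt) w
      have w₂ := congrArg (fun m => (CompPm.Hom.par m).pt) w
      refine CompOp.app_square (P := P) (Q := Q) ?_ _ _ _ _ w₂
      rw [h.app_map, h.map_app]
      exact congrArg h.app (η.adj_lower (fstOver f :) (leftCompFst η k') (leftCompFst η k)
        (fstOver f' :) w₁))
    (fun e => ⟨⟨𝟙 _, ⟨𝟙 _, (congrArg (· ≫ _) (R'.proj.map_id _)).trans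
        ((Category.id_comp _).trans (Category.comp_id _).symm)⟩, ⟨𝟙 _, by
        refine (congrArg (· ≫ _) (Q.proj.map_id _)).trans ((Category.id_comp _).trans ?_)
        refine Eq.trans ?_ (congrArg (_ ≫ ·) (CompOp.app_eq_id
          (o := η.operLeftObj Q (assocOperObjOper e.oper)) rfl _ rfl).symm)
        refine Eq.trans ?_ (Category.comp_id _).symm
        exact (Category.assoc _ _ _).symm⟩⟩, by
      exact (assocOperMapOper_id_path (η.operLeftObj (P.comp Q) e.oper)).trans
        (map_id_path (η.operLeft Q) (assocOperObjOper e.oper)).symm⟩)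
    (fun e => ⟨𝟙 _, by
      rw [P.proj.map_id, Category.id_comp]
      exact par_leftComp η rfl ((Category.id_comp _).trans ((assocOper P Q R').map_id _)) _ _ _
        ((Category.comp_id _).trans (η.pm.map_id _)).symm (Category.id_comp _).symm⟩)
    (fun {_ _} f => CompPm.hom_ext ((Category.comp_id _).trans (Category.id_comp _).symm)
      ((Category.comp_id _).trans (Category.id_comp _).symm)
      ((Category.comp_id _).trans (Category.id_comp _).symm))
    (fun {_ _} f => (Category.comp_id _).trans (Category.id_comp _).symm)
    (fun e => by simp)
    (fun b => by simp)

end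

end Eqv

end GPoly

/-! ### Naturality of the associator in the second polynomial. -/

namespace GPoly

variable {I J K L M : Type u} [Groupoid.{u} I] [Groupoid.{u} J] [Groupoid.{u} K] [Groupoid.{u} L]
  [Groupoid.{u} M]

namespace Eqv

section AdjOver

variable {Q Q' : GPoly J K} (η : Eqv Q Q') {c d : Q.Op}

/-- The adjunct of a morphism over a morphism of operations. -/
noncomputable abbrev adjOver {γ : c ⟶ d} {x : Q.Params c} {y : Q'.Params (η.oper.obj d)}
    (f : HFib.Over (η.oper.map γ) (η.fib x) y) : HFib.Over γ x ((η.unfib d).obj y) :=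
  (η.lower f).pre (η.un x)

theorem map_adjOver {γ : c ⟶ d} {x : Q.Params c} {y : Q'.Params (η.oper.obj d)}
    (f : HFib.Over (η.oper.map γ) (η.fib x) y) :
    η.pm.map (η.adjOver f).pt = f.pt ≫ inv (η.cu y).pt := by
  simp

end AdjOver

section MidAssoc

variable {P : GPoly I J} {Q Q' : GPoly J K} {R : GPoly K L} (η : Eqv Q Q')

noncomputable abbrev midFst {o : CompOp (P.comp Q) R}
    {z : (Q.comp R).Params (assocOperObjOper o)}
    {w : (Q'.comp R).Params (assocOperObjOper (((η.whiskerLeft P).operRight R).obj o))}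
    (f : HFib.Over (𝟙 ((η.operRight R).obj (assocOperObjOper o))) ((η.whiskerRight R).fib z) w) :
    (fst z :) ⟶ (fst w :) :=
  ⟨(CompPm.Hom.arg f.pt).pt, by
    have h := (fstOver f).path
    dsimp at h ⊢
    simpa using h⟩

theorem operRight_app_app {o o₁ : CompOp Q R} (k : o₁ ⟶ o) {x : R.Params o₁.oper}
    {x' y : R.Params o.oper} {g : (η.operRight R).obj o₁ ⟶ (η.operRight R).obj o}
    (hg : g = (η.operRight R).map k) {m : (η.operRight R).obj o ⟶ (η.operRight R).obj o}
    (hm : m = 𝟙 _) (l : HFib.Over g.oper x x') (l' : HFib.Over m.oper x' y)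
    (a : x.push k.oper ⟶ y) (h : l.pt ≫ l'.pt = a.pt) :
    g.app l ≫ m.app l' = η.oper.map (k.app (x.toPush k.oper)) ≫ η.oper.map (o.fam.map a) := by
  subst hg hm
  change η.oper.map (k.app l) ≫ η.oper.map (o.fam.map (HFib.Over.toHom l')) = _
  rw [← η.oper.map_comp, ← η.oper.map_comp, k.app_map, k.app_map]
  congr 2
  exact HFib.Over.ext (h.trans (Category.id_comp _).symm)

noncomputable abbrev midSnd {o : CompOp (P.comp Q) R}
    {z : (Q.comp R).Params (assocOperObjOper o)}
    {w : (Q'.comp R).Params (assocOperObjOper (((η.whiskerLeft P).operRight R).obj o))}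
    (f : HFib.Over (𝟙 ((η.operRight R).obj (assocOperObjOper o))) ((η.whiskerRight R).fib z) w) :
    HFib.Over (η.oper.map (CompOp.Hom.oper (o.fam.map (midFst η f)))) (η.fib (snd z :)) (snd w :) :=
  ⟨(CompPm.Hom.par f.pt).pt, by
    refine (sndOver f).path.trans ?_
    dsimp only
    rw [Category.assoc, Category.assoc, Category.assoc, η.oper.map_comp, Category.assoc]
    refine congrArg (_ ≫ _ ≫ ·) ?_
    exact η.operRight_app_app z.path (Category.id_comp _) rfl _ _ _ (Category.id_comp _)⟩

/-- Now `η` acts on the second coordinate, whose operation varies with the first one. Transposition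
therefore takes place over a morphism of operations, which is the role of `adjOver`. -/
noncomputable abbrev midHet (o : CompOp (P.comp Q) R) : Het (η.whiskerRight R)
    (assocOperObj o) (assocOperObj (((η.whiskerLeft P).operRight R).obj o)) where
  oper := 𝟙 ((η.operRight R).obj (assocOperObjOper o))
  app f := nest o (midFst η f) (η.adjOver (midSnd η f))
  naturality g f h := by
    refine CompOp.app_comp_comp_eq (P := P) (Q := Q) (h := o.fam.map (midFst η f))
      (l := o.fam.map (fstHom h :)) ?_ _ _ (η.lower (sndHom h)) _ ?_
    · rw [← o.fam.map_comp, ← o.fam.map_comp]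
      congr 1
      exact HFib.hom_ext (Category.assoc _ _ _).symm
    · apply η.pm.map_injective
      simp only [Functor.map_comp, map_adjOver, map_lower]
      simp
      exact (Category.assoc _ _ _).symm
  typ {z w} f := by
    have h := η.src.inv.naturality (η.adjOver (midSnd η f)).pt
    have h' := CompOp.Hom.typ (o.fam.map (midFst η f)) (η.adjOver (midSnd η f))
    refine (Category.assoc _ _ _).symm.trans ((congrArg (· ≫ _) h').trans ?_)
    refine (Category.assoc _ _ _).trans (congrArg (_ ≫ ·) ?_)
    refine (Category.assoc _ _ _).symm.trans ((congrArg (· ≫ _) h).trans ?_)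
    refine (Category.assoc _ _ _).trans (congrArg (_ ≫ ·) ?_)
    refine (Q'.src.map_comp _ _).symm.trans (congrArg Q'.src.map ?_)
    rw [map_adjOver, Category.assoc, IsIso.inv_hom_id, Category.comp_id]

/-- By definition the left-whiskered component at `l` is the component of `k` at the lowered
morphism; precomposing with the unit makes it the transpose of `l`. -/
theorem un_app_eq {o o₁ : CompOp P Q} (k : o₁ ⟶ o) {x : Q.Params o₁.oper}
    {y : Q'.Params (η.oper.obj o.oper)} {g : η.operLeftObj P o₁ ⟶ η.operLeftObj P o}
    (hg : g = η.operLeftMap P k) (l : HFib.Over g.oper (η.fib x) y) :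
    o₁.fam.map (η.un x) ≫ g.app l =
      k.app (η.adjOver (l.cast (congrArg CompOp.Hom.oper hg))) := by
  subst hg
  exact k.map_app _ _

theorem par_midAssoc {p : CompPm (P.comp Q) R} {k₀ : assocOperObj p.oper ⟶ assocOperObj p.oper}
    (hk₀ : k₀ = 𝟙 _) {k : assocOperObj (((η.whiskerLeft P).operRight R).obj p.oper) ⟶
      assocOperObj (((η.whiskerLeft P).operRight R).obj p.oper)} (hk : k = 𝟙 _)
    {z : (Q.comp R).Params (assocOperObjOper p.oper)}
    {w : (Q'.comp R).Params (assocOperObjOper (((η.whiskerLeft P).operRight R).obj p.oper))}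
    (t : HFib.Over k₀.oper (mkParam (assocOperObjOper p.oper) p.arg (fst p.par)) z)
    (t' : HFib.Over k.oper (mkParam (assocOperObjOper (((η.whiskerLeft P).operRight R).obj p.oper))
      p.arg (fst (CompPm.par (((η.whiskerLeft P).pmRight R).obj p)))) w)
    (f : HFib.Over (𝟙 ((η.operRight R).obj (assocOperObjOper p.oper)))
      ((η.whiskerRight R).fib z) w)
    (h₁ : (CompPm.Hom.arg t'.pt).pt = (CompPm.Hom.arg t.pt).pt ≫ (CompPm.Hom.arg f.pt).pt)
    (h₂ : (CompPm.Hom.par t'.pt).pt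
      = η.pm.map (CompPm.Hom.par t.pt).pt ≫ (CompPm.Hom.par f.pt).pt) :
    ((snd (CompPm.par (((η.whiskerLeft P).pmRight R).obj p))).path ≫
      nestIn (((η.whiskerLeft P).operRight R).obj p.oper) p.arg
        (fst (CompPm.par (((η.whiskerLeft P).pmRight R).obj p)))) ≫ k.app t'
        = (((snd p.par).path ≫ nestIn p.oper p.arg (fst p.par)) ≫ k₀.app t) ≫
          nest p.oper (midFst η f) (η.adjOver (midSnd η f)) := by
  rw [Category.assoc, nestIn_app hk, Category.assoc ((snd p.par).path), nestIn_app hk₀]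
  dsimp only
  rw [Category.assoc, Category.assoc, Category.assoc, Category.assoc, nest_comp_nest]
  refine congrArg (_ ≫ ·) ?_
  refine (Category.assoc _ _ _).symm.trans ((congrArg (· ≫ _) (η.un_app_eq p.par.path
    (Category.id_comp _) _)).trans ?_)
  refine CompOp.app_square (P := P) (Q := Q) (h := p.oper.fam.map (nestFst hk t')) ?_ _
    (η.lower (nestSnd hk t')) _ _ ?_
  · refine congrArg (p.par.path ≫ ·) (congrArg p.oper.fam.map (HFib.hom_ext h₁))
  · apply η.pm.map_injective
    simp only [Functor.map_comp, map_adjOver, map_lower]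
    rw [Category.assoc, IsIso.inv_hom_id_assoc, HFib.Over.cast_pt, HFib.toPush_pt, HFib.toPush_pt,
      η.pm.map_id, h₂]
    refine (Category.id_comp _).trans ((Category.assoc _ _ _).trans (Eq.trans ?_
      (Category.id_comp _).symm))
    exact (congrArg (_ ≫ ·) (η.map_adjOver (midSnd η f)).symm).trans (η.pm.map_comp _ _).symm

noncomputable def midAssoc (P : GPoly I J) (η : Eqv Q Q') (R : GPoly K L) :
    (assoc P Q R).trans ((η.whiskerRight R).whiskerLeft P)
      ⟶ ((η.whiskerLeft P).whiskerRight R).trans (assoc P Q' R) :=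
  leftHom (A := assoc P Q R) (B := ((η.whiskerLeft P).whiskerRight R).trans (assoc P Q' R))
    (fun o => midHet η o)
    (fun {_ _} h => (Category.comp_id _).trans (Category.id_comp _).symm)
    (fun {a a'} h {x x' y y'} f k' k f' w => by
      have w₁ := congrArg (fun m => (CompPm.Hom.arg m).pt) w
      have w₂ := congrArg (fun m => (CompPm.Hom.par m).pt) w
      refine CompOp.app_square (P := P) (Q := Q) (h := a'.fam.map (midFst η k'))
        (h' := h.app (fstOver f' :)) ?_ _ _ _ (η.lower (sndOver f')) ?_
      · rw [h.app_map, h.map_app]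
        exact congrArg h.app (HFib.Over.ext w₁)
      · apply η.pm.map_injective
        simp only [Functor.map_comp, map_adjOver, map_lower]
        rw [Category.assoc, IsIso.inv_hom_id_assoc, ← Category.assoc, ← Category.assoc]
        exact congrArg (· ≫ _) w₂)
    (fun e => ⟨⟨𝟙 _, ⟨𝟙 _, by simp⟩, ⟨𝟙 _, by
        dsimp
        rw [Q'.proj.map_id, Category.id_comp]
        refine Eq.trans ?_ (congrArg (_ ≫ ·) (CompOp.app_eq_id
          (o := (η.operRight R).obj (assocOperObjOper e.oper)) rfl _ rfl).symm)
        simp⟩⟩, by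
      dsimp
      exact (assocOperMapOper_id_path (((η.whiskerLeft P).operRight R).obj e.oper)).trans
        (map_id_path (η.operRight R) (assocOperObjOper e.oper)).symm⟩)
    (fun e => ⟨𝟙 _, by
      rw [P.proj.map_id, Category.id_comp]
      exact par_midAssoc η rfl ((Category.id_comp _).trans ((assocOper P Q' R).map_id _)) _ _ _
        (Category.id_comp _).symm ((Category.comp_id _).trans (η.pm.map_id _)).symm⟩)
    (fun {_ _} f => CompPm.hom_ext ((Category.comp_id _).trans (Category.id_comp _).symm)
      ((Category.comp_id _).trans (Category.id_comp _).symm)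
      ((Category.comp_id _).trans (Category.id_comp _).symm))
    (fun {_ _} f => (Category.comp_id _).trans (Category.id_comp _).symm)
    (fun e => by simp)
    (fun b => by simp)

end MidAssoc

end Eqv

end GPoly

/-! ### The triangle law. -/

namespace GPoly

variable {I J K L M : Type u} [Groupoid.{u} I] [Groupoid.{u} J] [Groupoid.{u} K] [Groupoid.{u} L]
  [Groupoid.{u} M]

namespace Eqv

section Triangle

variable {P : GPoly I J} {Q : GPoly J K}

/-- The morphism to the parameter of an operation of the identity polynomial over `f`. -/
abbrev overIdPt {i j : J} (f : i ⟶ j) (x : (GPoly.unit J).Params i) :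
    HFib.Over (p := (GPoly.unit J).proj) f x (idPt j) :=
  ⟨x.path ≫ f, Category.comp_id (x.path ≫ f)⟩

abbrev triFst {o : CompOp (P.comp (GPoly.unit J)) Q}
    {z : ((GPoly.unit J).comp Q).Params (assocOperObjOper o)} {y : Q.Params o.oper}
    (f : HFib.Over (𝟙 o.oper) ((lam Q).fib z) y) : (fst z :) ⟶ y :=
  ⟨f.pt, f.path.trans (Category.comp_id _)⟩

/-- The second coordinate is a parameter of the identity polynomial, where the morphism to the
canonical parameter is forced. All conditions on second coordinates hold by `id_over_pt`. -/
noncomputable abbrev triHet (o : CompOp (P.comp (GPoly.unit J)) Q) : Het (lam Q)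
    (assocOperObj o) (((rho P).operRight Q).obj o) where
  oper := 𝟙 o.oper
  app {z y} f := nest o (triFst f) (overIdPt (CompOp.Hom.oper (o.fam.map (triFst f))) (snd z))
  naturality {z' z y y'} g f h := by
    have e : o.fam.map (fstHom g :) ≫ o.fam.map (triFst f) ≫ o.fam.map h =
        o.fam.map (triFst ((f.pre (((lam Q).fibFunctor _).map g)).post h)) := by
      rw [← o.fam.map_comp, ← o.fam.map_comp]
      congr 1
      exact HFib.hom_ext (Category.assoc _ _ _).symm
    refine CompOp.app_comp_comp_eq (P := P) (Q := GPoly.unit J) e (sndHom g) _ _ _ ?_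
    exact congrArg HFib.Over.pt (id_over_pt (((sndHom g).comp ((overIdPt _ _).comp
      ⟨(o.fam.map h).oper, _⟩)).cast (congrArg CompOp.Hom.oper e)) (overIdPt _ _))
  typ {z y} f := by
    have h₁ := CompOp.Hom.typ (o.fam.map (triFst f)) (overIdPt _ (snd z))
    have h₂ := (assocOperObjOper o).typ_naturality (triFst f)
    -- The left unitor has as inverse source filler the path of the second coordinate followed by
    -- `typ`; this relation carries `typ` along the path of `z`, where `h₂` applies.
    have h₃ := CompOp.Hom.typ z.path (HFib.toPush (CompOp.Hom.oper z.path) z.pt.arg)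
    refine (Category.assoc _ _ _).symm.trans ((congrArg (· ≫ o.typ y) h₁).trans
      ((Category.assoc _ _ _).trans (congrArg (_ ≫ ·) ?_)))
    change (o.fam.map (triFst f)).oper ≫ o.typ y = o.typ (fst z :) ≫ Q.src.map f.pt at h₂
    change CompOp.Hom.app z.path _ ≫ o.typ (fst z :)
      = z.pt.oper.typ z.pt.arg ≫ Q.src.map (𝟙 _) at h₃
    change ((z.pt.par.path ≫ CompOp.Hom.app z.path (HFib.toPush (CompOp.Hom.oper z.path) z.pt.arg))
      ≫ (o.fam.map (triFst f)).oper) ≫ o.typ y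
        = (z.pt.par.path ≫ z.pt.oper.typ z.pt.arg) ≫ Q.src.map f.pt
    rw [Category.assoc, h₂, Category.assoc, reassoc_of% h₃, Q.src.map_id, Category.id_comp,
      Category.assoc]

theorem par_triangle {p : CompPm (P.comp (GPoly.unit J)) Q}
    {k₀ : assocOperObj p.oper ⟶ assocOperObj p.oper} (hk₀ : k₀ = 𝟙 _)
    {k : ((rho P).operRight Q).obj p.oper ⟶ ((rho P).operRight Q).obj p.oper} (hk : k = 𝟙 _)
    {z : ((GPoly.unit J).comp Q).Params (assocOperObjOper p.oper)} {y : Q.Params p.oper.oper}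
    (t : HFib.Over k₀.oper (mkParam (assocOperObjOper p.oper) p.arg (fst p.par)) z)
    (t' : HFib.Over k.oper p.arg y) (f : HFib.Over (𝟙 p.oper.oper) ((lam Q).fib z) y)
    (h : t'.pt = (CompPm.Hom.arg t.pt).pt ≫ f.pt) :
    (rhoProj P p.par.pt ≫ (rhoOper P).map p.par.path) ≫ k.app t'
      = (((snd p.par).path ≫ nestIn p.oper p.arg (fst p.par)) ≫ k₀.app t) ≫
        nest p.oper (triFst f) (overIdPt (CompOp.Hom.oper (p.oper.fam.map (triFst f))) (snd z)) := by
  rw [Category.assoc, Category.assoc ((snd p.par).path), nestIn_app hk₀]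
  dsimp only
  rw [Category.assoc, Category.assoc, Category.assoc, nest_comp_nest]
  refine congrArg (_ ≫ ·) ?_
  subst hk
  refine (Category.assoc _ _ _).symm.trans ((congrArg (· ≫ _) (CompOp.Hom.map_app p.par.path _ _)
    ).trans ?_)
  have e : p.par.path ≫ p.oper.fam.map (HFib.Over.toHom t') = p.par.path ≫
      p.oper.fam.map (nestFst hk₀ t ≫ triFst f) :=
    congrArg (p.par.path ≫ ·) (congrArg p.oper.fam.map (HFib.hom_ext h))
  let m := CompOp.Hom.oper (p.oper.fam.map (HFib.Over.toHom t'))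
  refine CompOp.app_square (P := P) (Q := GPoly.unit J) e _ (x₁ := idPt _) (y := idPt _)
    ⟨m, (Category.comp_id m).trans (Category.id_comp m).symm⟩ _ _ ?_
  · exact congrArg HFib.Over.pt (id_over_pt ((HFib.Over.comp _ _).cast
      (congrArg CompOp.Hom.oper e)) (HFib.Over.comp _ _))

noncomputable def triangleHom (P : GPoly I J) (Q : GPoly J K) :
    (assoc P (GPoly.unit J) Q).trans ((lam Q).whiskerLeft P) ⟶ (rho P).whiskerRight Q :=
  leftHom (A := assoc P (GPoly.unit J) Q) (B := (rho P).whiskerRight Q)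
    (fun o => triHet o)
    (fun {_ _} h => (Category.comp_id _).trans (Category.id_comp _).symm)
    (fun {a a'} h {x x' y y'} f k' k f' w => by
      have e : h.app (fstOver f :) ≫ a'.fam.map (triFst k') = a.fam.map (triFst k) ≫ h.app f' := by
        rw [h.app_map, h.map_app]
        exact congrArg h.app (HFib.Over.ext w)
      refine CompOp.app_square (P := P) (Q := GPoly.unit J) e (sndOver f) _ _ _ ?_
      exact congrArg HFib.Over.pt (id_over_pt (((sndOver f).comp (overIdPt _ _)).cast
        (congrArg CompOp.Hom.oper e)) ((overIdPt _ _).comp ⟨(h.app f').oper, _⟩)))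
    (fun e => ⟨𝟙 _, by
      change Q.proj.map (𝟙 e.arg.pt) ≫ e.arg.path ≫ 𝟙 e.oper.oper
        = (e.arg.path ≫ 𝟙 e.oper.oper ≫ 𝟙 e.oper.oper) ≫ 𝟙 e.oper.oper
      simp⟩)
    (fun e => ⟨𝟙 _, by
      rw [P.proj.map_id, Category.id_comp]
      exact par_triangle rfl rfl _ _ _ (Category.id_comp _).symm⟩)
    (fun {_ _} f => (Category.comp_id _).trans (Category.id_comp _).symm)
    (fun {_ _} f => (Category.comp_id _).trans (Category.id_comp _).symm)
    (fun e => by simp)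
    (fun b => by simp)

end Triangle

end Eqv

end GPoly

/-! ### Naturality of the associator in the first polynomial. -/

namespace GPoly

variable {I J K L M : Type u} [Groupoid.{u} I] [Groupoid.{u} J] [Groupoid.{u} K] [Groupoid.{u} L]
  [Groupoid.{u} M]

namespace Eqv

section RightComp

variable {P P' : GPoly I J} {Q : GPoly J K} {R : GPoly K L} (η : Eqv P P')

/-- The underlying operation of `Q.comp R` is untouched by `η`, except that `typ` is composed with
the identity target filler of the whiskering. -/
noncomputable abbrev rightCompOper (o : CompOp (P.comp Q) R) : assocOperObjOper o ⟶
    assocOperObjOper (((η.whiskerRight Q).operRight R).obj o) :=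
  CompOp.homOfTyp (assocOperObjOper o) _
    (assocOperObjOper (((η.whiskerRight Q).operRight R).obj o)).typ_naturality
    fun x => (Category.id_comp (o.typ x)).symm

noncomputable abbrev rightCompHom (o : CompOp (P.comp Q) R) :
    (η.operRight (Q.comp R)).obj (assocOperObj o) ⟶
      assocOperObj (((η.whiskerRight Q).operRight R).obj o) where
  oper := rightCompOper η o
  app f := η.oper.map (nest o (fstOver f :).toHom (sndOver f))
  naturality g f h := by
    refine (congrArg (_ ≫ ·) (η.oper.map_comp _ _).symm).trans ((η.oper.map_comp _ _).symm.trans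
      (congrArg η.oper.map ?_))
    refine CompOp.app_comp_comp_eq (P := P) (Q := Q) (g := o.fam.map (fstHom g :))
      (l := o.fam.map (fstHom h :)) ?_ (sndHom g) _ (sndHom h) _ ?_
    · rw [← o.fam.map_comp, ← o.fam.map_comp]
      congr 1
      exact HFib.hom_ext (Category.assoc _ _ _).symm
    · exact (Category.assoc _ _ _).symm
  typ {z w} f := by
    have h := CompOp.Hom.typ (o.fam.map (HFib.Over.toHom (fstOver f :))) (sndOver f)
    refine (Category.assoc _ _ _).symm.trans ((congrArg (· ≫ _) (η.tgt_naturality _)).trans ?_)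
    exact (Category.assoc _ _ _).trans ((congrArg (_ ≫ ·) h).trans (Category.assoc _ _ _).symm)

theorem assoc_map_four {C D : Type u} [Category.{u} C] [Category.{u} D] (F : C ⥤ D) {a b : D}
    {x y z : C} (i : a ⟶ F.obj x) (j : x ⟶ y) (k : y ⟶ z) {c : D} (l : F.obj z ⟶ b) (m : b ⟶ c) :
    ((i ≫ F.map (j ≫ k)) ≫ l) ≫ m = i ≫ F.map j ≫ F.map k ≫ l ≫ m := by
  simp

theorem rightCompHom_naturality {o o' : CompOp (P.comp Q) R} (h : o ⟶ o') :
    (η.operRight (Q.comp R)).map (assocOperMap h) ≫ rightCompHom η o' =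
      rightCompHom η o ≫ assocOperMap (((η.whiskerRight Q).operRight R).map h) := by
  have e {x : R.Params o.oper} {x' x₁ : R.Params o'.oper} {x₂ : R.Params o.oper}
      (f : HFib.Over h.oper x x') (g : x' ⟶ x₁) (f' : x ⟶ x₂) (g' : HFib.Over h.oper x₂ x₁)
      (w : f.pt ≫ g.pt = f'.pt ≫ g'.pt) :
      h.app f ≫ o'.fam.map g = o.fam.map f' ≫ h.app g' := by
    rw [h.app_map, h.map_app]
    exact congrArg h.app (HFib.Over.ext w)
  have e' : assocOperMapOper h ≫ rightCompOper η o' =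
      rightCompOper η o ≫ assocOperMapOper (((η.whiskerRight Q).operRight R).map h) := by
    refine CompOp.hom_ext ((Category.comp_id _).trans (Category.id_comp _).symm) fun f => ?_
    exact congrArg CompOp.Hom.oper (e _ _ _ _ rfl)
  refine CompOp.hom_ext e' fun f => ?_
  refine (η.oper.map_comp _ _).symm.trans (Eq.trans (congrArg η.oper.map ?_)
    (η.oper.map_comp _ _))
  exact CompOp.app_square (P := P) (Q := Q) (e _ _ _ _ rfl) _ _ _ _ rfl

theorem par_rightComp {p : CompPm (P.comp Q) R}
    {k₁ : assocOperObj p.oper ⟶ assocOperObj p.oper} (hk₁ : k₁ = 𝟙 _)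
    {k₀ : (η.operRight (Q.comp R)).obj (assocOperObj p.oper) ⟶
      (η.operRight (Q.comp R)).obj (assocOperObj p.oper)}
    (hk₀ : k₀ = (η.operRight (Q.comp R)).map k₁)
    {k : assocOperObj (((η.whiskerRight Q).operRight R).obj p.oper) ⟶
      assocOperObj (((η.whiskerRight Q).operRight R).obj p.oper)} (hk : k = 𝟙 _)
    {z : (Q.comp R).Params (assocOperObjOper p.oper)}
    {w : (Q.comp R).Params (assocOperObjOper (((η.whiskerRight Q).operRight R).obj p.oper))}
    (t : HFib.Over k₀.oper (mkParam (assocOperObjOper p.oper) p.arg (fst p.par)) z)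
    (t' : HFib.Over k.oper (mkParam (assocOperObjOper (((η.whiskerRight Q).operRight R).obj p.oper))
      p.arg (fst (CompPm.par (((η.whiskerRight Q).pmRight R).obj p)))) w)
    (f : HFib.Over (rightCompOper η p.oper) z w)
    (h₁ : (CompPm.Hom.arg t'.pt).pt = (CompPm.Hom.arg t.pt).pt ≫ (CompPm.Hom.arg f.pt).pt)
    (h₂ : (CompPm.Hom.par t'.pt).pt = (CompPm.Hom.par t.pt).pt ≫ (CompPm.Hom.par f.pt).pt) :
    ((snd (CompPm.par (((η.whiskerRight Q).pmRight R).obj p))).path ≫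
      nestIn (((η.whiskerRight Q).operRight R).obj p.oper) p.arg
        (fst (CompPm.par (((η.whiskerRight Q).pmRight R).obj p)))) ≫ k.app t'
        = ((η.proj.hom.app p.par.pt.par.pt ≫ η.oper.map ((snd p.par).path ≫
          nestIn p.oper p.arg (fst p.par))) ≫ k₀.app t) ≫
          η.oper.map (nest p.oper (fstOver f :).toHom (sndOver f)) := by
  subst hk₀
  rw [Category.assoc, nestIn_app hk]
  have e : η.oper.map (nestIn p.oper p.arg (fst p.par)) ≫
      ((η.operRight (Q.comp R)).map k₁).app t ≫
        η.oper.map (nest p.oper (fstOver f :).toHom (sndOver f)) =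
      η.oper.map (nest p.oper (nestFst hk₁ t) (nestSnd hk₁ t) ≫
        nest p.oper (fstOver f :).toHom (sndOver f)) := by
    rw [← nestIn_app hk₁, η.oper.map_comp, η.oper.map_comp, Category.assoc]
  refine Eq.trans ?_ (assoc_map_four η.oper _ _ _ _ _).symm
  refine Eq.trans ?_ (congrArg (_ ≫ _ ≫ ·) e.symm)
  rw [nest_comp_nest]
  refine (Category.assoc _ _ _).trans ((Category.assoc _ _ _).trans (congrArg (_ ≫ ·) ?_))
  refine Eq.trans ?_ (congrArg (· ≫ _) (η.oper.map_comp _ _).symm)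
  refine Eq.trans (congrArg (_ ≫ ·) ?_) (Category.assoc _ _ _).symm
  have e₁ : (CompPm.par (((η.whiskerRight Q).pmRight R).obj p)).path ≫
      (η.operRight Q).map (p.oper.fam.map (nestFst hk t')) =
        (η.operRight Q).map p.par.path ≫ (η.operRight Q).map
          (p.oper.fam.map (nestFst hk₁ t ≫ (fstOver f :).toHom)) := by
    refine (congrArg (· ≫ _) (Category.id_comp _)).trans (congrArg (_ ≫ ·) ?_)
    exact congrArg (η.operRight Q).map (congrArg p.oper.fam.map (HFib.hom_ext h₁))
  exact CompOp.app_square e₁ _ _ _ _ (congrArg (_ ≫ ·) h₂)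

/-- No left whiskering occurs, so `compHom` applies directly: the points of all coordinates are
identities, and the components on operations are `η` applied to the nested families. -/
noncomputable def rightComp (η : Eqv P P') (Q : GPoly J K) (R : GPoly K L) :
    (assoc P Q R).trans (η.whiskerRight (Q.comp R))
      ⟶ ((η.whiskerRight Q).whiskerRight R).trans (assoc P' Q R) :=
  compHom (φ := (assoc P Q R).trans (η.whiskerRight (Q.comp R)))
    (ψ := ((η.whiskerRight Q).whiskerRight R).trans (assoc P' Q R))
    { app := fun o => rightCompHom η o
      naturality := fun _ _ h => rightCompHom_naturality η h }
    (fun e => ⟨⟨rightCompOper η e.oper,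
      ⟨𝟙 _, (congrArg (· ≫ _) (R.proj.map_id _)).trans
        ((Category.id_comp _).trans (Category.comp_id _).symm)⟩, ⟨𝟙 _, by
        refine (congrArg (· ≫ _) (Q.proj.map_id _)).trans ((Category.id_comp _).trans ?_)
        refine Eq.trans ?_ (congrArg (_ ≫ ·) ((assocOperObjOper e.oper).fam.map_id _)).symm
        refine Eq.trans ?_ (Category.comp_id _).symm
        exact congrArg (_ ≫ ·) (Category.id_comp (CompOp.Hom.oper e.par.path))⟩⟩, by
      refine (congrArg (rightCompOper η e.oper ≫ ·) ?_).trans ((Category.comp_id _).trans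
        (Eq.trans (Category.id_comp _).symm (congrArg (· ≫ rightCompOper η e.oper) ?_)))
      · exact (Category.id_comp _).trans ((Category.id_comp _).trans
          (congrArg CompOp.Hom.oper ((assocOper P' Q R).map_id _)))
      · exact ((Category.id_comp _).trans (Category.id_comp _)).symm⟩)
    (fun e => ⟨𝟙 _, by
      rw [P'.proj.map_id, Category.id_comp]
      exact par_rightComp η rfl (Category.id_comp _) ((Category.id_comp _).trans
        ((assocOper P' Q R).map_id _)) _ _ _ (Category.id_comp _).symm (Category.id_comp _).symm⟩)
    (fun {_ _} f => CompPm.hom_ext (congrArg CompOp.Hom.oper (rightCompHom_naturality η f.oper))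
      ((Category.comp_id _).trans (Category.id_comp _).symm)
      ((Category.comp_id _).trans (Category.id_comp _).symm))
    (fun {_ _} f => (Category.comp_id _).trans (Category.id_comp _).symm)
    (fun e => by simp)
    (fun b => by simp)

end RightComp

end Eqv

end GPoly

/-! ### The pentagon law. -/

namespace GPoly

variable {I J K L M : Type u} [Groupoid.{u} I] [Groupoid.{u} J] [Groupoid.{u} K] [Groupoid.{u} L]
  [Groupoid.{u} M]

theorem assoc_congr {C : Type u} [Category.{u} C] {a b c d d' e : C} {f : a ⟶ b} {g : b ⟶ c}
    {h : c ⟶ d} {k : d ⟶ e} {h' : c ⟶ d'} {k' : d' ⟶ e} (w : h ≫ k = h' ≫ k') :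
    ((f ≫ g) ≫ h) ≫ k = (f ≫ g ≫ h') ≫ k' := by
  rw [Category.assoc, Category.assoc, Category.assoc, Category.assoc, w]

theorem CompOp.Hom.app_comp_map {P : GPoly I J} {Q : GPoly J K} {o o' : CompOp P Q} (h : o ⟶ o')
    {x : Q.Params o.oper} {x' x₁ : Q.Params o'.oper} {x₂ : Q.Params o.oper}
    (f : HFib.Over h.oper x x') (g : x' ⟶ x₁) (f' : x ⟶ x₂) (g' : HFib.Over h.oper x₂ x₁)
    (w : f.pt ≫ g.pt = f'.pt ≫ g'.pt) :
    h.app f ≫ o'.fam.map g = o.fam.map f' ≫ h.app g' := by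
  rw [h.app_map, h.map_app]
  exact congrArg h.app (HFib.Over.ext w)

theorem assoc_congr₄ {C : Type u} [Category.{u} C] {a b c c' d e f g : C} {p : a ⟶ b} {h : b ⟶ c}
    {k : c ⟶ g} {h₁ : b ⟶ c'} {h₂ : c' ⟶ d} {h₃ : d ⟶ e} {h₄ : e ⟶ f} {h₅ : f ⟶ g}
    (w : h ≫ k = h₁ ≫ (h₂ ≫ h₃) ≫ h₄ ≫ h₅) :
    (p ≫ h) ≫ k = ((((p ≫ h₁) ≫ h₂) ≫ h₃) ≫ h₄) ≫ h₅ := by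
  simp only [Category.assoc] at w ⊢
  rw [w]

theorem assoc_congr₃ {C : Type u} [Category.{u} C] {a b c d c' d' e : C} {p : a ⟶ b} {h : b ⟶ c}
    {k : c ⟶ d} {l : d ⟶ e} {h' : b ⟶ c'} {k' : c' ⟶ d'} {l' : d' ⟶ e}
    (w : h ≫ k ≫ l = h' ≫ k' ≫ l') : ((p ≫ h) ≫ k) ≫ l = p ≫ h' ≫ k' ≫ l' := by
  simp only [Category.assoc, w]

namespace CompOp

variable {P : GPoly I J} {Q : GPoly J K}

theorem app_comp₃_eq {o o₁ o₂ o₁' o₂' o' : CompOp P Q} {g : o ⟶ o₁} {h : o₁ ⟶ o₂} {l : o₂ ⟶ o'}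
    {g' : o ⟶ o₁'} {h' : o₁' ⟶ o₂'} {l' : o₂' ⟶ o'} (e : g ≫ h ≫ l = g' ≫ h' ≫ l')
    {x : Q.Params o.oper} {x₁ : Q.Params o₁.oper} {x₂ : Q.Params o₂.oper} {x₁' : Q.Params o₁'.oper}
    {x₂' : Q.Params o₂'.oper} {y : Q.Params o'.oper} (f : HFib.Over g.oper x x₁)
    (f₁ : HFib.Over h.oper x₁ x₂) (f₂ : HFib.Over l.oper x₂ y) (f' : HFib.Over g'.oper x x₁')
    (f₁' : HFib.Over h'.oper x₁' x₂') (f₂' : HFib.Over l'.oper x₂' y)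
    (e' : f.pt ≫ f₁.pt ≫ f₂.pt = f'.pt ≫ f₁'.pt ≫ f₂'.pt) :
    g.app f ≫ h.app f₁ ≫ l.app f₂ = g'.app f' ≫ h'.app f₁' ≫ l'.app f₂' :=
  (congrArg (g.app f ≫ ·) (app_comp_app h l f₁ f₂)).trans
    ((app_square e f (f₁.comp f₂) f' (f₁'.comp f₂') e').trans
      (congrArg (g'.app f' ≫ ·) (app_comp_app h' l' f₁' f₂').symm))

theorem app_comp₂₄_eq {o o₁ o₁' o₂' o₃' o' : CompOp P Q} {g : o ⟶ o₁} {h : o₁ ⟶ o'}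
    {g' : o ⟶ o₁'} {h' : o₁' ⟶ o₂'} {l' : o₂' ⟶ o₃'} {m' : o₃' ⟶ o'}
    (e : g ≫ h = g' ≫ h' ≫ l' ≫ m') {x : Q.Params o.oper} {x₁ : Q.Params o₁.oper}
    {x₁' : Q.Params o₁'.oper} {x₂' : Q.Params o₂'.oper} {x₃' : Q.Params o₃'.oper}
    {y : Q.Params o'.oper} (f : HFib.Over g.oper x x₁) (f₁ : HFib.Over h.oper x₁ y)
    (f' : HFib.Over g'.oper x x₁') (f₁' : HFib.Over h'.oper x₁' x₂')
    (f₂' : HFib.Over l'.oper x₂' x₃') (f₃' : HFib.Over m'.oper x₃' y)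
    (e' : f.pt ≫ f₁.pt = f'.pt ≫ f₁'.pt ≫ f₂'.pt ≫ f₃'.pt) :
    g.app f ≫ h.app f₁ = g'.app f' ≫ h'.app f₁' ≫ l'.app f₂' ≫ m'.app f₃' :=
  (app_square e f f₁ f' (f₁'.comp (f₂'.comp f₃')) e').trans
    (congrArg (g'.app f' ≫ ·) ((congrArg (h'.app f₁' ≫ ·) (app_comp_app l' m' f₂' f₃')).trans
      (app_comp_app h' (l' ≫ m') f₁' (f₂'.comp f₃'))).symm)

end CompOp

section NestOver

variable {P : GPoly I J} {Q : GPoly J K} {R : GPoly K L} {o o' : CompOp (P.comp Q) R} {h : o ⟶ o'}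
  {k : assocOperObj o ⟶ assocOperObj o'} (hk : k = assocOperMap h) {x : R.Params o.oper}
  {y : Q.Params (CompOp.oper (o.fam.obj x))} {w : (Q.comp R).Params (assocOperObjOper o')}
  (t : HFib.Over k.oper (mkParam (assocOperObjOper o) x y) w)

include hk in
noncomputable abbrev nestFstOver : HFib.Over h.oper x (fst w :) :=
  ⟨(CompPm.Hom.arg t.pt).pt, by
    subst hk
    simpa using (fstOver t).path⟩

noncomputable abbrev nestSndOver :
    HFib.Over (CompOp.Hom.oper (h.app (nestFstOver hk t))) y (snd w :) :=
  ⟨(CompPm.Hom.par t.pt).pt, by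
    subst hk
    refine (sndOver t).path.trans ?_
    rw [Category.assoc]
    refine congrArg (_ ≫ ·) (congrArg CompOp.Hom.oper ((h.map_app _ _).trans ?_))
    exact congrArg h.app (HFib.Over.ext (Category.id_comp _))⟩

/-- The form of `nestIn_app` for the image of an arbitrary morphism: in the pentagon the associator
is also applied to paths of parameters. -/
theorem nestIn_app_map :
    nestIn o x y ≫ k.app t = CompOp.Hom.app (h.app (nestFstOver hk t)) (nestSndOver hk t) := by
  subst hk
  refine CompOp.app_comp_eq (P := P) (Q := Q) ?_ _ (sndOver t) _ (Category.id_comp _)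
  exact (h.map_app _ _).trans (congrArg h.app (HFib.Over.ext (Category.id_comp _)))

end NestOver

namespace Eqv

section Pentagon

variable {P : GPoly I J} {Q : GPoly J K} {R : GPoly K L} {S : GPoly L M}

noncomputable abbrev pentInnerHom (o : CompOp ((P.comp Q).comp R) S) :
    assocOperObjOper (assocOperObjOper (((assoc P Q R).operRight S).obj o)) ⟶ assocOperObjOper o :=
  CompOp.homOfTyp (assocOperObjOper (assocOperObjOper (((assoc P Q R).operRight S).obj o))) o.typ
    o.typ_naturality fun x => Category.id_comp (o.typ x)

noncomputable abbrev pentOperHom (o : CompOp ((P.comp Q).comp R) S) :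
    assocOperObj (assocOperObjOper (((assoc P Q R).operRight S).obj o)) ⟶
      assocOperObjOper (assocOperObj o) where
  oper := pentInnerHom o
  app f := CompOp.Hom.oper (nest o (fstOver f :).toHom (sndOver f))
  naturality g f h := by
    refine congrArg CompOp.Hom.oper (CompOp.app_comp_comp_eq (P := P.comp Q) (Q := R)
      (g := o.fam.map (fstHom g :)) (l := o.fam.map (fstHom h :)) ?_ (sndHom g) _ (sndHom h) _ ?_)
    · rw [← o.fam.map_comp, ← o.fam.map_comp]
      congr 1
      exact HFib.hom_ext (Category.assoc _ _ _).symm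
    · exact (Category.assoc _ _ _).symm
  typ f := CompOp.Hom.typ (o.fam.map (HFib.Over.toHom (fstOver f :))) (sndOver f)

section

variable {o : CompOp ((P.comp Q).comp R) S}
    {z : ((Q.comp R).comp S).Params (assocOperObjOper (((assoc P Q R).operRight S).obj o))}
    {v : (Q.comp (R.comp S)).Params (assocOperObjOper (assocOperObj o))}
    (f : HFib.Over (pentOperHom o) ((assoc Q R S).fib z) v)

/-- A parameter of the threefold composite has three coordinates. `pentFst`, `pentMid` and `pentSnd`
are the actions of `f` on them, each lying over the preceding one. -/
noncomputable abbrev pentFst : (fst z :) ⟶ (fst (fst v :) :) :=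
  ⟨(CompPm.Hom.arg (CompPm.Hom.arg f.pt).pt).pt, by
    refine (fstOver (fstOver f :)).path.trans ?_
    change (z.pt.arg.path ≫ 𝟙 _ ≫ 𝟙 _ ≫ (CompOp.Hom.oper z.path)) ≫ 𝟙 _ = _
    simp⟩

noncomputable abbrev pentMid : HFib.Over (CompOp.Hom.oper (o.fam.map (pentFst f)))
    (fst (snd z :) :) (snd (fst v :)) :=
  ⟨(CompPm.Hom.par (CompPm.Hom.arg f.pt).pt).pt, by
    refine (sndOver (fstOver f :)).path.trans ?_
    refine assoc_congr ?_
    have e : 𝟙 _ ≫ CompOp.Hom.oper ((assoc Q R S).fib z).path =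
      assocOperMapOper z.path := (Category.id_comp _).trans (Category.id_comp _)
    exact CompOp.app_square (congrArg (· ≫ pentInnerHom o) e) _ _ (HFib.toPush _ _)
      ⟨(pentFst f).pt, (pentFst f).path.trans (Category.comp_id _).symm⟩ rfl⟩

noncomputable abbrev pentSnd : HFib.Over (CompOp.Hom.oper (nest o (pentFst f) (pentMid f)))
    (snd (snd z :) :) (snd v :) :=
  ⟨(CompPm.Hom.par f.pt).pt, by
    refine (sndOver f).path.trans ?_
    have e : ((assoc Q R S).fib z).path = assocOperMap z.path := Category.id_comp _
    refine (Category.assoc _ _ _).trans ((Category.assoc _ _ _).trans ((Category.assoc _ _ _).trans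
      (Eq.trans (congrArg (_ ≫ ·) ?_) (Category.assoc _ _ _).symm)))
    refine (congrArg (_ ≫ ·) ((Category.assoc _ _ _).symm.trans
      (congrArg (· ≫ _) (nestIn_app_map e _)))).trans ?_
    refine Eq.trans (CompOp.app_comp_comp_eq (P := Q) (Q := R)
      (l := assocOperMapOper (o.fam.map (HFib.Over.toHom (fstOver (fstOver f :)))))
      (k := (snd z).path ≫ assocOperMapOper (o.fam.map (pentFst f)))
      ?_ _ _ (sndOver (fstOver f :)) _ ?_)
        (CompOp.app_comp_app (P := Q) (Q := R) _ (assocOperMapOper (o.fam.map (pentFst f))) _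
          (pentMid f)).symm
    · refine (congrArg (_ ≫ ·) ?_).trans (Category.assoc _ _ _).symm
      refine (z.path.app_map _ _).trans (Eq.trans ?_ (z.path.app_map _ _).symm)
      exact congrArg z.path.app (HFib.Over.ext rfl)
    · exact congrArg (_ ≫ ·) (Category.id_comp _)⟩

end

/-- Both bracketings take the same threefold nested value of the family, and the component is the
action of that family on the three coordinates. -/
noncomputable abbrev pentHet (o : CompOp ((P.comp Q).comp R) S) : Het (assoc Q R S)
    (assocOperObj (((assoc P Q R).operRight S).obj o)) (assocOperObj (assocOperObj o)) where
  oper := pentOperHom o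
  app {z v} f := CompOp.Hom.app (nest o (pentFst f) (pentMid f)) (pentSnd f)
  naturality g f h := by
    refine CompOp.app_comp_comp_eq (P := P) (Q := Q) (g := nest o (fstHom g :)
        (fstOver (h := assocOperMapOper (o.fam.map (fstHom g :))) (sndHom g)))
      (l := nest o (fstHom (fstHom h :) :) (sndHom (fstHom h :))) ?_
      (sndOver (h := assocOperMapOper (o.fam.map (fstHom g :))) (sndHom g)) _
      (sndHom h) _ (Category.assoc _ _ _).symm
    refine CompOp.app_comp_comp_eq (P := P.comp Q) (Q := R) ?_ _ _ _ _ (Category.assoc _ _ _).symm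
    rw [← o.fam.map_comp, ← o.fam.map_comp]
    congr 1
    exact HFib.hom_ext (Category.assoc _ _ _).symm
  typ {z v} f := (CompOp.Hom.typ (nest o (pentFst f) (pentMid f)) (pentSnd f)).trans
    (congrArg (_ ≫ ·) (Category.id_comp _).symm)

theorem nested_oper_eq {a b b₁ c : CompOp (P.comp Q) R} {f : a ⟶ b} {g : b ⟶ c}
    {k : assocOperObjOper a ⟶ assocOperObjOper b} (hk : k = assocOperMapOper f) {g₁ : b ⟶ b₁}
    {g₂ : b₁ ⟶ c} (hg : g₁ ≫ g₂ = g) {x : R.Params a.oper} {y z : R.Params b.oper}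
    {z₁ : R.Params b₁.oper} {w : R.Params c.oper} (s : HFib.Over f.oper x y)
    (t : HFib.Over g.oper y w) (s' : HFib.Over k.oper x z) (t₁ : HFib.Over g₁.oper z z₁)
    (t₂ : HFib.Over g₂.oper z₁ w) (e : s.pt ≫ t.pt = s'.pt ≫ t₁.pt ≫ t₂.pt) :
    CompOp.Hom.oper (f.app s) ≫ CompOp.Hom.oper (g.app t) =
      k.app s' ≫ CompOp.Hom.oper (g₁.app t₁) ≫ CompOp.Hom.oper (g₂.app t₂) := by
  subst hk hg
  exact congrArg CompOp.Hom.oper ((CompOp.app_comp_app (P := P.comp Q) (Q := R) _ _ _ _).trans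
    (CompOp.app_comp_comp_eq (P := P.comp Q) (Q := R) rfl s' t₁ t₂ _ e.symm).symm)

theorem pentOperHom_naturality {o o' : CompOp ((P.comp Q).comp R) S} (h : o ⟶ o') :
    assocOperMap (assocOperMapOper (((assoc P Q R).operRight S).map h)) ≫ pentOperHom o' =
      pentOperHom o ≫ assocOperMapOper (assocOperMap h) := by
  have e' : assocOperMapOper (assocOperMapOper (((assoc P Q R).operRight S).map h)) ≫
      pentInnerHom o' = pentInnerHom o ≫ assocOperMapOper h := by
    refine CompOp.hom_ext ((Category.comp_id _).trans (Category.id_comp _).symm) fun f => ?_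
    exact congrArg CompOp.Hom.oper (CompOp.Hom.app_comp_map h _ _ _ _ rfl)
  refine CompOp.hom_ext e' fun f => ?_
  exact congrArg CompOp.Hom.oper (CompOp.app_square (P := P.comp Q) (Q := R)
    (CompOp.Hom.app_comp_map h _ _ _ _ (by rfl)) _ _ _ _ rfl)

/-- Both sides are reduced to iterated components of `p.par.path` and of the family of `p.oper`.
These agree once the points of the three coordinates agree, and the three hypotheses are peeled off
from the outer coordinate inwards. -/
theorem par_pentagon {p : CompPm ((P.comp Q).comp R) S}
    {k₀ : assocOperObj (((assoc P Q R).operRight S).obj p.oper) ⟶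
      assocOperObj (((assoc P Q R).operRight S).obj p.oper)} (hk₀ : k₀ = 𝟙 _)
    {k : assocOperObj (assocOperObj p.oper) ⟶ assocOperObj (assocOperObj p.oper)} (hk : k = 𝟙 _)
    {z : ((Q.comp R).comp S).Params (assocOperObjOper (((assoc P Q R).operRight S).obj p.oper))}
    {v : (Q.comp (R.comp S)).Params (assocOperObjOper (assocOperObj p.oper))}
    (t : HFib.Over k₀.oper (mkParam (assocOperObjOper (((assoc P Q R).operRight S).obj p.oper))
      p.arg (fst (CompPm.par (((assoc P Q R).pmRight S).obj p)))) z)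
    (t' : HFib.Over k.oper (mkParam (assocOperObjOper (assocOperObj p.oper))
      (mkParam (assocOperObjOper p.oper) p.arg (fst p.par)) (fst (assocPmObj p).par)) v)
    (f : HFib.Over (pentOperHom p.oper) ((assoc Q R S).fib z) v)
    (h₁ : (CompPm.Hom.arg (CompPm.Hom.arg t'.pt).pt).pt
      = (CompPm.Hom.arg t.pt).pt ≫ (CompPm.Hom.arg (CompPm.Hom.arg f.pt).pt).pt)
    (h₂ : (CompPm.Hom.par (CompPm.Hom.arg t'.pt).pt).pt
      = (CompPm.Hom.arg (CompPm.Hom.par t.pt).pt).pt ≫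
        (CompPm.Hom.par (CompPm.Hom.arg f.pt).pt).pt)
    (h₃ : (CompPm.Hom.par t'.pt).pt
      = (CompPm.Hom.par (CompPm.Hom.par t.pt).pt).pt ≫ (CompPm.Hom.par f.pt).pt) :
    ((snd (assocPmObj p).par).path ≫ nestIn (assocOperObj p.oper)
      (mkParam (assocOperObjOper p.oper) p.arg (fst p.par)) (fst (assocPmObj p).par)) ≫ k.app t' =
    (((snd (CompPm.par (((assoc P Q R).pmRight S).obj p))).path ≫
      nestIn (((assoc P Q R).operRight S).obj p.oper) p.arg
        (fst (CompPm.par (((assoc P Q R).pmRight S).obj p)))) ≫ k₀.app t) ≫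
          CompOp.Hom.app (nest p.oper (pentFst f) (pentMid f)) (pentSnd f) := by
  rw [Category.assoc, nestIn_app hk, Category.assoc
    (snd (CompPm.par (((assoc P Q R).pmRight S).obj p))).path, nestIn_app hk₀]
  have e : (CompPm.par (((assoc P Q R).pmRight S).obj p)).path = assocOperMap p.par.path :=
    Category.id_comp _
  refine assoc_congr₄ (Eq.trans ?_ (congrArg (_ ≫ · ≫ _) (nestIn_app_map e _).symm))
  refine CompOp.app_comp₂₄_eq (P := P) (Q := Q)
    (l' := nest p.oper (nestFst hk₀ t :)
      (fstOver (h := assocOperMapOper (p.oper.fam.map (nestFst hk₀ t :))) (nestSnd hk₀ t)))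
    (h := nest p.oper (fstHom (nestFst hk t' :) :) (sndHom (nestFst hk t')))
    ?_ _ (nestSnd hk t') _ _
    (sndOver (h := assocOperMapOper (p.oper.fam.map (nestFst hk₀ t :))) (nestSnd hk₀ t)) _ ?_
  · refine assoc_congr₃ ?_
    refine CompOp.app_comp₃_eq (P := P.comp Q) (Q := R)
      (l := p.oper.fam.map (fstHom (nestFst hk t' :) :)) ?_ _ _ (sndHom (nestFst hk t')) _
      (fstOver (h := assocOperMapOper (p.oper.fam.map (nestFst hk₀ t :))) (nestSnd hk₀ t)) _ ?_
    · refine congrArg (p.par.path ≫ ·) ((p.oper.fam.map_comp _ _).symm.trans (Eq.trans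
        (congrArg p.oper.fam.map (HFib.hom_ext ?_)) (p.oper.fam.map_comp _ _)))
      exact (Category.id_comp _).trans h₁
    · exact congrArg (_ ≫ ·) ((Category.id_comp _).trans h₂)
  · exact congrArg (_ ≫ ·) (h₃.trans (Category.id_comp _).symm)

section

variable (P Q R S)

noncomputable abbrev pentSource : Eqv (((P.comp Q).comp R).comp S) (P.comp ((Q.comp R).comp S)) :=
  ((assoc P Q R).whiskerRight S).trans (assoc P (Q.comp R) S)

noncomputable abbrev pentTarget : Eqv (((P.comp Q).comp R).comp S) (P.comp (Q.comp (R.comp S))) :=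
  (assoc (P.comp Q) R S).trans (assoc P Q (R.comp S))

end

theorem pentTarget_parAt_path (e : CompPm ((P.comp Q).comp R) S) :
    ((pentTarget P Q R S).parAt e).path = ((snd (assocPmObj e).par).path ≫
      nestIn (assocOperObj e.oper) (mkParam (assocOperObjOper e.oper) e.arg (fst e.par))
        (fst (assocPmObj e).par)) ≫
      CompOp.Hom.app ((pentTarget P Q R S).proj.hom.app e :) (HFib.toPush _ _) := rfl

theorem pentSource_parAt_path (e : CompPm ((P.comp Q).comp R) S) :
    ((pentSource P Q R S).parAt e).path =
      ((snd (CompPm.par (((assoc P Q R).pmRight S).obj e))).path ≫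
        nestIn (((assoc P Q R).operRight S).obj e.oper) e.arg
          (fst (CompPm.par (((assoc P Q R).pmRight S).obj e)))) ≫
        CompOp.Hom.app ((pentSource P Q R S).proj.hom.app e :) (HFib.toPush _ _) := rfl

/-- All coordinates have identity points, so the content is that each lies over the preceding one;
the paths differ by identities and by bracketing. -/
noncomputable abbrev pentArg (e : CompPm ((P.comp Q).comp R) S) : HFib.Over (pentOperHom e.oper)
    ((assoc Q R S).fib ((pentSource P Q R S).argAt e)) ((pentTarget P Q R S).argAt e) :=
  ⟨⟨pentOperHom e.oper,
      ⟨⟨pentInnerHom e.oper, ⟨𝟙 _, (congrArg (· ≫ _) (S.proj.map_id _)).trans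
        ((Category.id_comp _).trans (Category.comp_id _).symm)⟩, ⟨𝟙 _, by
        refine (congrArg (· ≫ _) (R.proj.map_id _)).trans ((Category.id_comp _).trans ?_)
        refine Eq.trans ?_ (congrArg (_ ≫ ·) ((assocOperObjOper
          (assocOperObjOper (((assoc P Q R).operRight S).obj e.oper))).fam.map_id _)).symm
        refine Eq.trans ?_ (Category.comp_id _).symm
        exact congrArg (_ ≫ ·) ((Category.id_comp _).trans
          (Category.id_comp (CompOp.Hom.oper e.par.path))).symm⟩⟩,
        (Category.comp_id _).trans (Category.id_comp _).symm⟩, ⟨𝟙 _, by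
        refine (congrArg (· ≫ _) (Q.proj.map_id _)).trans ((Category.id_comp _).trans ?_)
        refine Eq.trans ?_ (Category.assoc _ _ _).symm
        refine Eq.trans ?_ (Category.assoc _ _ _).symm
        refine Eq.trans (congrArg (_ ≫ ·) ?_) (Category.assoc _ _ _).symm
        refine (Category.assoc (CompOp.Hom.oper e.par.pt.par.path) _ _).trans
          (congrArg (_ ≫ ·) ?_)
        let v : HFib S.proj e.oper.oper := ⟨e.arg.pt, e.arg.path ≫ 𝟙 e.oper.oper⟩
        let u : e.arg ⟶ v := ⟨𝟙 e.arg.pt, by simp [v]⟩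
        refine nested_oper_eq (f := e.par.path) (g := e.oper.fam.map u)
          (g₁ := e.oper.fam.map u) (g₂ := e.oper.fam.map (𝟙 v))
          ((Category.id_comp _).trans (Category.id_comp _)) ?_ _ _ _ _ _ ?_
        · exact (congrArg (e.oper.fam.map u ≫ ·) (e.oper.fam.map_id v)).trans (Category.comp_id _)
        · exact congrArg (_ ≫ ·) (Category.id_comp (𝟙 e.par.pt.arg.pt)).symm⟩⟩, by
        refine (congrArg (pentOperHom e.oper ≫ ·) ?_).trans ((Category.comp_id _).trans
          (Eq.trans (Category.id_comp _).symm (congrArg (· ≫ pentOperHom e.oper) ?_)))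
        · exact (Category.id_comp _).trans ((Category.id_comp _).trans
            (congrArg CompOp.Hom.oper ((assocOper P Q (R.comp S)).map_id _)))
        · refine ((Category.id_comp _).trans ?_).symm
          refine (congrArg (assocOper Q R S).map (Category.id_comp _)).trans ?_
          exact (congrArg (assocOper Q R S).map ((Category.id_comp _).trans
            (congrArg CompOp.Hom.oper ((assocOper P (Q.comp R) S).map_id _)))).trans
            ((assocOper Q R S).map_id _)⟩

theorem pentPar_path (e : CompPm ((P.comp Q).comp R) S) :
    ((pentTarget P Q R S).parAt e).path = ((pentSource P Q R S).parAt e).path ≫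
      CompOp.Hom.app (nest e.oper (pentFst (pentArg e)) (pentMid (pentArg e)))
        (pentSnd (pentArg e)) := by
  refine (pentTarget_parAt_path e).trans (Eq.trans ?_
    (congrArg (· ≫ _) (pentSource_parAt_path e).symm))
  -- The projection fillers of both composites are identities, but only up to the identity laws of
  -- the functors involved.
  have hk₀ : ((pentSource P Q R S).proj.hom.app e :) =
      𝟙 (assocOperObj (((assoc P Q R).operRight S).obj e.oper)) :=
    (Category.id_comp _).trans ((assocOper P (Q.comp R) S).map_id _)
  have hk : ((pentTarget P Q R S).proj.hom.app e :) = 𝟙 (assocOperObj (assocOperObj e.oper)) :=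
    (Category.id_comp _).trans ((assocOper P Q (R.comp S)).map_id _)
  exact par_pentagon hk₀ hk (HFib.toPush _ _) (HFib.toPush _ _) (pentArg e)
    (Category.id_comp _).symm (Category.id_comp _).symm (Category.id_comp _).symm

noncomputable def pentagonHom (P : GPoly I J) (Q : GPoly J K) (R : GPoly K L) (S : GPoly L M) :
    (((assoc P Q R).whiskerRight S).trans (assoc P (Q.comp R) S)).trans
        ((assoc Q R S).whiskerLeft P)
      ⟶ (assoc (P.comp Q) R S).trans (assoc P Q (R.comp S)) :=
  leftHom (A := pentSource P Q R S)
    (B := pentTarget P Q R S)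
    (fun o => pentHet o)
    (fun {a a'} h => pentOperHom_naturality h)
    (fun {a a'} h {x x' y y'} f k' k f' w => by
      have w₁ := congrArg (fun m => (CompPm.Hom.arg (CompPm.Hom.arg m).pt).pt) w
      have w₂ := congrArg (fun m => (CompPm.Hom.par (CompPm.Hom.arg m).pt).pt) w
      have w₃ := congrArg (fun m => (CompPm.Hom.par m).pt) w
      refine CompOp.app_square (P := P) (Q := Q) ?_
        (sndOver (h := assocOperMapOper (h.app (fstOver f :))) (sndOver f)) _ _ (sndOver f') w₃
      refine CompOp.app_square (P := P.comp Q) (Q := R) ?_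
        (fstOver (h := assocOperMapOper (h.app (fstOver f :))) (sndOver f)) _ _
        (sndOver (fstOver f' :)) w₂
      exact CompOp.Hom.app_comp_map h _ _ _ _ w₁)
    (fun e => pentArg e)
    (fun e => ⟨𝟙 _, (congrArg (· ≫ _) (P.proj.map_id _)).trans
      ((Category.id_comp _).trans (pentPar_path e))⟩)
    (fun {_ _} f => CompPm.hom_ext (pentOperHom_naturality f.oper) (CompPm.hom_ext
      (congrArg CompOp.Hom.oper (pentOperHom_naturality f.oper))
      ((Category.comp_id _).trans (Category.id_comp _).symm)
      ((Category.comp_id _).trans (Category.id_comp _).symm))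
      ((Category.comp_id _).trans (Category.id_comp _).symm))
    (fun {_ _} f => (Category.comp_id _).trans (Category.id_comp _).symm)
    (fun e => (congrArg (· ≫ _) (P.src.map_id _)).trans (Category.id_comp _))
    (fun b => congrArg (· ≫ _) (S.tgt.map_id _))

end Pentagon

end Eqv

end GPoly

/-! ### Assembly of the bicategory. -/

namespace GPoly

section

variable {I J K L : Type u} [Groupoid.{u} I] [Groupoid.{u} J] [Groupoid.{u} K] [Groupoid.{u} L]

noncomputable abbrev assocCell (P : GPoly I J) (Q : GPoly J K) (R : GPoly K L) :
    (P.comp Q).comp R ⟶ P.comp (Q.comp R) := (assoc P Q R).cell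

noncomputable abbrev lamCell (P : GPoly I J) : (GPoly.id I).comp P ⟶ P := (lam P).cell

noncomputable abbrev rhoCell (P : GPoly I J) : P.comp (GPoly.id J) ⟶ P := (rho P).cell

end

/-- The bicategory structure on groupoids, polynomials in groupoids and 2-cells. -/
noncomputable def coherence : Coherence.{u} where
  associator P Q R := asIso (assocCell P Q R)
  leftUnitor P := asIso (lamCell P)
  rightUnitor P := asIso (rhoCell P)
  whiskerLeft_id P Q :=
    -- The isomorphism has an identity equivalence in front of the whiskering, which the unit law
    -- removes.
    (Category.id_comp _).symm.trans (Eqv.cell_eq (Eqv.whiskerLeftRefl P Q))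
  whiskerLeft_comp P Q Q' Q'' η θ := by
    obtain ⟨η⟩ := η
    obtain ⟨θ⟩ := θ
    exact (Category.id_comp _).symm.trans (Eqv.cell_eq (Eqv.whiskerLeftTrans P η θ))
  id_whiskerLeft {I J _ _ P P'} η := by
    obtain ⟨η⟩ := η
    -- Moving the inverse across leaves an equation between classes of composites without inverses,
    -- which a single isomorphism settles. The laws with an associator are treated alike.
    refine (IsIso.eq_comp_inv (lamCell P')).2 ?_ |>.trans (Category.assoc _ _ _)
    exact Eqv.cell_eq (Eqv.unitWhiskerLeft η)
  comp_whiskerLeft P Q R R' η := by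
    obtain ⟨η⟩ := η
    refine (IsIso.eq_comp_inv (assocCell P Q R')).2 ?_ |>.trans (Category.assoc _ _ _)
    exact (Eqv.cell_eq (Eqv.leftComp P Q η)).symm
  id_whiskerRight P Q := Eqv.cell_eq (Eqv.reflWhiskerRight P Q)
  comp_whiskerRight {I J K _ _ _ P P' P''} η θ Q := by
    obtain ⟨η⟩ := η
    obtain ⟨θ⟩ := θ
    exact Eqv.cell_eq (Eqv.transWhiskerRight η θ Q)
  whiskerRight_id {I J _ _ P P'} η := by
    obtain ⟨η⟩ := η
    refine (IsIso.eq_comp_inv (rhoCell P')).2 ?_ |>.trans (Category.assoc _ _ _)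
    exact Eqv.cell_eq (Eqv.whiskerRightUnit η)
  whiskerRight_comp {I J K L _ _ _ _ P P'} η Q R := by
    obtain ⟨η⟩ := η
    refine (IsIso.eq_inv_comp (assocCell P Q R)).2 ?_
    exact Eqv.cell_eq (Eqv.rightComp η Q R)
  whisker_assoc {I J K L _ _ _ _} P Q Q' η R := by
    obtain ⟨η⟩ := η
    refine (IsIso.eq_comp_inv (assocCell P Q' R)).2 ?_ |>.trans (Category.assoc _ _ _)
    exact (Eqv.cell_eq (Eqv.midAssoc P η R)).symm
  whisker_exchange {I J K _ _ _ P P' Q Q'} η θ := by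
    obtain ⟨η⟩ := η
    obtain ⟨θ⟩ := θ
    exact (Eqv.cell_eq (Eqv.exchange η θ)).symm
  pentagon P Q R S :=
    (Category.assoc _ _ _).symm.trans (Eqv.cell_eq (Eqv.pentagonHom P Q R S))
  triangle P Q := Eqv.cell_eq (Eqv.triangleHom P Q)

end GPoly

/-! ### Finitary polynomials. -/

/-- A groupoid with at most one morphism between any two objects and finitely many isomorphism
classes. -/
structure IsFiniteDiscrete (X : Type u) [Groupoid.{u} X] : Prop where
  thin (x y : X) : Subsingleton (x ⟶ y)
  cover : ∃ (T : Type) (_ : Finite T) (f : T → X), ∀ x, ∃ t, Nonempty (x ⟶ f t)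

/-- A thin groupoid is equivalent to the set of its isomorphism classes, and the cover makes that
set finite. Since the cover may repeat classes, no cardinality has to be computed for composites. -/
theorem IsFiniteDiscrete.nonempty_equivalence {X : Type u} [Groupoid.{u} X]
    (h : IsFiniteDiscrete X) : ∃ n : ℕ, Nonempty (X ≌ Discrete (Fin n)) := by
  obtain ⟨T, _, f, hf⟩ := h.cover
  have := h.thin
  let Q := Quotient (isIsomorphicSetoid X)
  have : Finite Q := Finite.of_surjective (fun t => (Quotient.mk _ (f t) : Q)) fun q => by
    induction q using Quotient.inductionOn with
    | _ x =>
      obtain ⟨t, ⟨k⟩⟩ := hf x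
      exact ⟨t, Quotient.sound ⟨(asIso k).symm⟩⟩
  obtain ⟨n, ⟨e⟩⟩ := Finite.exists_equiv_fin Q
  let F : X ⥤ Discrete Q :=
    { obj := fun x => ⟨Quotient.mk _ x⟩
      map := fun k => Discrete.eqToHom (Quotient.sound ⟨asIso k⟩) }
  have : F.Faithful := ⟨fun _ => Subsingleton.elim _ _⟩
  have : F.Full := ⟨fun {x y} k => by
    obtain ⟨i⟩ : IsIsomorphic x y := Quotient.exact (Discrete.eq_of_hom k)
    exact ⟨i.hom, Subsingleton.elim _ _⟩⟩
  have : F.EssSurj := ⟨fun ⟨q⟩ => by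
    induction q using Quotient.inductionOn with
    | _ x => exact ⟨x, ⟨Iso.refl _⟩⟩⟩
  have : F.IsEquivalence := { }
  exact ⟨n, ⟨F.asEquivalence.trans (Discrete.equivalence e)⟩⟩

theorem isFiniteDiscrete_of_equivalence {X : Type u} [Groupoid.{u} X] {n : ℕ}
    (e : X ≌ Discrete (Fin n)) : IsFiniteDiscrete X where
  thin _ _ := ⟨fun _ _ => e.functor.map_injective (Subsingleton.elim _ _)⟩
  cover := ⟨Fin n, inferInstance, fun t => e.inverse.obj ⟨t⟩,
    fun x => ⟨(e.functor.obj x).as, ⟨e.unit.app x⟩⟩⟩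

theorem isFiniteDiscrete_hfib_id {X : Type u} [Groupoid.{u} X] (x : X) :
    IsFiniteDiscrete (HFib (𝟭 X) x) where
  thin _ z := ⟨fun f g => HFib.hom_ext ((cancel_mono z.path).1 (f.path.trans g.path.symm))⟩
  cover := ⟨Unit, inferInstance, fun _ => ⟨x, 𝟙 x⟩, fun y => ⟨(), ⟨⟨y.path, Category.comp_id _⟩⟩⟩⟩

/-- Morphisms over `γ` out of `x` are morphisms out of `x.push γ` in the fibre at the end of `γ`. -/
theorem HFib.over_subsingleton {E B : Type u} [Groupoid.{u} E] [Groupoid.{u} B] {p : E ⥤ B} {b c : B}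
    (h : IsFiniteDiscrete (HFib p c)) (γ : b ⟶ c) (x : HFib p b) (y : HFib p c) :
    Subsingleton (HFib.Over γ x y) where
  allEq f g := HFib.Over.ext (congrArg HFib.Hom.pt
    ((h.thin (x.push γ) y).elim f.pushHom g.pushHom))

namespace GPoly

variable {I J K : Type u} [Groupoid.{u} I] [Groupoid.{u} J] [Groupoid.{u} K]

theorem isFinitary_iff {P : GPoly I J} :
    P.IsFinitary ↔ ∀ c : P.Op, IsFiniteDiscrete (P.Params c) :=
  forall_congr' fun _ => ⟨fun ⟨_, ⟨e⟩⟩ => isFiniteDiscrete_of_equivalence e,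
    fun h => h.nonempty_equivalence⟩

/-- Parameters of a composite are pairs of coordinates: thinness holds in each coordinate, and the
covers of the second coordinates over a finite cover of the first form a finite sum. -/
theorem isFinitary_comp {P : GPoly I J} {Q : GPoly J K} (hP : P.IsFinitary) (hQ : Q.IsFinitary) :
    (P.comp Q).IsFinitary := by
  rw [isFinitary_iff] at hP hQ ⊢
  refine fun (o : CompOp P Q) => ⟨fun z z' => ⟨fun k k' => ?_⟩, ?_⟩
  · have e : fstHom k = fstHom k' := ((hQ _).thin _ _).elim _ _
    have e' := (HFib.over_subsingleton (hP _) _ _ _).elim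
      ((sndHom k).cast (congrArg o.fam.map e)) (sndHom k')
    exact compParams_ext (congrArg HFib.Hom.pt e) (congrArg HFib.Over.pt e')
  · obtain ⟨T, _, f, hf⟩ := (hQ o.oper).cover
    choose S hS g hg using fun t : T => (hP (o.fam.obj (f t))).cover
    refine ⟨Σ t, S t, inferInstance, fun s => mkParam o (f s.1) (g s.1 s.2), fun z => ?_⟩
    obtain ⟨t, ⟨a⟩⟩ := hf (fst (o := o) z)
    -- The second coordinate lies over the value at `fst z`; it is moved along `a` to the value at
    -- the chosen representative before the cover there is used.
    obtain ⟨s, ⟨b⟩⟩ := hg t ((snd (o := o) z).push (o.fam.map a))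
    exact ⟨⟨t, s⟩, ⟨toMkParam (o := o) z ≫ mkParamHom a ((HFib.toPush _ _).post b)⟩⟩

/-- A reducible version of `GPoly.pair`. -/
noncomputable abbrev pairing (P : GPoly I J) (Q : GPoly I K) : GPoly I (J ⊕ K) where
  Op := P.Op ⊕ Q.Op
  Pm := P.Pm ⊕ Q.Pm
  src := P.src.sum' Q.src
  proj := P.proj.sum Q.proj
  tgt := P.tgt.sum Q.tgt

/-- A reducible version of `GPoly.graph`. -/
abbrev graphPoly (f : I ≌ J) : GPoly I J where
  Op := I
  Pm := I
  src := 𝟭 I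
  proj := 𝟭 I
  tgt := f.functor

/-- There are no morphisms between the summands, so the parameters of an operation of one summand
all come from that summand. -/
theorem isFinitary_pairing {P : GPoly I J} {Q : GPoly I K} (hP : P.IsFinitary) (hQ : Q.IsFinitary) :
    (pairing P Q).IsFinitary := by
  rw [isFinitary_iff] at hP hQ ⊢
  rintro (c | c)
  · refine ⟨?_, ?_⟩
    · rintro ⟨x | x, p⟩ ⟨y | y, q⟩
      · refine ⟨fun f g => HFib.hom_ext (congrArg ULift.up ?_)⟩
        have hf := congrArg ULift.down f.path
        have hg := congrArg ULift.down g.path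
        exact congrArg HFib.Hom.pt (((hP c).thin ⟨x, p.down⟩ ⟨y, q.down⟩).elim
          ⟨f.pt.down, hf⟩ ⟨g.pt.down, hg⟩)
      · exact q.elim
      · exact p.elim
      · exact p.elim
    · obtain ⟨T, _, f, hf⟩ := (hP c).cover
      refine ⟨T, inferInstance, fun t => ⟨.inl (f t).pt, ⟨(f t).path⟩⟩, ?_⟩
      rintro ⟨x | x, p⟩
      · obtain ⟨t, ⟨k⟩⟩ := hf ⟨x, p.down⟩
        exact ⟨t, ⟨⟨⟨k.pt⟩, congrArg ULift.up k.path⟩⟩⟩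
      · exact p.elim
  · refine ⟨?_, ?_⟩
    · rintro ⟨x | x, p⟩ ⟨y | y, q⟩
      · exact p.elim
      · exact p.elim
      · exact q.elim
      · refine ⟨fun f g => HFib.hom_ext (congrArg ULift.up ?_)⟩
        have hf := congrArg ULift.down f.path
        have hg := congrArg ULift.down g.path
        exact congrArg HFib.Hom.pt (((hQ c).thin ⟨x, p.down⟩ ⟨y, q.down⟩).elim
          ⟨f.pt.down, hf⟩ ⟨g.pt.down, hg⟩)
    · obtain ⟨T, _, f, hf⟩ := (hQ c).cover
      refine ⟨T, inferInstance, fun t => ⟨.inr (f t).pt, ⟨(f t).path⟩⟩, ?_⟩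
      rintro ⟨x | x, p⟩
      · exact p.elim
      · obtain ⟨t, ⟨k⟩⟩ := hf ⟨x, p.down⟩
        exact ⟨t, ⟨⟨⟨k.pt⟩, congrArg ULift.up k.path⟩⟩⟩

/-- For the identities, the projections and the polynomials of equivalences, `proj` is an identity
functor, whose homotopy fibres are contractible. -/
theorem finitaryStable : FinitaryStable.{u} where
  id I _ := isFinitary_iff.2 fun c => isFiniteDiscrete_hfib_id (X := I) c
  comp := isFinitary_comp
  projl I _ _ _ := isFinitary_iff.2 fun c => isFiniteDiscrete_hfib_id (X := I) c
  projr _ J _ _ := isFinitary_iff.2 fun c => isFiniteDiscrete_hfib_id (X := J) c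
  pair := isFinitary_pairing
  graph {I _ _ _} _ := isFinitary_iff.2 fun c => isFiniteDiscrete_hfib_id (X := I) c

end GPoly

/-! ### Composition with a restriction `restr i`. -/

/-- The path of a point of a homotopy fibre of an identity functor. -/
abbrev HFib.edge {J : Type u} [Groupoid.{u} J] {j : J} (x : HFib (𝟭 J) j) : x.pt ⟶ j := x.path

/-- The morphism between two points of a homotopy fibre of an identity functor. -/
noncomputable abbrev HFib.homOfId {J : Type u} [Groupoid.{u} J] {j : J} (x y : HFib (𝟭 J) j) : x ⟶ y :=
  ⟨(x.edge ≫ inv y.edge :), by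
    change (_ ≫ inv y.edge) ≫ y.edge = x.path
    simp⟩

theorem HFib.id_hom_eq {J : Type u} [Groupoid.{u} J] {j : J} {x y : HFib (𝟭 J) j} (f g : x ⟶ y) :
    f = g :=
  ((isFiniteDiscrete_hfib_id j).thin x y).elim f g

theorem HFib.id_over_eq {J : Type u} [Groupoid.{u} J] {j k : J} {γ : j ⟶ k} {x : HFib (𝟭 J) j}
    {y : HFib (𝟭 J) k} (f g : HFib.Over γ x y) : f = g :=
  (HFib.over_subsingleton (isFiniteDiscrete_hfib_id k) γ x y).elim f g

namespace GPoly

variable {I J K M : Type u} [Groupoid.{u} I] [Groupoid.{u} J] [Groupoid.{u} K] [Groupoid.{u} M]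

/-- The polynomial that restricts along `i`: one operation of each type `j`, with one parameter, of
type `i j`. -/
abbrev restr (i : J ⥤ M) : GPoly M J where
  Op := J
  Pm := J
  src := i
  proj := 𝟭 J
  tgt := 𝟭 J

variable {i : J ⥤ M}

/-- The parameter of the operation `j`. -/
abbrev restrPt (i : J ⥤ M) (j : J) : (restr i).Params j := ⟨j, 𝟙 j⟩

namespace CompOp

variable {P : GPoly I M}

/-- Morphisms of operations of `P.comp (restr i)`, from a morphism between members of the families. -/
noncomputable abbrev restrHom {o o' : CompOp P (restr i)} {x : (restr i).Params o.oper}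
    {x' : (restr i).Params o'.oper} (g : o.fam.obj x ⟶ o'.fam.obj x') (κ : x.pt ⟶ x'.pt)
    (h : P.tgt.map g ≫ o'.typ x' = o.typ x ≫ i.map κ) : o ⟶ o' where
  oper := inv x.edge ≫ κ ≫ x'.edge
  app {y y'} f := o.fam.map (HFib.homOfId y x) ≫ g ≫ o'.fam.map (HFib.homOfId x' y')
  naturality {y₁ y y' y₁'} l f l' := by
    have e : l ≫ HFib.homOfId y x = HFib.homOfId y₁ x := HFib.id_hom_eq _ _
    have e' : HFib.homOfId x' y' ≫ l' = HFib.homOfId x' y₁' := HFib.id_hom_eq _ _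
    rw [← e, ← e']
    simp only [Functor.map_comp, Category.assoc]
  typ {y y'} f := by
    have hf := f.path
    change f.pt ≫ y'.edge = y.edge ≫
      inv x.edge ≫ κ ≫ x'.edge at hf
    have e : f.pt = (HFib.homOfId y x).pt ≫ κ ≫ (HFib.homOfId x' y').pt := by
      rw [← cancel_mono y'.edge, hf]
      change _ = (_ ≫ _ ≫ _ ≫ inv y'.edge) ≫ _
      simp
    change _ = _ ≫ i.map f.pt
    rw [e, P.tgt.map_comp, P.tgt.map_comp, Category.assoc, Category.assoc, o'.typ_naturality,
      reassoc_of% h, o.typ_naturality_assoc, i.map_comp (HFib.homOfId y x).pt, i.map_comp κ]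

theorem restrHom_app {o o' : CompOp P (restr i)} {x : (restr i).Params o.oper}
    {x' : (restr i).Params o'.oper} (g : o.fam.obj x ⟶ o'.fam.obj x') (κ : x.pt ⟶ x'.pt)
    (h : P.tgt.map g ≫ o'.typ x' = o.typ x ≫ i.map κ)
    (f : HFib.Over (restrHom g κ h).oper x x') : (restrHom g κ h).app f = g := by
  have e (o : CompOp P (restr i)) (x : (restr i).Params o.oper) :
      o.fam.map (HFib.homOfId x x) = 𝟙 _ :=
    (congrArg o.fam.map (HFib.id_hom_eq _ _)).trans (o.fam.map_id x)
  change o.fam.map (HFib.homOfId x x) ≫ g ≫ o'.fam.map (HFib.homOfId x' x') = g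
  rw [e, e, Category.comp_id, Category.id_comp]

/-- All parameters of an operation of `restr i` are uniquely isomorphic, so naturality carries one
component to every other. -/
theorem restr_hom_ext {o o' : CompOp P (restr i)} {k l : o ⟶ o'} (e : k.oper = l.oper)
    {x : (restr i).Params o.oper} {x' : (restr i).Params o'.oper} (f : HFib.Over k.oper x x')
    (f' : HFib.Over l.oper x x') (e' : k.app f = l.app f') : k = l := by
  refine CompOp.hom_ext e fun {y y'} f₁ => ?_
  have h₁ : ((f.pre (HFib.homOfId y x)).post (HFib.homOfId x' y')) = f₁ := HFib.id_over_eq _ _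
  have h₂ : ((f'.pre (HFib.homOfId y x)).post (HFib.homOfId x' y')) = f₁.cast e :=
    HFib.id_over_eq _ _
  rw [← h₂, ← h₁, ← CompOp.Hom.naturality, ← CompOp.Hom.naturality, e']

/-- The operation of `P.comp (restr i)` given by an operation of `P` of type `i j`. -/
noncomputable abbrev constOp (c : P.Op) (j : J) (γ : P.tgt.obj c ⟶ i.obj j) : CompOp P (restr i) where
  oper := j
  fam := (Functor.const _).obj c
  typ x := γ ≫ i.map (inv x.edge)
  typ_naturality {x y} f := by
    have h := f.path
    change f.pt ≫ y.edge = x.edge at h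
    change P.tgt.map (𝟙 c) ≫ _ = _ ≫ i.map f.pt
    rw [P.tgt.map_id, Category.id_comp, Category.assoc, ← i.map_comp, ← h, IsIso.inv_comp,
      Category.assoc, IsIso.inv_hom_id]
    exact congrArg (fun t => γ ≫ i.map t) (Category.comp_id _).symm

theorem constOp_typ (c : P.Op) (j : J) (γ : P.tgt.obj c ⟶ i.obj j) :
    (constOp c j γ).typ (restrPt i j) = γ := by
  change γ ≫ i.map (inv (𝟙 j)) = γ
  rw [IsIso.inv_id, i.map_id, Category.comp_id]

/-- The morphism from a constant operation to a composite operation given by a morphism to one of its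
members. -/
noncomputable abbrev constHom {c : P.Op} {j : J} {γ : P.tgt.obj c ⟶ i.obj j} {o : CompOp P (restr i)}
    {x : (restr i).Params o.oper} (g : c ⟶ o.fam.obj x) (κ : j ⟶ x.pt)
    (h : P.tgt.map g ≫ o.typ x = γ ≫ i.map κ) : constOp c j γ ⟶ o :=
  restrHom (o := constOp c j γ) (x := restrPt i j) (x' := x) g κ
    (h.trans (congrArg (· ≫ i.map κ) (constOp_typ c j γ).symm))

/-- The morphism over `γ` between the canonical parameters. -/
abbrev ptOver {o o' : CompOp P (restr i)} (k : o ⟶ o') :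
    HFib.Over k.oper (restrPt i o.oper) (restrPt i o'.oper) :=
  ⟨k.oper, (Category.comp_id k.oper).trans (Category.id_comp k.oper).symm⟩

/-- The operation of `P` underlying an operation of `P.comp (restr i)`. -/
noncomputable abbrev restrOper (P : GPoly I M) (i : J ⥤ M) : CompOp P (restr i) ⥤ P.Op where
  obj o := o.fam.obj (restrPt i o.oper)
  map h := h.app (ptOver h)
  map_id o := (congrArg o.fam.map (HFib.id_hom_eq _ _)).trans (o.fam.map_id _)
  map_comp g h := by
    rw [CompOp.app_comp_app]
    congr 1

end CompOp

end GPoly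

/-! ### Isomorphisms between equivalences, read off from their restrictions. -/

namespace GPoly

open CompOp

variable {I J K M : Type u} [Groupoid.{u} I] [Groupoid.{u} J] [Groupoid.{u} K] [Groupoid.{u} M]

namespace Eqv

section

variable {P P' : GPoly I M} {φ ψ : Eqv P P'} {i : J ⥤ M}
  (N : φ.whiskerRight (restr i) ⟶ ψ.whiskerRight (restr i))

/-- The target fillers of a right whiskering are identities, so compatibility with targets leaves no
freedom in the `J`-part. -/
theorem restr_oper_eq (o : CompOp P (restr i)) : (N.oper.app o).oper = 𝟙 o.oper :=
  (Category.comp_id _).symm.trans (N.tgt o)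

/-- The component of a modification between restrictions at an operation of type `i j`. -/
noncomputable abbrev operAt (c : P.Op) (j : J) (γ : P.tgt.obj c ⟶ i.obj j) :
    φ.oper.obj c ⟶ ψ.oper.obj c :=
  (N.oper.app (constOp c j γ)).app (ptOver _)

/-- The parameter of `P.comp (restr i)` given by a parameter of an operation of type `i j`. -/
noncomputable abbrev constPm (p : P.Pm) (j : J) (γ : P.tgt.obj (P.proj.obj p) ⟶ i.obj j) :
    CompPm P (restr i) :=
  ⟨constOp (P.proj.obj p) j γ, restrPt i j, ⟨p, 𝟙 (P.proj.obj p)⟩⟩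

/-- The component of a modification between restrictions at a parameter of type `i j`. -/
noncomputable abbrev pmAt (p : P.Pm) (j : J) (γ : P.tgt.obj (P.proj.obj p) ⟶ i.obj j) :
    φ.pm.obj p ⟶ ψ.pm.obj p :=
  (N.pm.app (constPm p j γ)).par.pt

theorem pmAt_src (p : P.Pm) (j : J) (γ : P.tgt.obj (P.proj.obj p) ⟶ i.obj j) :
    P'.src.map (pmAt N p j γ) ≫ ψ.src.hom.app p = φ.src.hom.app p :=
  N.src (constPm p j γ)

theorem pm_oper_eq (z : CompPm P (restr i)) : (N.pm.app z).oper = N.oper.app z.oper :=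
  (Category.comp_id _).symm.trans ((N.proj z).trans (Category.id_comp _))

theorem pmAt_proj (p : P.Pm) (j : J) (γ : P.tgt.obj (P.proj.obj p) ⟶ i.obj j) :
    P'.proj.map (pmAt N p j γ) ≫ ψ.proj.hom.app p
      = φ.proj.hom.app p ≫ operAt N (P.proj.obj p) j γ := by
  have e (χ : Eqv P P') : χ.proj.hom.app p ≫ χ.oper.map (𝟙 (P.proj.obj p)) = χ.proj.hom.app p :=
    (congrArg (_ ≫ ·) (χ.oper.map_id _)).trans (Category.comp_id _)
  have h := (N.pm.app (constPm p j γ)).par.path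
  refine (congrArg (P'.proj.map (pmAt N p j γ) ≫ ·) (e ψ).symm).trans (h.trans ?_)
  refine (congrArg (· ≫ _) (e φ)).trans (congrArg (φ.proj.hom.app p ≫ ·) ?_)
  exact (CompOp.app_congr (pm_oper_eq N (constPm p j γ)) _).trans
    (congrArg _ (HFib.id_over_eq _ _))

theorem operAt_tgt (c : P.Op) (j : J) (γ : P.tgt.obj c ⟶ i.obj j) :
    P'.tgt.map (operAt N c j γ) ≫ ψ.tgt.hom.app c = φ.tgt.hom.app c := by
  have h := (N.oper.app (constOp c j γ)).typ (ptOver _)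
  have e : i.map (N.oper.app (constOp c j γ)).oper = 𝟙 _ :=
    (congrArg i.map (restr_oper_eq N _)).trans (i.map_id j)
  rw [← cancel_mono ((constOp c j γ).typ (restrPt i j)), Category.assoc]
  exact h.trans ((congrArg (_ ≫ ·) e).trans (Category.comp_id _))

/-- This is naturality of `N` at the morphism `constHom` out of a constant operation, read at one
component; the `J`-parts of `N` are identities by `restr_oper_eq`. -/
theorem operAt_naturality {c : P.Op} {j : J} {γ : P.tgt.obj c ⟶ i.obj j} {o : CompOp P (restr i)}
    (g : c ⟶ o.fam.obj (restrPt i o.oper)) (κ : j ⟶ o.oper)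
    (h : P.tgt.map g ≫ o.typ (restrPt i o.oper) = γ ≫ i.map κ) :
    φ.oper.map g ≫ (N.oper.app o).app (ptOver _) = operAt N c j γ ≫ ψ.oper.map g := by
  have e := N.oper.naturality (constHom g κ h)
  have k : HFib.Over (constHom g κ h).oper (restrPt i j) (restrPt i o.oper) :=
    ⟨κ, by
      change κ ≫ 𝟙 _ = 𝟙 j ≫ inv (𝟙 j) ≫ κ ≫ 𝟙 _
      simp⟩
  have h₁ : (constHom g κ h).app k = g := restrHom_app _ _ _ _
  have := CompOp.app_square e k (ptOver _) (ptOver _) k ?_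
  · refine (congrArg (φ.oper.map · ≫ _) h₁.symm).trans (this.trans ?_)
    exact congrArg (_ ≫ ψ.oper.map ·) h₁
  · change k.pt ≫ (N.oper.app o).oper = (N.oper.app (constOp c j γ)).oper ≫ k.pt
    rw [restr_oper_eq, restr_oper_eq]
    exact (Category.comp_id _).trans (Category.id_comp _).symm

theorem pmAt_naturality {p : P.Pm} {j : J} {γ : P.tgt.obj (P.proj.obj p) ⟶ i.obj j}
    {z : CompPm P (restr i)} (g : p ⟶ z.par.pt) (κ : j ⟶ z.arg.pt)
    (h : P.tgt.map (P.proj.map g ≫ z.par.path) ≫ z.oper.typ z.arg = γ ≫ i.map κ) :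
    φ.pm.map g ≫ (N.pm.app z).par.pt = pmAt N p j γ ≫ ψ.pm.map g := by
  let k : constPm p j γ ⟶ z :=
    { oper := constHom (P.proj.map g ≫ z.par.path) κ h
      arg := ⟨κ, by
        change κ ≫ HFib.edge (J := J) z.arg = 𝟙 j ≫ inv (𝟙 j) ≫ κ ≫ HFib.edge (J := J) z.arg
        simp⟩
      par := ⟨g, by
        refine Eq.trans ?_ (Category.id_comp _).symm
        exact (restrHom_app (o := constOp (P.proj.obj p) j γ) (x := restrPt i j)
          (P.proj.map g ≫ z.par.path) κ _ _).symm⟩ }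
  exact congrArg (fun t => t.par.pt) (N.pm.naturality k)

end

section

variable {P P' : GPoly I M} {φ ψ : Eqv P P'} {i : J ⥤ M} {i' : K ⥤ M}

theorem operRightHom_app (m : φ ⟶ ψ) (o : CompOp P (restr i)) :
    (operRightHom m (restr i) o).app (ptOver _) = m.oper.app (o.fam.obj (restrPt i o.oper)) :=
  (congrArg (fun t => _ ≫ ψ.oper.map t)
    ((congrArg o.fam.map (HFib.id_hom_eq _ (𝟙 _))).trans (o.fam.map_id _))).trans
    ((congrArg (_ ≫ ·) (ψ.oper.map_id _)).trans (Category.comp_id _))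

theorem oper_app_eq (m n : φ ⟶ ψ) (h : whiskerRightHom m (restr i) = whiskerRightHom n (restr i))
    (c : P.Op) (j : J) (γ : P.tgt.obj c ⟶ i.obj j) : m.oper.app c = n.oper.app c := by
  have e : operRightHom m (restr i) (constOp c j γ) = operRightHom n (restr i) (constOp c j γ) :=
    congrArg (fun t => t.oper.app (constOp c j γ)) h
  refine (operRightHom_app m (constOp c j γ)).symm.trans (Eq.trans ?_ (operRightHom_app n _))
  exact CompOp.app_congr_pt e _ _ rfl

theorem pm_app_eq (m n : φ ⟶ ψ) (h : whiskerRightHom m (restr i) = whiskerRightHom n (restr i))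
    (p : P.Pm) (j : J) (γ : P.tgt.obj (P.proj.obj p) ⟶ i.obj j) : m.pm.app p = n.pm.app p :=
  congrArg (fun t => (t.pm.app (constPm p j γ)).par.pt) h

/-- Two full functors have disjoint essential images that cover their common target. -/
structure _root_.CategoryTheory.Functor.Complementary (i : J ⥤ M) (i' : K ⥤ M) : Prop where
  full : i.Full
  full' : i'.Full
  cover (y : M) : (∃ j, Nonempty (y ⟶ i.obj j)) ∨ ∃ k, Nonempty (y ⟶ i'.obj k)
  disjoint (j : J) (k : K) : (i.obj j ⟶ i'.obj k) → False

/-- Each operation, and the operation of each parameter, has a type in the image of `i` or of `i'`;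
the component there can be read off at a constant operation. -/
theorem whiskerRightHom_injective (H : i.Complementary i') (m n : φ ⟶ ψ)
    (h : whiskerRightHom m (restr i) = whiskerRightHom n (restr i))
    (h' : whiskerRightHom m (restr i') = whiskerRightHom n (restr i')) : m = n := by
  apply Eqv.hom_ext
  · ext c
    obtain ⟨j, ⟨γ⟩⟩ | ⟨j, ⟨γ⟩⟩ := H.cover (P.tgt.obj c)
    · exact oper_app_eq m n h c j γ
    · exact oper_app_eq m n h' c j γ
  · ext p
    obtain ⟨j, ⟨γ⟩⟩ | ⟨j, ⟨γ⟩⟩ := H.cover (P.tgt.obj (P.proj.obj p))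
    · exact pm_app_eq m n h p j γ
    · exact pm_app_eq m n h' p j γ

/-- Fullness of `i` lifts the induced map of types to `J`. With `g` an identity this shows that
`operAt` does not depend on `j` and `γ`; in general it is naturality. -/
theorem operAt_eq [i.Full] (N : φ.whiskerRight (restr i) ⟶ ψ.whiskerRight (restr i))
    {c c' : P.Op} (g : c ⟶ c') {j j' : J} (γ : P.tgt.obj c ⟶ i.obj j)
    (γ' : P.tgt.obj c' ⟶ i.obj j') :
    φ.oper.map g ≫ operAt N c' j' γ' = operAt N c j γ ≫ ψ.oper.map g :=
  operAt_naturality N (o := constOp c' j' γ') g (i.preimage (inv γ ≫ P.tgt.map g ≫ γ')) (by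
    refine (congrArg (_ ≫ ·) (constOp_typ c' j' γ')).trans ?_
    rw [i.map_preimage, IsIso.hom_inv_id_assoc])

theorem pmAt_eq [i.Full] (N : φ.whiskerRight (restr i) ⟶ ψ.whiskerRight (restr i))
    {p p' : P.Pm} (g : p ⟶ p') {j j' : J} (γ : P.tgt.obj (P.proj.obj p) ⟶ i.obj j)
    (γ' : P.tgt.obj (P.proj.obj p') ⟶ i.obj j') :
    φ.pm.map g ≫ pmAt N p' j' γ' = pmAt N p j γ ≫ ψ.pm.map g :=
  pmAt_naturality N (z := constPm p' j' γ') g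
    (i.preimage (inv γ ≫ P.tgt.map (P.proj.map g) ≫ γ')) (by
    refine (congrArg (_ ≫ ·) (constOp_typ (P.proj.obj p') j' γ')).trans ?_
    rw [i.map_preimage, IsIso.hom_inv_id_assoc]
    exact congrArg (P.tgt.map · ≫ γ') (Category.comp_id _))

/-- Every composite operation receives a morphism from a constant one whose component is an
identity, so `N` is determined by its values at constant operations and parameters. -/
theorem whiskerRightHom_eq (m : φ ⟶ ψ) (N : φ.whiskerRight (restr i) ⟶ ψ.whiskerRight (restr i))
    (h : ∀ c j (γ : P.tgt.obj c ⟶ i.obj j), m.oper.app c = operAt N c j γ)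
    (h' : ∀ p j (γ : P.tgt.obj (P.proj.obj p) ⟶ i.obj j), m.pm.app p = pmAt N p j γ) :
    whiskerRightHom m (restr i) = N := by
  have e (o : CompOp P (restr i)) : operRightHom m (restr i) o = N.oper.app o := by
    refine restr_hom_ext (restr_oper_eq N o).symm (ptOver _) (ptOver _) ?_
    refine (operRightHom_app m o).trans ((h _ o.oper (o.typ _)).trans ?_)
    have := operAt_naturality N (o := o) (𝟙 _) (𝟙 _) (γ := o.typ _) (by simp)
    rw [φ.oper.map_id, ψ.oper.map_id] at this
    exact ((Category.comp_id _).symm.trans this.symm).trans (Category.id_comp _)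
  apply Eqv.hom_ext
  · ext o
    exact e o
  · ext z
    refine CompPm.hom_ext ((e z.oper).trans (pm_oper_eq N z).symm) ?_ ?_
    · have k := (N.pm.app z).arg.path
      have l : (N.pm.app z).oper.oper = 𝟙 _ :=
        (congrArg CompOp.Hom.oper (pm_oper_eq N z)).trans (restr_oper_eq N _)
      refine (cancel_mono (HFib.edge (J := J) z.arg)).1 ?_
      exact (Category.id_comp _).trans
        ((Category.comp_id _).symm.trans ((congrArg (z.arg.path ≫ ·) l.symm).trans k.symm))
    · have := pmAt_naturality N (z := z) (𝟙 _) (𝟙 _)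
        (γ := P.tgt.map z.par.path ≫ z.oper.typ z.arg) (by simp)
      rw [φ.pm.map_id, ψ.pm.map_id] at this
      exact (h' _ _ _).trans (((Category.comp_id _).symm.trans this.symm).trans (Category.id_comp _))

/-- Operations of `P` split according to their types, and no morphism joins the two parts.
Components taken from one restriction on each part thus form a natural transformation. -/
theorem exists_whiskerRightHom_eq (H : i.Complementary i')
    (M : φ.whiskerRight (restr i) ⟶ ψ.whiskerRight (restr i))
    (N : φ.whiskerRight (restr i') ⟶ ψ.whiskerRight (restr i')) :
    ∃ m : φ ⟶ ψ, whiskerRightHom m (restr i) = M ∧ whiskerRightHom m (restr i') = N := by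
  have := H.full
  have := H.full'
  have disj {c : P.Op} {j : J} {k : K} (γ : P.tgt.obj c ⟶ i.obj j) (δ : P.tgt.obj c ⟶ i'.obj k) :
      False := H.disjoint j k (inv γ ≫ δ)
  -- The component is specified by its equality with `operAt` for all identifications of the type at
  -- once. On the part where `c` does not lie the condition is vacuous, so later steps may use any
  -- identification at hand.
  have e (c : P.Op) : ∃ f : φ.oper.obj c ⟶ ψ.oper.obj c,
      (∀ j γ, f = operAt M c j γ) ∧ ∀ k γ, f = operAt N c k γ := by
    obtain ⟨j, ⟨γ⟩⟩ | ⟨j, ⟨γ⟩⟩ := H.cover (P.tgt.obj c)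
    · exact ⟨operAt M c j γ, fun j' γ' => by simpa using operAt_eq M (𝟙 c) γ' γ,
        fun _ δ => (disj γ δ).elim⟩
    · exact ⟨operAt N c j γ, fun _ δ => (disj δ γ).elim,
        fun j' γ' => by simpa using operAt_eq N (𝟙 c) γ' γ⟩
  have e' (p : P.Pm) : ∃ f : φ.pm.obj p ⟶ ψ.pm.obj p,
      (∀ j γ, f = pmAt M p j γ) ∧ ∀ k γ, f = pmAt N p k γ := by
    obtain ⟨j, ⟨γ⟩⟩ | ⟨j, ⟨γ⟩⟩ := H.cover (P.tgt.obj (P.proj.obj p))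
    · exact ⟨pmAt M p j γ, fun j' γ' => by simpa using pmAt_eq M (𝟙 p) γ' γ,
        fun _ δ => (disj γ δ).elim⟩
    · exact ⟨pmAt N p j γ, fun _ δ => (disj δ γ).elim,
        fun j' γ' => by simpa using pmAt_eq N (𝟙 p) γ' γ⟩
  choose f hf hf' using e
  choose g hg hg' using e'
  refine ⟨
    { oper := { app := f, naturality := fun c c' k => ?_ }
      pm := { app := g, naturality := fun p p' k => ?_ }
      src := fun p => ?_
      proj := fun p => ?_
      tgt := fun c => ?_ }, whiskerRightHom_eq _ M hf hg, whiskerRightHom_eq _ N hf' hg'⟩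
  · obtain ⟨j, ⟨γ⟩⟩ | ⟨j, ⟨γ⟩⟩ := H.cover (P.tgt.obj c')
    · rw [hf c' j γ, hf c j (P.tgt.map k ≫ γ)]
      exact operAt_eq M k _ _
    · rw [hf' c' j γ, hf' c j (P.tgt.map k ≫ γ)]
      exact operAt_eq N k _ _
  · obtain ⟨j, ⟨γ⟩⟩ | ⟨j, ⟨γ⟩⟩ := H.cover (P.tgt.obj (P.proj.obj p'))
    · rw [hg p' j γ, hg p j (P.tgt.map (P.proj.map k) ≫ γ)]
      exact pmAt_eq M k _ _
    · rw [hg' p' j γ, hg' p j (P.tgt.map (P.proj.map k) ≫ γ)]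
      exact pmAt_eq N k _ _
  · obtain ⟨j, ⟨γ⟩⟩ | ⟨j, ⟨γ⟩⟩ := H.cover (P.tgt.obj (P.proj.obj p))
    · dsimp only
      rw [hg p j γ]
      exact pmAt_src M p j γ
    · dsimp only
      rw [hg' p j γ]
      exact pmAt_src N p j γ
  · obtain ⟨j, ⟨γ⟩⟩ | ⟨j, ⟨γ⟩⟩ := H.cover (P.tgt.obj (P.proj.obj p))
    · dsimp only
      rw [hg p j γ, hf _ j γ]
      exact pmAt_proj M p j γ
    · dsimp only
      rw [hg' p j γ, hf' _ j γ]
      exact pmAt_proj N p j γ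
  · obtain ⟨j, ⟨γ⟩⟩ | ⟨j, ⟨γ⟩⟩ := H.cover (P.tgt.obj c)
    · dsimp only
      rw [hf c j γ]
      exact operAt_tgt M c j γ
    · dsimp only
      rw [hf' c j γ]
      exact operAt_tgt N c j γ

end

end Eqv

end GPoly

/-! ### Embeddings of polynomials and their restrictions. -/

namespace GPoly

open CompOp Eqv

variable {I J K M : Type u} [Groupoid.{u} I] [Groupoid.{u} J] [Groupoid.{u} K] [Groupoid.{u} M]

/-- Morphisms between constant operations. -/
abbrev CompOp.constMap {P : GPoly I M} {i : J ⥤ M} {c c' : P.Op} {j j' : J} {γ : P.tgt.obj c ⟶ i.obj j}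
    {γ' : P.tgt.obj c' ⟶ i.obj j'} (g : c ⟶ c') (κ : j ⟶ j') (h : P.tgt.map g ≫ γ' = γ ≫ i.map κ) :
    constOp c j γ ⟶ constOp c' j' γ' where
  oper := κ
  app _ := g
  naturality _ _ _ := (Category.id_comp _).trans (Category.comp_id _)
  typ {x y} f := by
    have hf := f.path
    change f.pt ≫ y.edge = x.edge ≫ κ at hf
    change P.tgt.map g ≫ γ' ≫ i.map (inv y.edge) = (γ ≫ i.map (inv x.edge)) ≫ i.map f.pt
    rw [reassoc_of% h, Category.assoc, ← i.map_comp, ← i.map_comp]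
    congr 2
    rw [IsIso.comp_inv_eq, Category.assoc, IsIso.eq_inv_comp, hf]

/-- An inclusion of a polynomial into `J` as the part of a polynomial into `M` that lies over a full
subgroupoid `i`. -/
structure Embedding (i : J ⥤ M) (A : GPoly I J) (X : GPoly I M) where
  oper : A.Op ⥤ X.Op
  pm : A.Pm ⥤ X.Pm
  [oper_full : oper.Full]
  [oper_faithful : oper.Faithful]
  [pm_full : pm.Full]
  [pm_faithful : pm.Faithful]
  src : pm ⋙ X.src ≅ A.src
  proj : pm ⋙ X.proj ≅ A.proj ⋙ oper
  tgt : oper ⋙ X.tgt ≅ A.tgt ⋙ i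
  oper_mem {c : X.Op} {j : J} : (X.tgt.obj c ⟶ i.obj j) → oper.essImage c
  pm_mem {p : X.Pm} {c : A.Op} : (X.proj.obj p ⟶ oper.obj c) → pm.essImage p

namespace Embedding

attribute [instance] oper_full oper_faithful pm_full pm_faithful

variable {i : J ⥤ M} {A : GPoly I J} {X : GPoly I M} (E : Embedding i A X)

/-- The induced functor to the operations of the restriction. -/
noncomputable abbrev operRestrict : A.Op ⥤ CompOp X (restr i) where
  obj c := constOp (E.oper.obj c) (A.tgt.obj c) (E.tgt.hom.app c)
  map k := constMap (E.oper.map k) (A.tgt.map k) (E.tgt.hom.naturality k)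
  map_id _ := CompOp.hom_ext (A.tgt.map_id _) fun _ => E.oper.map_id _
  map_comp _ _ := CompOp.hom_ext (A.tgt.map_comp _ _) fun _ => E.oper.map_comp _ _

instance : E.operRestrict.Faithful where
  map_injective h := E.oper.map_injective
    (CompOp.app_congr_pt h (ptOver _) (ptOver _) (congrArg CompOp.Hom.oper h))

/-- Compatibility with `typ` determines the image under `i` of the `J`-part, hence the `J`-part
itself when `i` is faithful. -/
theorem operRestrict_map_eq [i.Faithful] {c c' : A.Op} (f : E.operRestrict.obj c ⟶ E.operRestrict.obj c')
    (k : c ⟶ c') (h : E.oper.map k = f.app (ptOver f)) : E.operRestrict.map k = f := by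
  have h₁ := f.typ (ptOver f)
  have h₂ := E.tgt.hom.naturality k
  have e := constOp_typ (P := X) (i := i) (E.oper.obj c') (A.tgt.obj c') (E.tgt.hom.app c')
  have e' := constOp_typ (P := X) (i := i) (E.oper.obj c) (A.tgt.obj c) (E.tgt.hom.app c)
  refine restr_hom_ext (i.map_injective ?_) (ptOver _) (ptOver _) h
  refine (cancel_epi (E.tgt.hom.app c)).1 (h₂.symm.trans ?_)
  refine (congrArg (X.tgt.map · ≫ _) h).trans ?_
  exact (congrArg (_ ≫ ·) e.symm).trans (h₁.trans (congrArg (· ≫ _) e'))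

instance [i.Faithful] : E.operRestrict.Full where
  map_surjective f := ⟨E.oper.preimage (f.app (ptOver f)),
    E.operRestrict_map_eq f _ (E.oper.map_preimage _)⟩

theorem lift_typ [i.Full] {o : CompOp X (restr i)} {x : (restr i).Params o.oper} {c : A.Op}
    (g : E.oper.obj c ⟶ o.fam.obj x) : X.tgt.map g ≫ o.typ x = E.tgt.hom.app c ≫
      i.map (i.preimage (inv (E.tgt.hom.app c) ≫ X.tgt.map g ≫ o.typ x)) := by
  rw [i.map_preimage, IsIso.hom_inv_id_assoc]

/-- The morphism from the restriction of an operation given by a morphism to a member of a family. -/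
noncomputable abbrev liftHom [i.Full] {o : CompOp X (restr i)} {x : (restr i).Params o.oper} {c : A.Op}
    (g : E.oper.obj c ⟶ o.fam.obj x) : E.operRestrict.obj c ⟶ o :=
  constHom g (i.preimage (inv (E.tgt.hom.app c) ≫ X.tgt.map g ≫ o.typ x)) (E.lift_typ g)

noncomputable abbrev liftOver [i.Full] {o : CompOp X (restr i)} {x : (restr i).Params o.oper} {c : A.Op}
    (g : E.oper.obj c ⟶ o.fam.obj x) : HFib.Over (E.liftHom g).oper (restrPt i (A.tgt.obj c)) x :=
  ⟨i.preimage (inv (E.tgt.hom.app c) ≫ X.tgt.map g ≫ o.typ x), by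
    change _ ≫ x.edge = 𝟙 _ ≫ inv (𝟙 _) ≫ _ ≫ x.edge
    simp⟩

theorem liftHom_app [i.Full] {o : CompOp X (restr i)} {x : (restr i).Params o.oper} {c : A.Op}
    (g : E.oper.obj c ⟶ o.fam.obj x) : (E.liftHom g).app (E.liftOver g) = g :=
  restrHom_app (o := E.operRestrict.obj c) (x := restrPt i _) g _
    ((E.lift_typ g).trans (congrArg (· ≫ i.map _)
      (constOp_typ (P := X) (i := i) (E.oper.obj c) (A.tgt.obj c) (E.tgt.hom.app c)).symm)) _

instance [i.Full] : E.operRestrict.EssSurj where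
  mem_essImage o := by
    obtain ⟨c, ⟨g⟩⟩ := E.oper_mem (o.typ (restrPt i o.oper))
    exact ⟨c, ⟨asIso (E.liftHom g.hom)⟩⟩

/-- The induced functor to the parameters of the restriction. -/
noncomputable abbrev pmRestrict : A.Pm ⥤ CompPm X (restr i) where
  obj p := ⟨E.operRestrict.obj (A.proj.obj p), restrPt i (A.tgt.obj (A.proj.obj p)),
    ⟨E.pm.obj p, E.proj.hom.app p⟩⟩
  map k :=
    { oper := E.operRestrict.map (A.proj.map k)
      arg := ptOver _
      par := ⟨E.pm.map k, E.proj.hom.naturality k⟩ }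
  map_id p := CompPm.hom_ext ((congrArg E.operRestrict.map (A.proj.map_id p)).trans
    (E.operRestrict.map_id _)) ((congrArg A.tgt.map (A.proj.map_id p)).trans (A.tgt.map_id _))
    (E.pm.map_id p)
  map_comp k l := CompPm.hom_ext ((congrArg E.operRestrict.map (A.proj.map_comp k l)).trans
    (E.operRestrict.map_comp _ _)) ((congrArg A.tgt.map (A.proj.map_comp k l)).trans
    (A.tgt.map_comp _ _)) (E.pm.map_comp k l)

instance : E.pmRestrict.Faithful where
  map_injective h := E.pm.map_injective (congrArg (fun t => t.par.pt) h :)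

instance [i.Faithful] : E.pmRestrict.Full where
  map_surjective {p p'} f := by
    have hf := f.par.path
    have hk := E.proj.hom.naturality (E.pm.preimage f.par.pt)
    have e : E.operRestrict.map (A.proj.map (E.pm.preimage f.par.pt)) = f.oper := by
      refine E.operRestrict_map_eq _ _ ?_
      refine (cancel_epi (E.proj.hom.app p)).1 (hk.symm.trans ?_)
      refine (congrArg (X.proj.map · ≫ _) (E.pm.map_preimage f.par.pt)).trans (hf.trans ?_)
      exact congrArg (_ ≫ ·) (congrArg _ (HFib.id_over_eq _ _))
    refine ⟨E.pm.preimage f.par.pt, CompPm.hom_ext e ?_ (E.pm.map_preimage _)⟩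
    have h := f.arg.path
    exact (congrArg CompOp.Hom.oper e).trans
      ((Category.id_comp _).symm.trans (h.symm.trans (Category.comp_id _)))

instance [i.Full] : E.pmRestrict.EssSurj where
  mem_essImage z := by
    obtain ⟨c, ⟨g⟩⟩ := E.oper_mem (z.oper.typ z.arg)
    obtain ⟨p, ⟨l⟩⟩ := E.pm_mem (z.par.path ≫ g.inv)
    -- The operation is replaced by that of `p`, so that `l.hom` itself becomes the second
    -- coordinate of a morphism over it.
    let g' : E.oper.obj (A.proj.obj p) ⟶ z.oper.fam.obj z.arg :=
      inv (E.proj.hom.app p) ≫ X.proj.map l.hom ≫ z.par.path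
    let k : E.pmRestrict.obj p ⟶ z :=
      { oper := E.liftHom g'
        arg := E.liftOver g'
        par := ⟨l.hom, by
          refine Eq.trans ?_ (congrArg (E.proj.hom.app p ≫ ·) (E.liftHom_app g').symm)
          simp [g']⟩ }
    exact ⟨p, ⟨asIso k⟩⟩

instance [i.Full] [i.Faithful] : E.operRestrict.IsEquivalence where

instance [i.Full] [i.Faithful] : E.pmRestrict.IsEquivalence where

/-- An embedding over `i` identifies its source with a restriction. -/
noncomputable abbrev restrict [i.Full] [i.Faithful] : Eqv A (X.comp (restr i)) where
  oper := E.operRestrict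
  pm := E.pmRestrict
  src := NatIso.ofComponents (fun p => E.src.app p) fun k => E.src.hom.naturality k
  proj := Iso.refl _
  tgt := Iso.refl _

variable {A' : GPoly I J} {X' : GPoly I M}

/-- A square of polynomials that commutes up to isomorphism, with embeddings and equivalences as
sides. -/
structure Square (E : Embedding i A X) (E' : Embedding i A' X') (a : Eqv A A') (x : Eqv X X') where
  oper : E.oper ⋙ x.oper ⟶ a.oper ⋙ E'.oper
  pm : E.pm ⋙ x.pm ⟶ a.pm ⋙ E'.pm
  src (p : A.Pm) : X'.src.map (pm.app p) ≫ E'.src.hom.app (a.pm.obj p) ≫ a.src.hom.app p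
    = x.src.hom.app (E.pm.obj p) ≫ E.src.hom.app p
  proj (p : A.Pm) : X'.proj.map (pm.app p) ≫ E'.proj.hom.app (a.pm.obj p) ≫
      E'.oper.map (a.proj.hom.app p)
    = (x.proj.hom.app (E.pm.obj p) ≫ x.oper.map (E.proj.hom.app p)) ≫ oper.app (A.proj.obj p)
  tgt (c : A.Op) : X'.tgt.map (oper.app c) ≫ E'.tgt.hom.app (a.oper.obj c) ≫
    i.map (a.tgt.hom.app c) = x.tgt.hom.app (E.oper.obj c) ≫ E.tgt.hom.app c

variable {E} {E' : Embedding i A' X'} {a : Eqv A A'} {x : Eqv X X'} (S : Square E E' a x)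

/-- The comparison of operations for a square. -/
noncomputable abbrev Square.restrictOperHom (c : A.Op) :
    (x.operRight (restr i)).obj (E.operRestrict.obj c) ⟶ E'.operRestrict.obj (a.oper.obj c) where
  oper := inv (a.tgt.hom.app c)
  app _ := S.oper.app c
  naturality {_ _ _ _} g f h := (congrArg (· ≫ S.oper.app c ≫ 𝟙 _) (x.oper.map_id _)).trans
    ((Category.id_comp _).trans (Category.comp_id _))
  typ {y y'} f := by
    have hf := f.path
    change f.pt ≫ y'.edge = y.edge ≫ inv (a.tgt.hom.app c) at hf
    have ht := S.tgt c
    change X'.tgt.map (S.oper.app c) ≫ E'.tgt.hom.app (a.oper.obj c) ≫ i.map (inv y'.edge)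
      = (x.tgt.hom.app (E.oper.obj c) ≫ E.tgt.hom.app c ≫ i.map (inv y.edge)) ≫ i.map f.pt
    have e : inv y.edge ≫ f.pt = inv (a.tgt.hom.app c) ≫ inv y'.edge := by
      rw [IsIso.inv_comp_eq, ← Category.assoc, IsIso.eq_comp_inv, hf]
    have e' := congrArg (fun t => t ≫ i.map (inv y.edge ≫ f.pt)) ht
    rw [e] at e'
    simp only [Category.assoc, ← i.map_comp, IsIso.hom_inv_id_assoc] at e' ⊢
    rw [e, ← e']

theorem Square.restrictOperHom_naturality {c c' : A.Op} (k : c ⟶ c') :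
    (x.operRight (restr i)).map (E.operRestrict.map k) ≫ S.restrictOperHom c'
      = S.restrictOperHom c ≫ E'.operRestrict.map (a.oper.map k) := by
  refine CompOp.hom_ext ?_ fun f => S.oper.naturality k
  have h := a.tgt.hom.naturality k
  change A.tgt.map k ≫ inv (a.tgt.hom.app c') = inv (a.tgt.hom.app c) ≫ A'.tgt.map (a.oper.map k)
  rw [IsIso.comp_inv_eq, Category.assoc, IsIso.eq_inv_comp]
  exact h.symm

/-- Restriction is natural in squares. -/
noncomputable def Square.restrictHom [i.Full] [i.Faithful] :
    E.restrict.trans (x.whiskerRight (restr i)) ⟶ a.trans E'.restrict where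
  oper :=
    { app := S.restrictOperHom
      naturality := fun _ _ k => S.restrictOperHom_naturality k }
  pm :=
    { app := fun p =>
        -- The square ends at the image of the operation of `p`, whereas the parameter `a.pm.obj p`
        -- lies over its own operation; the inverse projection filler of `a` joins the two.
        { oper := S.restrictOperHom (A.proj.obj p) ≫ E'.operRestrict.map (inv (a.proj.hom.app p))
          arg := ptOver _
          par := ⟨S.pm.app p, by
            have h := S.proj p
            change X'.proj.map (S.pm.app p) ≫ E'.proj.hom.app (a.pm.obj p)
              = (x.proj.hom.app (E.pm.obj p) ≫ x.oper.map (E.proj.hom.app p)) ≫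
                S.oper.app (A.proj.obj p) ≫ E'.oper.map (inv (a.proj.hom.app p))
            refine Eq.trans ?_ (Category.assoc _ _ _)
            rw [← h, Category.assoc, Category.assoc, ← E'.oper.map_comp, IsIso.hom_inv_id,
              E'.oper.map_id]
            exact congrArg (_ ≫ ·) (Category.comp_id _).symm⟩ }
      naturality := fun p p' k => by
        have e : (x.operRight (restr i)).map (E.operRestrict.map (A.proj.map k)) ≫
            S.restrictOperHom (A.proj.obj p') ≫ E'.operRestrict.map (inv (a.proj.hom.app p'))
            = (S.restrictOperHom (A.proj.obj p) ≫ E'.operRestrict.map (inv (a.proj.hom.app p))) ≫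
              E'.operRestrict.map (A'.proj.map (a.pm.map k)) := by
          have h := a.proj.hom.naturality k
          dsimp only [Functor.comp_map] at h
          rw [← Category.assoc, S.restrictOperHom_naturality, Category.assoc, Category.assoc,
            ← Functor.map_comp, ← Functor.map_comp]
          congr 2
          rw [IsIso.comp_inv_eq, Category.assoc, IsIso.eq_inv_comp, h]
        exact CompPm.hom_ext e (congrArg CompOp.Hom.oper e) (S.pm.naturality k) }
  src p := S.src p
  proj p := by
    change (S.restrictOperHom (A.proj.obj p) ≫ E'.operRestrict.map (inv (a.proj.hom.app p))) ≫
      𝟙 _ ≫ E'.operRestrict.map (a.proj.hom.app p)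
        = (𝟙 _ ≫ (x.operRight (restr i)).map (𝟙 _)) ≫ S.restrictOperHom (A.proj.obj p)
    rw [CategoryTheory.Functor.map_id, Category.id_comp, Category.id_comp, Category.id_comp,
      Category.assoc, ← Functor.map_comp, IsIso.inv_hom_id, CategoryTheory.Functor.map_id]
    exact Category.comp_id _
  tgt c := by
    change inv (a.tgt.hom.app c) ≫ 𝟙 _ ≫ a.tgt.hom.app c = 𝟙 _ ≫ 𝟙 _
    simp

end Embedding

end GPoly

/-! ### Restrictions and summands of a pairing as embeddings. -/

namespace GPoly

open CompOp Eqv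

section Sum

variable (J K : Type u) [Groupoid.{u} J] [Groupoid.{u} K]

instance : (Sum.inl_ J K).Full where
  map_surjective f := ⟨f.down, rfl⟩

instance : (Sum.inl_ J K).Faithful where
  map_injective h := congrArg ULift.down h

instance : (Sum.inr_ J K).Full where
  map_surjective f := ⟨f.down, rfl⟩

instance : (Sum.inr_ J K).Faithful where
  map_injective h := congrArg ULift.down h

theorem complementary_inl_inr : (Sum.inl_ J K).Complementary (Sum.inr_ J K) where
  full := inferInstance
  full' := inferInstance
  cover
    | .inl j => .inl ⟨j, ⟨𝟙 _⟩⟩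
    | .inr k => .inr ⟨k, ⟨𝟙 _⟩⟩
  disjoint _ _ f := CategoryTheory.hom_inl_inr_false _ _ f

end Sum

variable {I J K M : Type u} [Groupoid.{u} I] [Groupoid.{u} J] [Groupoid.{u} K] [Groupoid.{u} M]

section

variable (P : GPoly I M) {i : J ⥤ M}

/-- By `typ` the component at the canonical parameter determines the image of the `J`-part under
`i`. -/
instance [i.Faithful] : (restrOper P i).Faithful where
  map_injective {o o'} k l h := by
    refine restr_hom_ext (i.map_injective ?_) (ptOver k) (ptOver l) h
    refine (cancel_epi (o.typ (restrPt i o.oper))).1 ?_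
    exact (k.typ (ptOver k)).symm.trans ((congrArg (P.tgt.map · ≫ _) h).trans (l.typ (ptOver l)))

instance [i.Full] : (restrOper P i).Full where
  map_surjective {o o'} g := by
    obtain ⟨κ, hκ⟩ := i.map_surjective (inv (o.typ (restrPt i o.oper)) ≫ P.tgt.map g ≫
      o'.typ (restrPt i o'.oper))
    have h := ((IsIso.eq_inv_comp _).1 hκ).symm
    exact ⟨restrHom g κ h, restrHom_app g κ h (ptOver (restrHom g κ h))⟩

variable (i) in
/-- The parameter of `P` underlying a parameter of `P.comp (restr i)`. -/
noncomputable abbrev restrPm : CompPm P (restr i) ⥤ P.Pm where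
  obj z := z.par.pt
  map f := f.par.pt

/-- The operation of a parameter of the restriction. -/
noncomputable abbrev restrProj (z : CompPm P (restr i)) :
    P.proj.obj z.par.pt ⟶ (restrOper P i).obj z.oper :=
  z.par.path ≫ z.oper.fam.map (HFib.homOfId z.arg (restrPt i z.oper.oper))

theorem restrProj_naturality {z z' : CompPm P (restr i)} (f : z ⟶ z') :
    P.proj.map f.par.pt ≫ restrProj P z' = restrProj P z ≫ (restrOper P i).map f.oper := by
  have h := f.par.path
  rw [reassoc_of% h]
  refine Eq.trans ?_ (Category.assoc _ _ _).symm
  refine congrArg (z.par.path ≫ ·) ?_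
  refine (f.oper.app_map _ _).trans (Eq.trans ?_ (f.oper.map_app _ _).symm)
  exact congrArg _ (HFib.id_over_eq _ _)

instance [i.Faithful] : (restrPm P i).Faithful where
  map_injective {z z'} f g h := by
    have e : f.oper = g.oper := (restrOper P i).map_injective
      ((cancel_epi (restrProj P z)).1 ((restrProj_naturality P f).symm.trans
        ((congrArg (P.proj.map · ≫ _) h).trans (restrProj_naturality P g))))
    refine CompPm.hom_ext e ?_ h
    exact (cancel_mono (HFib.edge (J := J) z'.arg)).1 (f.arg.path.trans
      ((congrArg (z.arg.path ≫ ·) (congrArg CompOp.Hom.oper e)).trans g.arg.path.symm))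

instance [i.Full] : (restrPm P i).Full where
  map_surjective {z z'} g := by
    obtain ⟨k, hk⟩ := (restrOper P i).map_surjective
      (inv (restrProj P z) ≫ P.proj.map g ≫ restrProj P z')
    have hk' := (IsIso.eq_inv_comp _).1 hk
    refine ⟨⟨k, ⟨(HFib.edge (J := J) z.arg ≫ k.oper) ≫ inv (HFib.edge (J := J) z'.arg), ?_⟩,
      ⟨g, ?_⟩⟩, rfl⟩
    · exact (Category.assoc _ _ _).trans ((congrArg (_ ≫ ·) (IsIso.inv_hom_id _)).trans
        (Category.comp_id _))
    · refine (cancel_mono (z'.oper.fam.map (HFib.homOfId z'.arg (restrPt i z'.oper.oper)))).1 ?_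
      refine (Category.assoc _ _ _).trans (hk'.symm.trans ?_)
      refine (Category.assoc _ _ _).trans (Eq.trans ?_ (Category.assoc _ _ _).symm)
      refine congrArg (z.par.path ≫ ·) ?_
      refine (k.map_app _ _).trans (Eq.trans ?_ (k.app_map _ _).symm)
      exact congrArg _ (HFib.id_over_eq _ _)

variable (i) in
/-- The restriction of a polynomial is a part of it. -/
noncomputable abbrev restrEmbedding [i.Full] [i.Faithful] : Embedding i (P.comp (restr i)) P where
  oper := restrOper P i
  pm := restrPm P i
  src := Iso.refl _
  proj := NatIso.ofComponents (fun z => asIso (restrProj P z)) fun f => restrProj_naturality P f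
  tgt := NatIso.ofComponents (fun o => asIso (o.typ (restrPt i o.oper)))
    fun f => f.typ (ptOver f)
  oper_mem {c j} γ := ⟨constOp c j γ, ⟨Iso.refl c⟩⟩
  pm_mem {p o} γ := ⟨⟨o, restrPt i _, ⟨p, γ⟩⟩, ⟨Iso.refl p⟩⟩

end

section

variable (A : GPoly I J) (B : GPoly I K)

/-- The first summand of a pairing. -/
noncomputable abbrev inlEmbedding : Embedding (Sum.inl_ J K) A (pairing A B) where
  oper := Sum.inl_ _ _
  pm := Sum.inl_ _ _
  src := NatIso.ofComponents (fun _ => Iso.refl _) fun _ =>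
    (Category.comp_id _).trans (Category.id_comp _).symm
  proj := NatIso.ofComponents (fun _ => Iso.refl _) fun _ =>
    (Category.comp_id _).trans (Category.id_comp _).symm
  tgt := NatIso.ofComponents (fun _ => Iso.refl _) fun _ =>
    (Category.comp_id _).trans (Category.id_comp _).symm
  oper_mem {c _} γ := match c, γ with
    | .inl c, _ => ⟨c, ⟨Iso.refl _⟩⟩
    | .inr _, γ => (CategoryTheory.hom_inr_inl_false _ _ γ).elim
  pm_mem {p _} γ := match p, γ with
    | .inl p, _ => ⟨p, ⟨Iso.refl _⟩⟩
    | .inr _, γ => (CategoryTheory.hom_inr_inl_false _ _ γ).elim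

/-- The second summand of a pairing. -/
noncomputable abbrev inrEmbedding : Embedding (Sum.inr_ J K) B (pairing A B) where
  oper := Sum.inr_ _ _
  pm := Sum.inr_ _ _
  src := NatIso.ofComponents (fun _ => Iso.refl _) fun _ =>
    (Category.comp_id _).trans (Category.id_comp _).symm
  proj := NatIso.ofComponents (fun _ => Iso.refl _) fun _ =>
    (Category.comp_id _).trans (Category.id_comp _).symm
  tgt := NatIso.ofComponents (fun _ => Iso.refl _) fun _ =>
    (Category.comp_id _).trans (Category.id_comp _).symm
  oper_mem {c _} γ := match c, γ with
    | .inr c, _ => ⟨c, ⟨Iso.refl _⟩⟩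
    | .inl _, γ => (CategoryTheory.hom_inl_inr_false _ _ γ).elim
  pm_mem {p _} γ := match p, γ with
    | .inr p, _ => ⟨p, ⟨Iso.refl _⟩⟩
    | .inl _, γ => (CategoryTheory.hom_inl_inr_false _ _ γ).elim

end

end GPoly

/-! ### Gluing a polynomial from its parts over two summands. -/

namespace GPoly

open CompOp Eqv

section

variable {A B C : Type u} [Groupoid.{u} A] [Groupoid.{u} B] [Groupoid.{u} C] {F : A ⥤ C} {G : B ⥤ C}

theorem isEquivalence_sum' [F.Full] [F.Faithful] [G.Full] [G.Faithful]
    (disj : ∀ a b, (F.obj a ⟶ G.obj b) → False) (cover : ∀ c, F.essImage c ∨ G.essImage c) :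
    (F.sum' G).IsEquivalence where
  faithful :=
    ⟨fun {x y} f g h => match x, y, f, g, h with
      | .inl _, .inl _, _, _, h => congrArg ULift.up (F.map_injective h)
      | .inr _, .inr _, _, _, h => congrArg ULift.up (G.map_injective h)
      | .inl _, .inr _, f, _, _ => (hom_inl_inr_false _ _ f).elim
      | .inr _, .inl _, f, _, _ => (hom_inr_inl_false _ _ f).elim⟩
  full :=
    ⟨fun {x y} g => match x, y, g with
      | .inl _, .inl _, g => ⟨⟨F.preimage g⟩, F.map_preimage g⟩
      | .inr _, .inr _, g => ⟨⟨G.preimage g⟩, G.map_preimage g⟩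
      | .inl _, .inr _, g => (disj _ _ g).elim
      | .inr b, .inl a, g => (disj a b (inv (show G.obj b ⟶ F.obj a from g))).elim⟩
  essSurj :=
    ⟨fun c => (cover c).elim (fun ⟨a, i⟩ => ⟨.inl a, i⟩) fun ⟨b, i⟩ => ⟨.inr b, i⟩⟩

end

variable {I J K M : Type u} [Groupoid.{u} I] [Groupoid.{u} J] [Groupoid.{u} K] [Groupoid.{u} M]

namespace Embedding

section

variable {A : GPoly I J} {B : GPoly I K} {P : GPoly I (J ⊕ K)}
  (E : Embedding (Sum.inl_ J K) A P) (F : Embedding (Sum.inr_ J K) B P)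

/-- The target functor would send such a morphism to one between different summands. -/
theorem oper_disjoint (a : A.Op) (b : B.Op) (f : E.oper.obj a ⟶ F.oper.obj b) : False :=
  hom_inl_inr_false _ _ (show Sum.inl (A.tgt.obj a) ⟶ Sum.inr (B.tgt.obj b) from
    E.tgt.inv.app a ≫ P.tgt.map f ≫ F.tgt.hom.app b)

theorem pm_disjoint (a : A.Pm) (b : B.Pm) (f : E.pm.obj a ⟶ F.pm.obj b) : False :=
  oper_disjoint E F _ _ (inv (E.proj.hom.app a) ≫ P.proj.map f ≫ F.proj.hom.app b)

theorem oper_cover (c : P.Op) : E.oper.essImage c ∨ F.oper.essImage c :=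
  ((complementary_inl_inr J K).cover (P.tgt.obj c)).imp (fun ⟨_, ⟨γ⟩⟩ => E.oper_mem γ)
    fun ⟨_, ⟨γ⟩⟩ => F.oper_mem γ

/-- A parameter belongs to the part that contains its operation. -/
theorem pm_cover (p : P.Pm) : E.pm.essImage p ∨ F.pm.essImage p :=
  (oper_cover E F (P.proj.obj p)).imp (fun ⟨_, ⟨i⟩⟩ => E.pm_mem i.inv) fun ⟨_, ⟨i⟩⟩ => F.pm_mem i.inv

/-- A polynomial is the pairing of two complementary parts. -/
noncomputable abbrev glue : Eqv (pairing A B) P where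
  oper := E.oper.sum' F.oper
  pm := E.pm.sum' F.pm
  oper_isEquivalence := isEquivalence_sum' (oper_disjoint E F) (oper_cover E F)
  pm_isEquivalence := isEquivalence_sum' (pm_disjoint E F) (pm_cover E F)
  src := Functor.sumIsoExt E.src F.src
  proj := Functor.sumIsoExt E.proj F.proj
  tgt := Functor.sumIsoExt E.tgt F.tgt

/-- The first summand of a glued polynomial. -/
noncomputable abbrev glueInl : Square (inlEmbedding A B) E (Eqv.refl A) (glue E F) where
  oper :=
    { app := fun c => 𝟙 (E.oper.obj c)
      naturality := fun _ _ _ => (Category.comp_id _).trans (Category.id_comp _).symm }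
  pm :=
    { app := fun p => 𝟙 (E.pm.obj p)
      naturality := fun _ _ _ => (Category.comp_id _).trans (Category.id_comp _).symm }
  src p := by
    change P.src.map (𝟙 _) ≫ E.src.hom.app p ≫ 𝟙 _ = E.src.hom.app p ≫ 𝟙 _
    rw [P.src.map_id]
    exact Category.id_comp _
  proj p := by
    change P.proj.map (𝟙 _) ≫ E.proj.hom.app p ≫ E.oper.map (𝟙 _)
      = (E.proj.hom.app p ≫ E.oper.map (𝟙 _)) ≫ 𝟙 _
    rw [P.proj.map_id]
    exact (Category.id_comp _).trans (Category.comp_id _).symm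
  tgt c := by
    change P.tgt.map (𝟙 _) ≫ E.tgt.hom.app c ≫ (Sum.inl_ J K).map (𝟙 _) = E.tgt.hom.app c ≫ 𝟙 _
    rw [P.tgt.map_id, CategoryTheory.Functor.map_id]
    exact Category.id_comp _

/-- The second summand of a glued polynomial. -/
noncomputable abbrev glueInr : Square (inrEmbedding A B) F (Eqv.refl B) (glue E F) where
  oper :=
    { app := fun c => 𝟙 (F.oper.obj c)
      naturality := fun _ _ _ => (Category.comp_id _).trans (Category.id_comp _).symm }
  pm :=
    { app := fun p => 𝟙 (F.pm.obj p)
      naturality := fun _ _ _ => (Category.comp_id _).trans (Category.id_comp _).symm }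
  src p := by
    change P.src.map (𝟙 _) ≫ F.src.hom.app p ≫ 𝟙 _ = F.src.hom.app p ≫ 𝟙 _
    rw [P.src.map_id]
    exact Category.id_comp _
  proj p := by
    change P.proj.map (𝟙 _) ≫ F.proj.hom.app p ≫ F.oper.map (𝟙 _)
      = (F.proj.hom.app p ≫ F.oper.map (𝟙 _)) ≫ 𝟙 _
    rw [P.proj.map_id]
    exact (Category.id_comp _).trans (Category.comp_id _).symm
  tgt c := by
    change P.tgt.map (𝟙 _) ≫ F.tgt.hom.app c ≫ (Sum.inr_ J K).map (𝟙 _) = F.tgt.hom.app c ≫ 𝟙 _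
    rw [P.tgt.map_id, CategoryTheory.Functor.map_id]
    exact Category.id_comp _

end

section

variable {i : J ⥤ M} {A A' : GPoly I J} {X : GPoly I M} (E : Embedding i A' X) (a : Eqv A A')

/-- An equivalence followed by an embedding. -/
noncomputable abbrev precomp : Embedding i A X where
  oper := a.oper ⋙ E.oper
  pm := a.pm ⋙ E.pm
  src := Functor.isoWhiskerLeft a.pm E.src ≪≫ a.src
  proj := Functor.isoWhiskerLeft a.pm E.proj ≪≫ Functor.isoWhiskerRight a.proj E.oper
  tgt := Functor.isoWhiskerLeft a.oper E.tgt ≪≫ Functor.isoWhiskerRight a.tgt i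
  oper_mem γ := by
    obtain ⟨c, ⟨g⟩⟩ := E.oper_mem γ
    exact ⟨a.oper.objPreimage c, ⟨E.oper.mapIso (a.oper.objObjPreimageIso c) ≪≫ g⟩⟩
  pm_mem γ := by
    obtain ⟨c, ⟨g⟩⟩ := E.pm_mem γ
    exact ⟨a.pm.objPreimage c, ⟨E.pm.mapIso (a.pm.objObjPreimageIso c) ≪≫ g⟩⟩

/-- An equivalence followed by an embedding, as a square. -/
noncomputable abbrev precompSquare : Square (E.precomp a) E a (Eqv.refl X) where
  oper := 𝟙 _
  pm := 𝟙 _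
  src p := by simp
  proj p := by simp
  tgt c := by simp

end

end Embedding

theorem restrict_cell {i : J ⥤ M} [i.Full] [i.Faithful] {A A' : GPoly I J} {X X' : GPoly I M}
    {E : Embedding i A X} {E' : Embedding i A' X'} {a : Eqv A A'} {x : Eqv X X'}
    (S : Embedding.Square E E' a x) :
    (show A ⟶ X.comp (restr i) from E.restrict.cell) ≫ Cell.whiskerRight (show X ⟶ X' from x.cell) (restr i)
      = (show A ⟶ A' from a.cell) ≫ (show A' ⟶ X'.comp (restr i) from E'.restrict.cell) :=
  Eqv.cell_eq S.restrictHom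

end GPoly

/-! ### The terminal object: polynomials into the empty groupoid. -/

namespace GPoly

open CompOp Eqv

variable {I J K M : Type u} [Groupoid.{u} I] [Groupoid.{u} J] [Groupoid.{u} K] [Groupoid.{u} M]

section Terminal

/-- The functor between two empty groupoids. -/
abbrev emptyFunctor (C D : Type u) [Groupoid.{u} C] [Groupoid.{u} D] [IsEmpty C] : C ⥤ D where
  obj := isEmptyElim
  map {x} := isEmptyElim x
  map_id x := isEmptyElim x
  map_comp {x} := isEmptyElim x

/-- Functors from an empty groupoid are isomorphic. -/
abbrev emptyIso {C D : Type u} [Groupoid.{u} C] [Groupoid.{u} D] [IsEmpty C] (F G : C ⥤ D) : F ≅ G :=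
  NatIso.ofComponents (fun x => isEmptyElim x) fun {x} => isEmptyElim x

theorem isEquivalence_of_isEmpty {C D : Type u} [Groupoid.{u} C] [Groupoid.{u} D] [IsEmpty C]
    [IsEmpty D] (F : C ⥤ D) : F.IsEquivalence where
  faithful := ⟨fun {x _ _ _} _ => (IsEmpty.false x).elim⟩
  full := ⟨fun {x} => isEmptyElim x⟩
  essSurj := ⟨fun y => isEmptyElim y⟩

theorem isEmpty_op (P : GPoly I (Discrete PEmpty.{u + 1})) : IsEmpty P.Op :=
  ⟨fun c => (P.tgt.obj c).as.elim⟩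

theorem isEmpty_pm (P : GPoly I (Discrete PEmpty.{u + 1})) : IsEmpty P.Pm :=
  ⟨fun p => (P.tgt.obj (P.proj.obj p)).as.elim⟩

theorem nonempty_eqv_of_terminal (P P' : GPoly I (Discrete PEmpty.{u + 1})) : Nonempty (Eqv P P') := by
  have := isEmpty_op P
  have := isEmpty_op P'
  have := isEmpty_pm P
  have := isEmpty_pm P'
  exact ⟨{
    oper := emptyFunctor _ _
    pm := emptyFunctor _ _
    oper_isEquivalence := isEquivalence_of_isEmpty _
    pm_isEquivalence := isEquivalence_of_isEmpty _
    src := emptyIso _ _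
    proj := emptyIso _ _
    tgt := emptyIso _ _ }⟩

/-- Operations and parameters both map to the empty groupoid, so all components and all conditions
are vacuous. -/
theorem nonempty_unique_hom_of_terminal {P P' : GPoly I (Discrete PEmpty.{u + 1})} (φ ψ : Eqv P P') :
    Nonempty (Unique (φ ⟶ ψ)) := by
  have := isEmpty_op P
  have := isEmpty_pm P
  refine ⟨⟨⟨⟨(emptyIso _ _).hom, (emptyIso _ _).hom, isEmptyElim, isEmptyElim, isEmptyElim⟩⟩,
    fun m => Eqv.hom_ext ?_ ?_⟩⟩
  · ext c
    exact isEmptyElim c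
  · ext c
    exact isEmptyElim c

theorem eqv_terminal (P P' : GPoly I (Discrete PEmpty.{u + 1})) :
    Nonempty (Eqv P P' ≌ Discrete PUnit.{1}) :=
  (equiv_punit_iff_unique _).2 ⟨nonempty_eqv_of_terminal P P', nonempty_unique_hom_of_terminal⟩

theorem nonempty_unique_cell_of_terminal (P P' : GPoly I (Discrete PEmpty.{u + 1})) :
    Nonempty (Unique (P ⟶ P')) := by
  obtain ⟨φ⟩ := nonempty_eqv_of_terminal P P'
  refine ⟨⟨⟨φ.cell⟩, ?_⟩⟩
  rintro ⟨ψ⟩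
  exact Eqv.cell_eq (nonempty_unique_hom_of_terminal ψ φ).some.default

end Terminal

/-! ### The product: gluing 2-cells along the two projections. -/

section Product

theorem comp_whiskerRight_inv_comp {P P' X : GPoly I M} {A : GPoly I J} {R : GPoly M J}
    {ε : A ⟶ X.comp R} {e : A ⟶ P.comp R} {e' : A ⟶ P'.comp R} {δ : X ⟶ P} {g : X ⟶ P'}
    (h : ε ≫ Cell.whiskerRight δ R = e) (h' : ε ≫ Cell.whiskerRight g R = e') :
    e ≫ Cell.whiskerRight (inv δ ≫ g) R = e' := by
  rw [← h, ← h', Category.assoc, ← coherence.comp_whiskerRight, IsIso.hom_inv_id_assoc]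

/-- `P` is the pairing of its two restrictions. The same pairing maps to `P'` by way of `a` and `b`
followed by the parts of `P'`, and `f` is the composite through the pairing. Naturality of
`restrict` in squares computes its restrictions. -/
theorem exists_cell_square {P P' : GPoly I (J ⊕ K)}
    (a : P.comp (restr (Sum.inl_ J K)) ⟶ P'.comp (restr (Sum.inl_ J K)))
    (b : P.comp (restr (Sum.inr_ J K)) ⟶ P'.comp (restr (Sum.inr_ J K))) :
    ∃ f : P ⟶ P',
      (show _ ⟶ P.comp (restr (Sum.inl_ J K)) from (restrEmbedding P (Sum.inl_ J K)).restrict.cell) ≫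
          Cell.whiskerRight f (restr (Sum.inl_ J K))
        = a ≫ (show _ ⟶ P'.comp (restr (Sum.inl_ J K)) from
          (restrEmbedding P' (Sum.inl_ J K)).restrict.cell) ∧
      (show _ ⟶ P.comp (restr (Sum.inr_ J K)) from (restrEmbedding P (Sum.inr_ J K)).restrict.cell) ≫
          Cell.whiskerRight f (restr (Sum.inr_ J K))
        = b ≫ (show _ ⟶ P'.comp (restr (Sum.inr_ J K)) from
          (restrEmbedding P' (Sum.inr_ J K)).restrict.cell) := by
  obtain ⟨a⟩ := a
  obtain ⟨b⟩ := b
  let E := restrEmbedding P (Sum.inl_ J K)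
  let F := restrEmbedding P (Sum.inr_ J K)
  let E' := restrEmbedding P' (Sum.inl_ J K)
  let F' := restrEmbedding P' (Sum.inr_ J K)
  let δ : pairing _ _ ⟶ P := (Embedding.glue E F).cell
  let g : pairing _ _ ⟶ P' := (Embedding.glue (E'.precomp a) (F'.precomp b)).cell
  have h₁ := restrict_cell (Embedding.glueInl E F)
  have h₂ := restrict_cell (Embedding.glueInl (E'.precomp a) (F'.precomp b))
  have h₃ := restrict_cell (E'.precompSquare a)
  have k₁ := restrict_cell (Embedding.glueInr E F)
  have k₂ := restrict_cell (Embedding.glueInr (E'.precomp a) (F'.precomp b))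
  have k₃ := restrict_cell (F'.precompSquare b)
  refine ⟨inv δ ≫ g, ?_, ?_⟩
  · refine (comp_whiskerRight_inv_comp (h₁.trans (Category.id_comp _))
      (h₂.trans (Category.id_comp _))).trans (Eq.trans ?_ h₃)
    exact (Category.comp_id _).symm.trans (congrArg (_ ≫ ·) (coherence.id_whiskerRight _ _).symm)
  · refine (comp_whiskerRight_inv_comp (k₁.trans (Category.id_comp _))
      (k₂.trans (Category.id_comp _))).trans (Eq.trans ?_ k₃)
    exact (Category.comp_id _).symm.trans (congrArg (_ ≫ ·) (coherence.id_whiskerRight _ _).symm)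

/-- Restricting the embedding of the restriction of `P` gives an automorphism of that restriction.
Instead of proving that it is the identity, `a` and `b` are conjugated by it beforehand. -/
theorem exists_cell {P P' : GPoly I (J ⊕ K)}
    (a : P.comp (restr (Sum.inl_ J K)) ⟶ P'.comp (restr (Sum.inl_ J K)))
    (b : P.comp (restr (Sum.inr_ J K)) ⟶ P'.comp (restr (Sum.inr_ J K))) :
    ∃ f : P ⟶ P', Cell.whiskerRight f (restr (Sum.inl_ J K)) = a ∧
      Cell.whiskerRight f (restr (Sum.inr_ J K)) = b := by
  let e (P : GPoly I (J ⊕ K)) : _ ⟶ P.comp (restr (Sum.inl_ J K)) :=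
    (restrEmbedding P (Sum.inl_ J K)).restrict.cell
  let e' (P : GPoly I (J ⊕ K)) : _ ⟶ P.comp (restr (Sum.inr_ J K)) :=
    (restrEmbedding P (Sum.inr_ J K)).restrict.cell
  obtain ⟨f, hf, hf'⟩ := exists_cell_square (e P ≫ a ≫ inv (e P')) (e' P ≫ b ≫ inv (e' P'))
  refine ⟨f, (cancel_epi (e P)).1 (hf.trans ?_), (cancel_epi (e' P)).1 (hf'.trans ?_)⟩
  · change (e P ≫ a ≫ inv (e P')) ≫ e P' = _
    simp
  · change (e' P ≫ b ≫ inv (e' P')) ≫ e' P' = _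
    simp

/-- Equal restrictions of classes mean isomorphic restrictions of representatives, and these
isomorphisms glue: injectivity on 2-cells is fullness one level down. -/
theorem cell_eq_of_whiskerRight_eq {P P' : GPoly I (J ⊕ K)} {f g : P ⟶ P'}
    (h : Cell.whiskerRight f (restr (Sum.inl_ J K)) = Cell.whiskerRight g (restr (Sum.inl_ J K)))
    (h' : Cell.whiskerRight f (restr (Sum.inr_ J K)) = Cell.whiskerRight g (restr (Sum.inr_ J K))) :
    f = g := by
  obtain ⟨φ⟩ := f
  obtain ⟨ψ⟩ := g
  obtain ⟨M⟩ : IsIsomorphic (φ.whiskerRight (restr (Sum.inl_ J K))) (ψ.whiskerRight _) :=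
    Quotient.exact h
  obtain ⟨N⟩ : IsIsomorphic (φ.whiskerRight (restr (Sum.inr_ J K))) (ψ.whiskerRight _) :=
    Quotient.exact h'
  obtain ⟨m, -, -⟩ := exists_whiskerRightHom_eq (complementary_inl_inr J K) M.hom N.hom
  exact Eqv.cell_eq m

theorem isEquivalence_whiskerRight (P P' : GPoly I (J ⊕ K)) :
    ((Eqv.whiskerRightFunctor P P' (restr (Sum.inl_ J K))).prod'
      (Eqv.whiskerRightFunctor P P' (restr (Sum.inr_ J K)))).IsEquivalence where
  faithful := ⟨fun {_ _} m n h => whiskerRightHom_injective (complementary_inl_inr J K) m n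
    (congrArg Prod.fst h :) (congrArg Prod.snd h :)⟩
  full := ⟨fun {_ _} f => by
    obtain ⟨m, h, h'⟩ := exists_whiskerRightHom_eq (complementary_inl_inr J K) f.1 f.2
    exact ⟨m, Prod.ext h h'⟩⟩
  essSurj := ⟨fun ⟨A, B⟩ => by
    obtain ⟨⟨φ⟩, h, h'⟩ := exists_cell (P := P) (P' := P') A.cell B.cell
    obtain ⟨M⟩ : IsIsomorphic (φ.whiskerRight _) A := Quotient.exact h
    obtain ⟨N⟩ : IsIsomorphic (φ.whiskerRight _) B := Quotient.exact h'
    exact ⟨φ, ⟨Iso.prod M N⟩⟩⟩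

/-- The first component of a pairing. -/
noncomputable abbrev pairingInl (A : GPoly I J) (B : GPoly I K) :
    A ⟶ (pairing A B).comp (restr (Sum.inl_ J K)) := (inlEmbedding A B).restrict.cell

/-- The second component of a pairing. -/
noncomputable abbrev pairingInr (A : GPoly I J) (B : GPoly I K) :
    B ⟶ (pairing A B).comp (restr (Sum.inr_ J K)) := (inrEmbedding A B).restrict.cell

end Product

end GPoly

/-! ### Equivalences between the polynomials of two equivalences of groupoids. -/

namespace GPoly

open Eqv

variable {I J : Type u} [Groupoid.{u} I] [Groupoid.{u} J] {f g : I ≌ J}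

/-- Compatibility with `src` determines the action on parameters, and compatibility with `proj` then
determines the action on operations. -/
theorem graph_hom_ext {φ ψ : Eqv (graphPoly f) (graphPoly g)} (m n : φ ⟶ ψ) : m = n := by
  have h : m.pm = n.pm := by
    ext x
    exact (cancel_mono (ψ.src.hom.app x)).1 ((m.src x).trans (n.src x).symm)
  refine Eqv.hom_ext ?_ h
  ext x
  refine (cancel_epi (φ.proj.hom.app x)).1 ((m.proj x).symm.trans (Eq.trans ?_ (n.proj x)))
  exact congrArg (fun t => NatTrans.app t x ≫ ψ.proj.hom.app x) h

/-- The natural isomorphism underlying an equivalence between the polynomials of two equivalences of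
groupoids. -/
noncomputable abbrev graphTransformation (φ : Eqv (graphPoly f) (graphPoly g)) :
    f.functor ⟶ g.functor where
  app x := φ.tgt.inv.app x ≫ g.functor.map (φ.proj.inv.app x ≫ φ.src.hom.app x)
  naturality x y k := by
    have h₁ := φ.tgt.inv.naturality k
    have h₂ := φ.proj.inv.naturality k
    have h₃ := φ.src.hom.naturality k
    change f.functor.map k ≫ φ.tgt.inv.app y = φ.tgt.inv.app x ≫ g.functor.map (φ.oper.map k) at h₁
    change φ.oper.map k ≫ φ.proj.inv.app y = φ.proj.inv.app x ≫ φ.pm.map k at h₂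
    change φ.pm.map k ≫ φ.src.hom.app y = φ.src.hom.app x ≫ k at h₃
    rw [reassoc_of% h₁, Category.assoc, ← g.functor.map_comp, ← g.functor.map_comp, reassoc_of% h₂, h₃,
      Category.assoc]

/-- The source filler identifies the action on parameters with the identity, and the projection
filler then does so for operations. Transported along these, the target filler is the inverse of the
natural isomorphism `graphTransformation φ`. -/
theorem exists_graphEqv (φ : Eqv (graphPoly f) (graphPoly g)) :
    ∃ θ : f ⟶ g, Nonempty (φ ⟶ (graphEqv θ : Eqv (graphPoly f) (graphPoly g))) := by
  refine ⟨Equivalence.mkHom (graphTransformation φ), ⟨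
    { oper :=
        { app := fun x => φ.proj.inv.app x ≫ φ.src.hom.app x
          naturality := fun x y k => ?_ }
      pm :=
        { app := fun x => φ.src.hom.app x
          naturality := fun x y k => φ.src.hom.naturality k }
      src := fun x => Category.comp_id _
      proj := fun x => ?_
      tgt := fun x => ?_ }⟩⟩
  · have h₂ := φ.proj.inv.naturality k
    have h₃ := φ.src.hom.naturality k
    change φ.oper.map k ≫ φ.proj.inv.app y = φ.proj.inv.app x ≫ φ.pm.map k at h₂
    change φ.pm.map k ≫ φ.src.hom.app y = φ.src.hom.app x ≫ k at h₃
    change φ.oper.map k ≫ φ.proj.inv.app y ≫ φ.src.hom.app y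
      = (φ.proj.inv.app x ≫ φ.src.hom.app x) ≫ k
    rw [reassoc_of% h₂, h₃, Category.assoc]
  · exact (Category.comp_id _).trans (Iso.hom_inv_id_app_assoc φ.proj x _).symm
  · change g.functor.map (φ.proj.inv.app x ≫ φ.src.hom.app x) ≫
      inv (φ.tgt.inv.app x ≫ g.functor.map (φ.proj.inv.app x ≫ φ.src.hom.app x)) = φ.tgt.hom.app x
    rw [IsIso.comp_inv_eq]
    exact (Iso.hom_inv_id_app_assoc φ.tgt x _).symm

/-- Compatibility with `src` and `proj` makes every component of `m` an identity, so the target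
fillers coincide. -/
theorem eq_of_graphEqv_hom {θ τ : f ⟶ g} (m : graphEqv θ ⟶ graphEqv τ) : θ = τ := by
  apply Equivalence.hom_ext
  ext x
  have h₁ : m.pm.app x ≫ 𝟙 x = 𝟙 x := m.src x
  have h₂ : m.pm.app x ≫ 𝟙 x = 𝟙 x ≫ m.oper.app x := m.proj x
  have h₃ : g.functor.map (m.oper.app x) ≫ inv ((Equivalence.asNatTrans τ).app x)
    = inv ((Equivalence.asNatTrans θ).app x) := m.tgt x
  have h₄ : m.oper.app x = 𝟙 x := (Category.id_comp _).symm.trans (h₂.symm.trans h₁)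
  rw [h₄] at h₃
  have h₅ := g.functor.map_id x
  refine IsIso.inv_eq_inv.1 ?_
  exact h₃.symm.trans ((congrArg (· ≫ _) h₅).trans (Category.id_comp _))

theorem isEquivalence_graphEqv (f g : I ≌ J) :
    (Discrete.functor fun θ : f ⟶ g => graphEqv θ).IsEquivalence where
  faithful := ⟨fun {_ _ _ _} _ => Subsingleton.elim _ _⟩
  full := ⟨fun {_ _} m => ⟨Discrete.eqToHom (eq_of_graphEqv_hom m), graph_hom_ext _ _⟩⟩
  essSurj := ⟨fun φ => by
    obtain ⟨θ, ⟨m⟩⟩ : ∃ θ : f ⟶ g, Nonempty (φ ⟶ graphEqv θ) := exists_graphEqv φ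
    exact ⟨⟨θ⟩, ⟨(asIso m).symm⟩⟩⟩

theorem untruncatedUniversality : UntruncatedUniversality.{u} where
  terminal := eqv_terminal
  product := isEquivalence_whiskerRight
  graph := isEquivalence_graphEqv

theorem full_graphFunctor (I J : Type u) [Groupoid.{u} I] [Groupoid.{u} J] :
    (graphFunctor I J).Full where
  map_surjective {f g} φ := by
    obtain ⟨φ⟩ := φ
    obtain ⟨θ, ⟨m⟩⟩ : ∃ θ : f ⟶ g, Nonempty (φ ⟶ graphEqv θ) := exists_graphEqv φ
    exact ⟨θ, (Eqv.cell_eq m).symm⟩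

theorem faithful_graphFunctor (I J : Type u) [Groupoid.{u} I] [Groupoid.{u} J] :
    (graphFunctor I J).Faithful where
  map_injective {f g θ τ} h := by
    obtain ⟨m⟩ : IsIsomorphic (graphEqv θ) (graphEqv τ) := Quotient.exact h
    exact eq_of_graphEqv_hom m.hom

end GPoly

/-! ### Invertible polynomials have equivalences as their three legs. -/

section

variable {A B C : Type u} [Groupoid.{u} A] [Groupoid.{u} B] [Groupoid.{u} C]

/-- The quasi-inverse of `t` is the inverse of `π ⋙ t` followed by `π`. The counit is that of `π ⋙
t`; the unit is obtained by inserting `σ ⋙ π` in front and cancelling `π ⋙ t` against its inverse.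
-/
theorem isEquivalence_of_section {σ : B ⥤ A} {π : A ⥤ B} {t : B ⥤ C} (e : σ ⋙ π ≅ 𝟭 B)
    (h : (π ⋙ t).IsEquivalence) : t.IsEquivalence ∧ π.IsEquivalence := by
  have ht : t.IsEquivalence := Equivalence.isEquivalence_functor
    (CategoryTheory.Equivalence.mk t ((π ⋙ t).inv ⋙ π)
    (e.symm ≪≫ Functor.isoWhiskerRight (Functor.isoWhiskerLeft σ (π ⋙ t).asEquivalence.unitIso) π ≪≫
      Functor.isoWhiskerRight e (t ⋙ (π ⋙ t).inv ⋙ π))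
    (π ⋙ t).asEquivalence.counitIso)
  exact ⟨ht, Functor.isEquivalence_of_comp_right π t⟩

end

namespace GPoly

open CompOp Eqv

variable {I J K : Type u} [Groupoid.{u} I] [Groupoid.{u} J] [Groupoid.{u} K]

section Unit

variable {R : GPoly I I} (ρ : Eqv R (GPoly.unit I))

include ρ in
theorem isEquivalence_src_of_eqv_unit : R.src.IsEquivalence := by
  have : (ρ.pm ⋙ (GPoly.unit I).src).IsEquivalence := ρ.pm_isEquivalence
  exact Functor.isEquivalence_of_iso ρ.src

include ρ in
theorem isEquivalence_tgt_of_eqv_unit : R.tgt.IsEquivalence := by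
  have : (ρ.oper ⋙ (GPoly.unit I).tgt).IsEquivalence := ρ.oper_isEquivalence
  exact Functor.isEquivalence_of_iso ρ.tgt

include ρ in
theorem isEquivalence_proj_of_eqv_unit : R.proj.IsEquivalence := by
  have : (ρ.pm ⋙ (GPoly.unit I).proj).IsEquivalence := ρ.pm_isEquivalence
  have : (R.proj ⋙ ρ.oper).IsEquivalence := Functor.isEquivalence_of_iso ρ.proj
  have := ρ.oper_isEquivalence
  exact Functor.isEquivalence_of_comp_right R.proj ρ.oper

end Unit

variable (P : GPoly I J) (Q : GPoly J K)

/-- The operation of the second factor. -/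
noncomputable abbrev compOperSnd : CompOp P Q ⥤ Q.Op where
  obj o := o.oper
  map f := f.oper

/-- The parameter of the second factor. -/
noncomputable abbrev compPmSnd : CompPm P Q ⥤ Q.Pm where
  obj z := z.arg.pt
  map f := f.arg.pt

/-- The parameter of the first factor. -/
noncomputable abbrev compPmFst : CompPm P Q ⥤ P.Pm where
  obj z := z.par.pt
  map f := f.par.pt

/-- The parameter of the second factor lies over the operation of the second factor. -/
noncomputable abbrev compPmSndProj : compPmSnd P Q ⋙ Q.proj ≅ (P.comp Q).proj ⋙ compOperSnd P Q :=
  NatIso.ofComponents (fun z => asIso z.arg.path) fun f => f.arg.path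

/-- The two factors of a parameter have the same type in the middle. -/
noncomputable abbrev compPmFstTgt : compPmFst P Q ⋙ P.proj ⋙ P.tgt ≅ compPmSnd P Q ⋙ Q.src :=
  NatIso.ofComponents (fun z => asIso (P.tgt.map z.par.path ≫ z.oper.typ z.arg)) fun {z z'} f => by
    have h := f.par.path
    have h' := f.oper.typ f.arg
    change P.tgt.map (P.proj.map f.par.pt) ≫ P.tgt.map z'.par.path ≫ z'.oper.typ z'.arg
      = (P.tgt.map z.par.path ≫ z.oper.typ z.arg) ≫ Q.src.map f.arg.pt
    rw [← P.tgt.map_comp_assoc, h, P.tgt.map_comp, Category.assoc, Category.assoc, h']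

section

variable {P Q} (s : J ⥤ P.Op) (τ : s ⋙ P.tgt ≅ 𝟭 J)

/-- A section of the target of `P` provides operations of composites with `P`. -/
noncomputable abbrev operSection : Q.Op ⥤ CompOp P Q where
  obj c :=
    { oper := c
      fam := HFib.forget Q.proj c ⋙ Q.src ⋙ s
      typ := fun x => τ.hom.app (Q.src.obj x.pt)
      typ_naturality := fun f => τ.hom.naturality (Q.src.map f.pt) }
  map k :=
    { oper := k
      app := fun f => s.map (Q.src.map f.pt)
      naturality := fun g f h => by
        change s.map (Q.src.map g.pt) ≫ s.map (Q.src.map f.pt) ≫ s.map (Q.src.map h.pt) = _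
        rw [← s.map_comp, ← s.map_comp, ← Q.src.map_comp, ← Q.src.map_comp]
        exact congrArg (fun t => s.map (Q.src.map t)) (Category.assoc _ _ _).symm
      typ := fun f => τ.hom.naturality (Q.src.map f.pt) }
  map_id c := CompOp.hom_ext rfl fun _ => rfl
  map_comp k l := CompOp.hom_ext rfl fun {x y} f => by
    refine Eq.trans ?_ (CompOp.comp_app _ _ _).symm
    change s.map (Q.src.map f.pt) = s.map (Q.src.map (𝟙 x.pt)) ≫ s.map (Q.src.map f.pt)
    rw [Q.src.map_id, s.map_id, Category.id_comp]

variable (r : P.Op ⥤ P.Pm) (υ : r ⋙ P.proj ≅ 𝟭 P.Op)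

/-- Sections of the target and of the projection of `P` provide parameters of composites with `P`. -/
noncomputable abbrev pmSection : Q.Pm ⥤ CompPm P Q where
  obj x := ⟨(operSection s τ).obj (Q.proj.obj x), ⟨x, 𝟙 _⟩,
    ⟨r.obj (s.obj (Q.src.obj x)), υ.hom.app (s.obj (Q.src.obj x))⟩⟩
  map k :=
    { oper := (operSection s τ).map (Q.proj.map k)
      arg := ⟨k, (Category.comp_id _).trans (Category.id_comp _).symm⟩
      par := ⟨r.map (s.map (Q.src.map k)), υ.hom.naturality (s.map (Q.src.map k))⟩ }
  map_id x := CompPm.hom_ext ((congrArg (operSection s τ).map (Q.proj.map_id x)).trans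
      ((operSection s τ).map_id _)) rfl (by
    change r.map (s.map (Q.src.map (𝟙 x))) = 𝟙 _
    simp)
  map_comp k l := CompPm.hom_ext ((congrArg (operSection s τ).map (Q.proj.map_comp k l)).trans
      ((operSection s τ).map_comp _ _)) rfl (by
    change r.map (s.map (Q.src.map (k ≫ l))) = r.map (s.map (Q.src.map k)) ≫
      r.map (s.map (Q.src.map l))
    simp)

end

section

variable {P : GPoly I J} {Q : GPoly J I} (ρ : Eqv (P.comp Q) (GPoly.unit I))
  (ς : Eqv (Q.comp P) (GPoly.unit J))

-- The target of `P.comp Q` is the forgetful functor to the operations of `Q` followed by the target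
-- of `Q`. The target of `P` has a section, supplied by `ς`, and applying it to the sources of
-- parameters yields a section of the forgetful functor.
include ρ ς in
theorem isEquivalence_tgt : Q.tgt.IsEquivalence ∧ (compOperSnd P Q).IsEquivalence := by
  have h : (compOperSnd P Q ⋙ Q.tgt).IsEquivalence := isEquivalence_tgt_of_eqv_unit ρ
  have h' : (compOperSnd Q P ⋙ P.tgt).IsEquivalence := isEquivalence_tgt_of_eqv_unit ς
  let s : J ⥤ P.Op := (compOperSnd Q P ⋙ P.tgt).inv ⋙ compOperSnd Q P
  let τ : s ⋙ P.tgt ≅ 𝟭 J := (compOperSnd Q P ⋙ P.tgt).asEquivalence.counitIso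
  exact isEquivalence_of_section (σ := operSection s τ) (Iso.refl _) h

-- The same argument on parameters: a section now also needs a section of the projection of `P`,
-- which `Q.comp P` supplies because its forgetful functors are already understood on operations.
include ρ ς in
theorem isEquivalence_proj : Q.proj.IsEquivalence ∧ (compPmSnd P Q).IsEquivalence := by
  have h := (isEquivalence_tgt ρ ς).2
  have h' := (isEquivalence_tgt ς ρ).2
  have := isEquivalence_proj_of_eqv_unit ρ
  have := isEquivalence_proj_of_eqv_unit ς
  have k : (compPmSnd P Q ⋙ Q.proj).IsEquivalence :=
    Functor.isEquivalence_of_iso (compPmSndProj P Q).symm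
  have k' : (compPmSnd Q P ⋙ P.proj).IsEquivalence :=
    Functor.isEquivalence_of_iso (compPmSndProj Q P).symm
  have l' : (compOperSnd Q P ⋙ P.tgt).IsEquivalence := isEquivalence_tgt_of_eqv_unit ς
  let s : J ⥤ P.Op := (compOperSnd Q P ⋙ P.tgt).inv ⋙ compOperSnd Q P
  let τ : s ⋙ P.tgt ≅ 𝟭 J := (compOperSnd Q P ⋙ P.tgt).asEquivalence.counitIso
  let r : P.Op ⥤ P.Pm := (compPmSnd Q P ⋙ P.proj).inv ⋙ compPmSnd Q P
  let υ : r ⋙ P.proj ≅ 𝟭 P.Op := (compPmSnd Q P ⋙ P.proj).asEquivalence.counitIso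
  exact isEquivalence_of_section (σ := pmSection s τ r υ) (Iso.refl _) k

-- Since the projection and target of `P` and the forgetful functor `compPmSnd` are equivalences,
-- `Q.src` is, up to these, the functor `compPmFst`; and that is faithful because `compPmFst`
-- followed by `P.src` is an equivalence.
include ρ ς in
theorem faithful_src : Q.src.Faithful ∧ (compPmFst P Q).Faithful := by
  have := (isEquivalence_tgt ς ρ).1
  have := (isEquivalence_proj ς ρ).1
  have := (isEquivalence_proj ρ ς).2
  have h : (compPmFst P Q ⋙ P.src).IsEquivalence := isEquivalence_src_of_eqv_unit ρ
  have h' : (compPmFst P Q).Faithful := Functor.Faithful.of_comp _ P.src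
  have k : (compPmSnd P Q ⋙ Q.src).Faithful := Functor.Faithful.of_iso (compPmFstTgt P Q)
  refine ⟨Functor.Faithful.of_iso (F := (compPmSnd P Q).inv ⋙ compPmSnd P Q ⋙ Q.src)
    (Functor.isoWhiskerRight (compPmSnd P Q).asEquivalence.counitIso Q.src), h'⟩

-- Faithfulness of `P.src`, by symmetry, makes `compPmFst` full, hence `Q.src` full. It is
-- essentially surjective because the source of `Q.comp P` factors through it.
include ρ ς in
theorem isEquivalence_src : Q.src.IsEquivalence := by
  have := (isEquivalence_tgt ς ρ).1
  have := (isEquivalence_proj ς ρ).1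
  have := (isEquivalence_proj ρ ς).2
  have := (faithful_src ρ ς).1
  have := (faithful_src ς ρ).1
  have h : (compPmFst P Q ⋙ P.src).IsEquivalence := isEquivalence_src_of_eqv_unit ρ
  have h' : (compPmFst P Q).Full := Functor.Full.of_comp_faithful _ P.src
  have k : (compPmSnd P Q ⋙ Q.src).Full := Functor.Full.of_iso (compPmFstTgt P Q)
  have full : Q.src.Full :=
    Functor.Full.of_iso (F := (compPmSnd P Q).inv ⋙ compPmSnd P Q ⋙ Q.src)
      (Functor.isoWhiskerRight (compPmSnd P Q).asEquivalence.counitIso Q.src)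
  have l : (compPmFst Q P ⋙ Q.src).IsEquivalence := isEquivalence_src_of_eqv_unit ς
  have : Q.src.EssSurj := ⟨fun i => by
    obtain ⟨z, e⟩ := l.essSurj.mem_essImage i
    exact ⟨(compPmFst Q P).obj z, e⟩⟩
  exact { }

end

/-- A polynomial all of whose functors are equivalences is the polynomial of an equivalence of
groupoids. -/
theorem exists_eqv_graphPoly (P : GPoly I J) [P.src.IsEquivalence] [P.proj.IsEquivalence]
    [P.tgt.IsEquivalence] : ∃ f : I ≌ J, Nonempty (Eqv (graphPoly f) P) :=
  ⟨(P.src.inv ⋙ P.proj ⋙ P.tgt).asEquivalence, ⟨{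
    oper := P.src.inv ⋙ P.proj
    pm := P.src.inv
    oper_isEquivalence := inferInstance
    pm_isEquivalence := inferInstance
    src := P.src.asEquivalence.counitIso
    proj := Iso.refl _
    tgt := Iso.refl _ }⟩⟩

theorem exists_cell_graph {P : GPoly I J} {Q : GPoly J I} (ρ : P.comp Q ⟶ GPoly.unit I)
    (ς : Q.comp P ⟶ GPoly.unit J) : ∃ f : I ≌ J, Nonempty (graph f ⟶ P) := by
  obtain ⟨ρ⟩ := ρ
  obtain ⟨ς⟩ := ς
  have := isEquivalence_src ς ρ
  have := (isEquivalence_proj ς ρ).1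
  have := (isEquivalence_tgt ς ρ).1
  obtain ⟨f, ⟨φ⟩⟩ := exists_eqv_graphPoly P
  exact ⟨f, ⟨φ.cell⟩⟩

/-! ### Inverses of the polynomials of equivalences. -/

section

variable (f : I ≌ J)

/-- The polynomial of an equivalence of groupoids is inverted by restriction along it. -/
noncomputable abbrev graphEmbedding : Embedding f.functor (GPoly.unit I) (graphPoly f) where
  oper := 𝟭 I
  pm := 𝟭 I
  src := Iso.refl _
  proj := Iso.refl _
  tgt := Iso.refl _
  oper_mem {c _} _ := ⟨c, ⟨Iso.refl c⟩⟩
  pm_mem {p _} _ := ⟨p, ⟨Iso.refl p⟩⟩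

/-- Over the fully faithful `f.functor` the identity polynomial embeds onto the whole of `graphPoly
f`, so it is identified with the restriction. -/
noncomputable abbrev graphUnit : GPoly.unit I ⟶ (graphPoly f).comp (restr f.functor) :=
  (graphEmbedding f).restrict.cell

/-- Restriction along the inverse of an equivalence of groupoids. -/
noncomputable abbrev restrInverse : Eqv (restr f.inverse) (graphPoly f) where
  oper := f.inverse
  pm := f.inverse
  oper_isEquivalence := inferInstance
  pm_isEquivalence := inferInstance
  src := Iso.refl _
  proj := Iso.refl _
  tgt := f.counitIso

/-- The restriction that inverts the polynomial of `f.symm` is restriction along `f.inverse`, and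
this is equivalent to the polynomial of `f`. -/
noncomputable abbrev graphCounit : GPoly.unit J ⟶ (graphPoly f.symm).comp (graphPoly f) :=
  graphUnit f.symm ≫ Cell.whiskerLeft (graphPoly f.symm)
    (show restr f.symm.functor ⟶ graphPoly f from (restrInverse f).cell)

theorem isFinitary_restr (i : J ⥤ K) : (restr i).IsFinitary :=
  isFinitary_iff.2 fun c => isFiniteDiscrete_hfib_id (X := J) c

end

end GPoly

/-! ### Internal equivalences in a bicategory and the final assembly. -/

section

variable {B : Type*} [Bicategory B]

/-- A right inverse `Q` is isomorphic to a left inverse `Q'`, by cancelling in `Q' ≫ P ≫ Q`. -/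
theorem IsInternalEquivalence.exists_inverse {I J : B} {P : I ⟶ J} (h : IsInternalEquivalence P) :
    ∃ Q : J ⟶ I, Nonempty (P ≫ Q ≅ 𝟙 I) ∧ Nonempty (Q ≫ P ≅ 𝟙 J) := by
  obtain ⟨Q, Q', ⟨e⟩, ⟨e'⟩⟩ := h
  refine ⟨Q, ⟨e⟩, ⟨?_ ≪≫ e'⟩⟩
  exact Bicategory.whiskerRightIso ((Bicategory.leftUnitor Q).symm ≪≫
    Bicategory.whiskerRightIso e'.symm Q ≪≫ Bicategory.associator Q' P Q ≪≫
    Bicategory.whiskerLeftIso Q' e ≪≫ Bicategory.rightUnitor Q') P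

theorem IsInternalEquivalence.of_iso {I J : B} {P P' : I ⟶ J} (h : IsInternalEquivalence P)
    (i : P ≅ P') : IsInternalEquivalence P' := by
  obtain ⟨Q, Q', ⟨e⟩, ⟨e'⟩⟩ := h
  exact ⟨Q, Q', ⟨Bicategory.whiskerRightIso i.symm Q ≪≫ e⟩,
    ⟨Bicategory.whiskerLeftIso Q' i.symm ≪≫ e'⟩⟩

end

namespace GPoly

variable {I J K : Type u} [Groupoid.{u} I] [Groupoid.{u} J] [Groupoid.{u} K]

/-- The polynomial without operations. -/
abbrev emptyPoly (I : Type u) [Groupoid.{u} I] : GPoly I (Discrete PEmpty.{u + 1}) where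
  Op := Discrete PEmpty
  Pm := Discrete PEmpty
  src := emptyFunctor _ _
  proj := 𝟭 _
  tgt := 𝟭 _

theorem isLocallyGroupoid_grpds : Bicategory.IsLocallyGroupoid (Grpds coherence.{u}) :=
  fun I J => ⟨fun f => isIso_cell (I := I.carrier) (J := J.carrier) f⟩

/-- 2-cells as isomorphisms of 1-cells of the bicategory. -/
noncomputable abbrev cellIso {I J : Grpds coherence.{u}} {P Q : I ⟶ J}
    (f : P ⟶ Q) : P ≅ Q :=
  haveI := isIso_cell (I := I.carrier) (J := J.carrier) f
  asIso f

theorem isCartesian : (cartesianData coherence.{u}).IsCartesian where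
  terminal I := (equiv_punit_iff_unique _).2
    ⟨⟨emptyPoly I.carrier⟩, nonempty_unique_cell_of_terminal (I := I.carrier)⟩
  product I J K :=
    { faithful := ⟨fun {P Q} f g h => cell_eq_of_whiskerRight_eq (congrArg Prod.fst h :)
        (congrArg Prod.snd h :)⟩
      full := ⟨fun {P Q} f => by
        obtain ⟨m, h, h'⟩ := exists_cell (P := P) (P' := Q) f.1 f.2
        exact ⟨m, Prod.ext h h'⟩⟩
      essSurj := ⟨fun ⟨P, Q⟩ => ⟨pairing P Q, ⟨Iso.prod (cellIso (pairingInl P Q)).symm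
        (cellIso (pairingInr P Q)).symm⟩⟩⟩ }
  pair_projl P Q := ⟨(cellIso (pairingInl P Q)).symm⟩
  pair_projr P Q := ⟨(cellIso (pairingInr P Q)).symm⟩

theorem isInternalEquivalence_graph {I J : Grpds coherence.{u}} (f : I.carrier ≌ J.carrier) :
    IsInternalEquivalence ((graphs coherence I J).obj f) :=
  ⟨restr f.functor, graph f.symm, ⟨(cellIso (graphUnit f)).symm⟩,
    ⟨(cellIso (graphCounit f)).symm⟩⟩

theorem presentsEquivalences (I J : Grpds coherence.{u}) :
    PresentsEquivalences (graphs coherence I J) where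
  full := full_graphFunctor I.carrier J.carrier
  faithful := faithful_graphFunctor I.carrier J.carrier
  essImage P := by
    refine ⟨fun ⟨f, ⟨i⟩⟩ => (isInternalEquivalence_graph f).of_iso i, fun h => ?_⟩
    obtain ⟨Q, ⟨e⟩, ⟨e'⟩⟩ := h.exists_inverse
    -- One two-sided inverse is needed here, since the argument on the legs uses both composites of
    -- the same pair.
    obtain ⟨f, ⟨i⟩⟩ := exists_cell_graph e.hom e'.hom
    exact ⟨f, ⟨cellIso i⟩⟩

/-- 2-cells between finitary polynomials as isomorphisms. -/
noncomputable abbrev finCellIso {I J : FinGrpds coherence.{u} finitaryStable} {P Q : I ⟶ J}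
    (f : P.obj ⟶ Q.obj) : P ≅ Q :=
  ObjectProperty.isoMk _ (cellIso f)

theorem isLocallyGroupoid_finGrpds :
    Bicategory.IsLocallyGroupoid (FinGrpds coherence.{u} finitaryStable) :=
  fun _ _ => ⟨fun f => (finCellIso f.hom).isIso_hom⟩

/-- All 2-cells between finitary polynomials are retained, so the previous witnesses work once the
empty polynomial and the pairings are known to be finitary. -/
theorem isCartesian_finitary : (finCartesianData coherence.{u} finitaryStable).IsCartesian where
  terminal I := by
    refine (equiv_punit_iff_unique _).2 ⟨⟨⟨emptyPoly I.obj.carrier, fun c => c.as.elim⟩⟩, ?_⟩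
    intro P Q
    obtain ⟨h⟩ := nonempty_unique_cell_of_terminal (I := I.obj.carrier) P.obj Q.obj
    exact ⟨⟨⟨ObjectProperty.homMk h.default⟩, fun f => ObjectProperty.hom_ext _ (h.uniq f.hom)⟩⟩
  product I J K :=
    { faithful := ⟨fun {P Q} f g h => ObjectProperty.hom_ext _ (cell_eq_of_whiskerRight_eq
        (congrArg (fun t => t.1.hom) h :) (congrArg (fun t => t.2.hom) h :))⟩
      full := ⟨fun {P Q} f => by
        obtain ⟨m, h, h'⟩ := exists_cell (P := P.obj) (P' := Q.obj) f.1.hom f.2.hom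
        exact ⟨ObjectProperty.homMk m, Prod.ext (ObjectProperty.hom_ext _ h)
          (ObjectProperty.hom_ext _ h')⟩⟩
      essSurj := ⟨fun ⟨P, Q⟩ => ⟨⟨pairing P.obj Q.obj, isFinitary_pairing P.property Q.property⟩,
        ⟨Iso.prod (finCellIso (pairingInl P.obj Q.obj)).symm
          (finCellIso (pairingInr P.obj Q.obj)).symm⟩⟩⟩ }
  pair_projl P Q := ⟨(finCellIso (pairingInl P.obj Q.obj)).symm⟩
  pair_projr P Q := ⟨(finCellIso (pairingInr P.obj Q.obj)).symm⟩

theorem isInternalEquivalence_finGraph {I J : FinGrpds coherence.{u} finitaryStable}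
    (f : I.obj.carrier ≌ J.obj.carrier) :
    IsInternalEquivalence ((finGraphs coherence finitaryStable I J).obj f) :=
  ⟨⟨restr f.functor, isFinitary_restr _⟩, ⟨graph f.symm, finitaryStable.graph _⟩,
    ⟨(finCellIso (graphUnit f)).symm⟩, ⟨(finCellIso (graphCounit f)).symm⟩⟩

theorem presentsEquivalences_finitary (I J : FinGrpds coherence.{u} finitaryStable) :
    PresentsEquivalences (finGraphs coherence finitaryStable I J) where
  full := ⟨fun {f g} m => by
    obtain ⟨θ, h⟩ := (full_graphFunctor I.obj.carrier J.obj.carrier).map_surjective m.hom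
    exact ⟨θ, ObjectProperty.hom_ext _ h⟩⟩
  faithful := ⟨fun {f g} θ τ h => (faithful_graphFunctor I.obj.carrier J.obj.carrier).map_injective
    (congrArg (fun t => t.hom) h :)⟩
  essImage P := by
    refine ⟨fun ⟨f, ⟨i⟩⟩ => (isInternalEquivalence_finGraph f).of_iso i, fun h => ?_⟩
    obtain ⟨Q, ⟨e⟩, ⟨e'⟩⟩ := h.exists_inverse
    obtain ⟨f, ⟨i⟩⟩ := exists_cell_graph e.hom.hom e'.hom.hom
    exact ⟨f, ⟨finCellIso i⟩⟩

end GPoly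

theorem mainTheorem6 :
    GPoly.UntruncatedUniversality.{u} ∧
    ∃ (h : GPoly.FinitaryStable.{u}) (D : GPoly.Coherence.{u}),
      (Bicategory.IsLocallyGroupoid (GPoly.Grpds D) ∧
        (GPoly.cartesianData D).IsCartesian ∧
        ∀ I J : GPoly.Grpds D, PresentsEquivalences (GPoly.graphs D I J)) ∧
      (Bicategory.IsLocallyGroupoid (GPoly.FinGrpds D h) ∧
        (GPoly.finCartesianData D h).IsCartesian ∧
        ∀ I J : GPoly.FinGrpds D h, PresentsEquivalences (GPoly.finGraphs D h I J)) :=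
  ⟨GPoly.untruncatedUniversality, GPoly.finitaryStable, GPoly.coherence,
    ⟨GPoly.isLocallyGroupoid_grpds, GPoly.isCartesian, GPoly.presentsEquivalences⟩,
    ⟨GPoly.isLocallyGroupoid_finGrpds, GPoly.isCartesian_finitary,
      GPoly.presentsEquivalences_finitary⟩⟩
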